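/- Let $S$ be an inverse semigroup acting on a locally compact Hausdorff space $X$ by partial homeomorphisms $\vartheta_a\colon D_{a^*a}\xrightarrow{\sim}D_{aa^*}$ ($a\in S$) between open subsets of $X$, with $\vartheta_a\circ\vartheta_b=\vartheta_{ab}$ as partial maps, and assume that the domains cover $X$, that is, $\bigcup_{a\in S}D_{a^*a}=X$. Identify $C_0(D_e)$ with the ideal of functions in $C_0(X)$ that vanish outside $D_e$. The crossed product $S\ltimes C_0(X)$ is the universal C*-algebra generated by expressions $f\delta_a$ with $a\in S$ and $f\in C_0(D_{aa^*})$, subject to the following relations: $f\mapsto f\delta_a$ is linear; $f\delta_a=f\delta_b$ if $a\le b$ and $f\in C_0(D_{aa^*})$; $(f\delta_a)(g\delta_b)=\bigl(((f\circ\vartheta_a)\cdot g)\circ\vartheta_{a^*}\bigr)\delta_{ab}$; and $(f\delta_a)^*=(\overline{f}\circ\vartheta_a)\delta_{a^*}$. A representation of a C*-algebra $B$ on a (right) Hilbert $D$-module $\mathcal F$ is a nondegenerate $^*$-homomorphism from $B$ to the adjointable operators $\mathbb B(\mathcal F)$. A covariant representation of $(X,S,\vartheta)$ on $\mathcal F$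 consists of a representation $\varphi\colon C_0(X)\to\mathbb B(\mathcal F)$ and unitaries $U_a\colon\mathcal F_{a^*a}\xrightarrow{\sim}\mathcal F_{aa^*}$ for $a\in S$, where $\mathcal F_e:=\varphi(C_0(D_e))\mathcal F$, such that 1. $U_b$ restricts to $U_a$ if $a\le b$; 2. $U_a^*=U_{a^*}$ for all $a\in S$; 3. $U_aU_b=U_{ab}$ for all $a,b\in S$ with $a^*a=bb^*$; 4. $U_a\varphi(f)U_a^*=\varphi(f\circ\vartheta_{a^*})$ for all $a\in S$ and $f\in C_0(D_{a^*a})$. Theorem. For all C*-algebras $D$ and Hilbert $D$-modules $\mathcal F$, there is a bijection $(\varphi,U)\mapsto U\ltimes\varphi$ from the covariant representations of $(X,S,\vartheta)$ on $\mathcal F$ to the representations of $S\ltimes C_0(X)$ on $\mathcal F$, with $(U\ltimes\varphi)(f\delta_a)\xi=\varphi(f)U_a\xi$ for $a\in S$, $f\in C_0(D_{aa^*})$, $\xi\in\mathcal F_{a^*a}$. These bijections are natural in the following two ways: (i) Let $V\colon\mathcal F_1\hookrightarrow\mathcal F_2$ be an isometry (an inner product preserving linear map) between Hilbert $D$-modules.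 Then $V$ intertwines two representations of $S\ltimes C_0(X)$ on $\mathcal F_1$ and $\mathcal F_2$ if and only if it intertwines the corresponding covariant representations. (ii) Let $\mathcal E$ be a C*-correspondence from $D$ to a C*-algebra $D'$, that is, a Hilbert $D'$-module with a nondegenerate $^*$-homomorphism $D\to\mathbb B(\mathcal E)$. Each covariant representation $(\varphi,U)$ on $\mathcal F$ induces a unique covariant representation $(\varphi',U')$ on the interior tensor product $\mathcal F\otimes_D\mathcal E$ with $\varphi'(f)(\xi\otimes\eta)=\varphi(f)\xi\otimes\eta$ for $f\in C_0(X)$, $\xi\in\mathcal F$, $\eta\in\mathcal E$, and $U'_a(\zeta\otimes\eta)=U_a\zeta\otimes\eta$ for $a\in S$, $\zeta\in\mathcal F_{a^*a}$, $\eta\in\mathcal E$. Each representation $\varrho$ of $S\ltimes C_0(X)$ on $\mathcal F$ induces a unique representation $\varrho'$ on $\mathcal F\otimes_D\mathcal E$ with $\varrho'(b)(\xi\otimes\eta)=\varrho(b)\xi\otimes\eta$ for $b\in S\ltimes C_0(X)$, $\xi\in\mathcal F$, $\eta\in\mathcal E$. The bijections are compatible with induction: a covariant representation on $\mathcal F\otimes_D\mathcal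 E$ is induced by one on $\mathcal F$ if and only if the corresponding representations of $S\ltimes C_0(X)$ are related in this way. -/

import Mathlib

noncomputable section

/-! ### C*-seminorms and their Hausdorff completions -/

/-- A C*-seminorm on a complex *-algebra. -/
structure CStarSeminorm (𝒜 : Type*) [NonUnitalRing 𝒜] [StarRing 𝒜] [Module ℂ 𝒜]
    extends Seminorm ℂ 𝒜 where
  mul_le' : ∀ x y, toFun (x * y) ≤ toFun x * toFun y
  star_mul_self' : ∀ x, toFun (star x * x) = toFun x ^ 2

namespace CStarSeminorm

section Basic

variable {𝒜 : Type*} [NonUnitalRing 𝒜] [StarRing 𝒜] [Module ℂ 𝒜]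

instance : CoeFun (CStarSeminorm 𝒜) (fun _ => 𝒜 → ℝ) := ⟨fun p => p.toSeminorm⟩

variable (p : CStarSeminorm 𝒜)

theorem mul_le (x y : 𝒜) : p (x * y) ≤ p x * p y := p.mul_le' x y

theorem star_mul_self (x : 𝒜) : p (star x * x) = p x ^ 2 := p.star_mul_self' x

theorem le_star (x : 𝒜) : p x ≤ p (star x) := by
  rcases (apply_nonneg p.toSeminorm x).eq_or_lt with h | h
  · rw [← h]; exact apply_nonneg p.toSeminorm _
  · have h1 := p.mul_le (star x) x
    rw [p.star_mul_self, pow_two] at h1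
    exact le_of_mul_le_mul_right h1 h

theorem map_star (x : 𝒜) : p (star x) = p x :=
  le_antisymm (by simpa using p.le_star (star x)) (p.le_star x)

/-- The algebra `𝒜`, equipped with the topology of the seminorm `p`. -/
@[nolint unusedArguments]
def Carrier (_p : CStarSeminorm 𝒜) : Type _ := 𝒜

instance instNonUnitalRingCarrier : NonUnitalRing p.Carrier := inferInstanceAs (NonUnitalRing 𝒜)

instance : NonUnitalSeminormedRing p.Carrier where
  __ := p.instNonUnitalRingCarrier
  norm x := p x
  dist x y := p (-x + y)
  dist_self x := (congrArg p (neg_add_cancel (x : 𝒜))).trans (map_zero p.toSeminorm)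
  dist_comm := fun x y : 𝒜 => by
    change p (-x + y) = p (-y + x)
    rw [← map_neg_eq_map p.toSeminorm (-x + y)]; congr 1; abel
  dist_triangle := fun x y z : 𝒜 => by
    change p (-x + z) ≤ p (-x + y) + p (-y + z)
    have h : -x + z = (-x + y) + (-y + z) := by abel
    rw [h]; exact map_add_le_add p.toSeminorm _ _
  dist_eq x y := rfl
  norm_mul_le x y := p.mul_le x y

theorem norm_def (x : p.Carrier) : ‖x‖ = p x := rfl

instance instStarRingCarrier : StarRing p.Carrier := inferInstanceAs (StarRing 𝒜)

instance instModuleCarrier : Module ℂ p.Carrier := inferInstanceAs (Module ℂ 𝒜)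

instance : NormedSpace ℂ p.Carrier where
  __ := p.instModuleCarrier
  norm_smul_le c x := (map_smul_eq_mul p.toSeminorm c x).le

instance [IsScalarTower ℂ 𝒜 𝒜] : IsScalarTower ℂ p.Carrier p.Carrier where
  smul_assoc := fun (c : ℂ) (x y : 𝒜) => smul_assoc c x y
instance [SMulCommClass ℂ 𝒜 𝒜] : SMulCommClass ℂ p.Carrier p.Carrier where
  smul_comm := fun (c : ℂ) (x y : 𝒜) => smul_comm c x y
instance [StarModule ℂ 𝒜] : StarModule ℂ p.Carrier where
  star_smul := fun (c : ℂ) (x : 𝒜) => StarModule.star_smul (R := ℂ) (A := 𝒜) c x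

instance : NormedStarGroup p.Carrier where
  norm_star_le x := (p.map_star x).le

/-- The Hausdorff completion of `𝒜` with respect to the C*-seminorm `p`. -/
def Completion : Type _ := UniformSpace.Completion p.Carrier

instance : NormedAddCommGroup p.Completion :=
  inferInstanceAs (NormedAddCommGroup (UniformSpace.Completion p.Carrier))
instance : NormedSpace ℂ p.Completion :=
  inferInstanceAs (NormedSpace ℂ (UniformSpace.Completion p.Carrier))
instance : CompleteSpace p.Completion :=
  inferInstanceAs (CompleteSpace (UniformSpace.Completion p.Carrier))

/-- The canonical map from `𝒜` to the completion. -/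
def toCompletion : 𝒜 →ₗ[ℂ] p.Completion :=
  (UniformSpace.Completion.toComplₗᵢ (𝕜 := ℂ) (E := p.Carrier)).toLinearMap

theorem isDenseInducing : IsDenseInducing (fun x : p.Carrier => p.toCompletion x) :=
  UniformSpace.Completion.isDenseInducing_coe

theorem continuous_toCompletion : Continuous (fun x : p.Carrier => p.toCompletion x) :=
  p.isDenseInducing.continuous

theorem norm_toCompletion (x : 𝒜) : ‖p.toCompletion x‖ = p x :=
  UniformSpace.Completion.norm_coe (E := p.Carrier) x

theorem denseRange_toCompletion : DenseRange p.toCompletion :=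
  p.isDenseInducing.dense

@[elab_as_elim]
theorem induction {P : p.Completion → Prop} (x : p.Completion) (hc : IsClosed {x | P x})
    (h : ∀ a : 𝒜, P (p.toCompletion a)) : P x :=
  UniformSpace.Completion.induction_on x hc h

@[elab_as_elim]
theorem induction₂ {P : p.Completion → p.Completion → Prop} (x y : p.Completion)
    (hc : IsClosed {x : p.Completion × p.Completion | P x.1 x.2})
    (h : ∀ a b : 𝒜, P (p.toCompletion a) (p.toCompletion b)) : P x y :=
  UniformSpace.Completion.induction_on₂ x y hc h

@[elab_as_elim]
theorem induction₃ {P : p.Completion → p.Completion → p.Completion → Prop}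
    (x y z : p.Completion)
    (hc : IsClosed {x : p.Completion × p.Completion × p.Completion | P x.1 x.2.1 x.2.2})
    (h : ∀ a b c : 𝒜, P (p.toCompletion a) (p.toCompletion b) (p.toCompletion c)) :
    P x y z :=
  UniformSpace.Completion.induction_on₃ x y z hc h

instance : Mul p.Completion where
  mul x y := (p.isDenseInducing.prodMap p.isDenseInducing).extend
    (fun z : p.Carrier × p.Carrier => p.toCompletion (z.1 * z.2)) (x, y)

theorem toCompletion_mul (x y : 𝒜) :
    p.toCompletion (x * y) = p.toCompletion x * p.toCompletion y :=
  ((p.isDenseInducing.prodMap p.isDenseInducing).extend_eq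
    (f := fun z : p.Carrier × p.Carrier => p.toCompletion (z.1 * z.2))
    (p.continuous_toCompletion.comp continuous_mul) (x, y)).symm

instance : ContinuousMul p.Completion where
  continuous_mul := by
    let i : p.Carrier →+ p.Completion := p.toCompletion.toAddMonoidHom
    let m : p.Carrier →+ p.Carrier →+ p.Completion :=
      (AddMonoidHom.mul : p.Carrier →+ p.Carrier →+ p.Carrier).compr₂ i
    have : Continuous fun z : p.Carrier × p.Carrier => m z.1 z.2 :=
      p.continuous_toCompletion.comp continuous_mul
    have di : IsDenseInducing i := p.isDenseInducing
    exact (di.extend_Z_bilin di this :)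

instance : Star p.Completion where
  star := UniformSpace.Completion.map (fun x : p.Carrier => star x)

theorem uniformContinuous_star : UniformContinuous (fun x : p.Carrier => star x) :=
  (star_isometry (E := p.Carrier)).uniformContinuous

theorem toCompletion_star (x : 𝒜) : p.toCompletion (star x) = star (p.toCompletion x) :=
  (UniformSpace.Completion.map_coe p.uniformContinuous_star x).symm

instance : ContinuousStar p.Completion where
  continuous_star := UniformSpace.Completion.continuous_map

end Basic

section Algebra

variable {𝒜 : Type*} [NonUnitalRing 𝒜] [StarRing 𝒜] [Module ℂ 𝒜] (p : CStarSeminorm 𝒜)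

instance : NonUnitalRing p.Completion where
  left_distrib x y z := p.induction₃ x y z (isClosed_eq (by fun_prop) (by fun_prop))
    fun a b c => by simp only [← map_add, ← toCompletion_mul, mul_add]
  right_distrib x y z := p.induction₃ x y z (isClosed_eq (by fun_prop) (by fun_prop))
    fun a b c => by simp only [← map_add, ← toCompletion_mul, add_mul]
  zero_mul x := p.induction x (isClosed_eq (by fun_prop) (by fun_prop))
    fun a => by rw [← map_zero p.toCompletion, ← toCompletion_mul, zero_mul]
  mul_zero x := p.induction x (isClosed_eq (by fun_prop) (by fun_prop))
    fun a => by rw [← map_zero p.toCompletion, ← toCompletion_mul, mul_zero]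
  mul_assoc x y z := p.induction₃ x y z (isClosed_eq (by fun_prop) (by fun_prop))
    fun a b c => by simp only [← toCompletion_mul, mul_assoc]

instance : NonUnitalNormedRing p.Completion where
  __ := (inferInstance : NormedAddCommGroup p.Completion)
  __ := (inferInstance : NonUnitalRing p.Completion)
  norm_mul_le x y := p.induction₂ x y (isClosed_le (by fun_prop) (by fun_prop))
    fun a b => by
      simp only [← toCompletion_mul, norm_toCompletion]; exact p.mul_le a b

instance : StarRing p.Completion where
  star_involutive x := p.induction x (isClosed_eq (by fun_prop) (by fun_prop))
    fun a => by simp only [← toCompletion_star, star_star]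
  star_mul x y := p.induction₂ x y (isClosed_eq (by fun_prop) (by fun_prop))
    fun a b => by simp only [← toCompletion_star, ← toCompletion_mul, star_mul]
  star_add x y := p.induction₂ x y (isClosed_eq (by fun_prop) (by fun_prop))
    fun a b => by simp only [← toCompletion_star, ← map_add, star_add]

theorem continuous_smul_left (c : ℂ) : Continuous (fun x : p.Completion => c • x) :=
  continuous_const_smul (T := UniformSpace.Completion p.Carrier) c

instance : CStarRing p.Completion where
  norm_mul_self_le x := p.induction x (isClosed_le (by fun_prop) (by fun_prop))
    fun a => by
      rw [← toCompletion_star, ← toCompletion_mul, norm_toCompletion, norm_toCompletion,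
        p.star_mul_self, pow_two]

instance [IsScalarTower ℂ 𝒜 𝒜] : IsScalarTower ℂ p.Completion p.Completion where
  smul_assoc c x y := p.induction₂ x y (isClosed_eq (((p.continuous_smul_left c).comp continuous_fst).mul continuous_snd)
    ((p.continuous_smul_left c).comp continuous_mul))
    fun a b => by
      rw [smul_eq_mul, smul_eq_mul, ← map_smul, ← toCompletion_mul, ← toCompletion_mul,
        smul_mul_assoc, map_smul]

instance [SMulCommClass ℂ 𝒜 𝒜] : SMulCommClass ℂ p.Completion p.Completion where
  smul_comm c x y := p.induction₂ x y (isClosed_eq ((p.continuous_smul_left c).comp continuous_mul)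
    (continuous_fst.mul ((p.continuous_smul_left c).comp continuous_snd)))
    fun a b => by
      rw [smul_eq_mul, smul_eq_mul, ← map_smul, ← toCompletion_mul, ← toCompletion_mul,
        mul_smul_comm, map_smul]

instance [StarModule ℂ 𝒜] : StarModule ℂ p.Completion where
  star_smul c x := p.induction x (isClosed_eq (p.continuous_smul_left c).star
    ((p.continuous_smul_left (star c)).comp continuous_star))
    fun a => by rw [← map_smul, ← toCompletion_star, star_smul, map_smul, toCompletion_star]

instance [IsScalarTower ℂ 𝒜 𝒜] [SMulCommClass ℂ 𝒜 𝒜] [StarModule ℂ 𝒜] :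
    NonUnitalCStarAlgebra p.Completion where

end Algebra

end CStarSeminorm

/-! ### Free *-algebras -/

/-- The reversed word, with `g` and its formal adjoint exchanged in each letter. -/
def starWord {G : Type*} : FreeSemigroup (G × Bool) →ₙ* (FreeSemigroup (G × Bool))ᵐᵒᵖ :=
  FreeSemigroup.lift fun g => MulOpposite.op (FreeSemigroup.of (g.1, !g.2))

theorem starWord_starWord {G : Type*} (w : FreeSemigroup (G × Bool)) :
    (starWord (starWord w).unop).unop = w := by
  induction w using FreeSemigroup.recOnMul with
  | ih1 g => simp [starWord]
  | ih2 x y hx hy => simpa using congrArg₂ (· * ·) hx hy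

/-- The free (non-unital) complex *-algebra on the set `G`: linear combinations of nonempty words
in the letters `g` (encoded as `(g, false)`) and `g*` (encoded as `(g, true)`). -/
abbrev FreeStarAlgebra (G : Type*) : Type _ := MonoidAlgebra ℂ (FreeSemigroup (G × Bool))

namespace FreeStarAlgebra

variable {G : Type*}

/-- The canonical generators. -/
def of (g : G) : FreeStarAlgebra G := MonoidAlgebra.single (FreeSemigroup.of (g, false)) 1

instance : Star (FreeStarAlgebra G) where
  star x := MonoidAlgebra.mapDomain (fun w => (starWord w).unop)
    (MonoidAlgebra.map (starRingEnd ℂ).toAddMonoidHom x)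

theorem star_single (w : FreeSemigroup (G × Bool)) (c : ℂ) :
    star (MonoidAlgebra.single w c : FreeStarAlgebra G)
      = MonoidAlgebra.single (starWord w).unop (star c) := by
  change MonoidAlgebra.mapDomain _ (MonoidAlgebra.map _ _) = _
  simp [MonoidAlgebra.map_single]

theorem star_add' (x y : FreeStarAlgebra G) : star (x + y) = star x + star y := by
  change MonoidAlgebra.mapDomain _ (MonoidAlgebra.map _ _) = _
  rw [MonoidAlgebra.map_add, MonoidAlgebra.mapDomain_add]
  rfl

theorem star_zero' : star (0 : FreeStarAlgebra G) = 0 := by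
  have h := star_add' (0 : FreeStarAlgebra G) 0
  simpa using h

instance : StarRing (FreeStarAlgebra G) where
  star_involutive x := by
    induction x using MonoidAlgebra.induction_linear with
    | zero => simp [star_zero']
    | add x y hx hy => rw [star_add', star_add', hx, hy]
    | single w c => simp [star_single, starWord_starWord]
  star_add := star_add'
  star_mul x y := by
    induction x using MonoidAlgebra.induction_linear with
    | zero => simp [star_zero']
    | add x x' hx hy => rw [add_mul, star_add', star_add', hx, hy, mul_add]
    | single w c =>
      induction y using MonoidAlgebra.induction_linear with
      | zero => simp [star_zero']
      | add x x' hx hy => rw [mul_add, star_add', star_add', hx, hy, add_mul]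
      | single w' c' => simp [star_single, MonoidAlgebra.single_mul_single, mul_comm]

instance : StarModule ℂ (FreeStarAlgebra G) where
  star_smul c x := by
    induction x using MonoidAlgebra.induction_linear with
    | zero => simp
    | add x y hx hy => rw [smul_add, star_add, star_add, hx, hy, smul_add]
    | single w c => simp [star_single]

end FreeStarAlgebra

/-! ### Inverse semigroups and their actions by partial homeomorphisms -/

/-- An inverse semigroup: every `a` has exactly one generalised inverse `star a`. -/
class InverseSemigroup (S : Type*) extends Semigroup S, Star S where
  mul_star_mul_self : ∀ a : S, a * star a * a = a
  star_mul_self_star : ∀ a : S, star a * a * star a = star a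
  star_unique : ∀ a b : S, a * b * a = a → b * a * b = b → b = star a

namespace InverseSemigroup

variable {S : Type*} [InverseSemigroup S]

/-- The natural partial order `a ≤ b`. -/
def NatLE (a b : S) : Prop := a = b * (star a * a)

theorem star_star (a : S) : star (star a) = a :=
  (star_unique (star a) a (star_mul_self_star a) (mul_star_mul_self a)).symm

theorem range_idem (a : S) : (a * star a) * (a * star a) = a * star a := by
  rw [← mul_assoc, mul_star_mul_self]

theorem star_of_idem {e : S} (he : e * e = e) : star e = e :=
  (star_unique e e (by rw [he, he]) (by rw [he, he])).symm

end InverseSemigroup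

open InverseSemigroup

/-- An action of an inverse semigroup `S` on a topological space `X` by homeomorphisms between open
subsets.  It is a homomorphism to the inverse semigroup of partial homeomorphisms, such
that the domains cover `X`. -/
structure InverseSemigroupAction (S X : Type*) [InverseSemigroup S] [TopologicalSpace X] where
  θ : S → OpenPartialHomeomorph X X
  θ_mul : ∀ a b : S, (θ b).trans (θ a) ≈ θ (a * b)
  cover : ∀ x : X, ∃ a : S, x ∈ (θ a).source

namespace InverseSemigroupAction

variable {S X : Type*} [InverseSemigroup S] [TopologicalSpace X] (A : InverseSemigroupAction S X)

/-- The open subset `D_e` of `X` for an idempotent `e`. -/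
def D (e : S) : Set X := (A.θ e).source

theorem mem_mul {a b : S} {x : X} :
    x ∈ (A.θ (a * b)).source ↔ x ∈ (A.θ b).source ∧ A.θ b x ∈ (A.θ a).source := by
  rw [← (A.θ_mul a b).1]; simp

theorem mul_apply {a b : S} {x : X} (h : x ∈ (A.θ b).source) (h' : A.θ b x ∈ (A.θ a).source) :
    A.θ (a * b) x = A.θ a (A.θ b x) := by
  have := (A.θ_mul a b).2 (x := x) (by simp [h, h'])
  simpa using this.symm

theorem star_apply {a : S} {x : X} (h : x ∈ (A.θ a).source) :
    A.θ a x ∈ (A.θ (star a)).source ∧ A.θ (star a) (A.θ a x) = x := by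
  have h0 : x ∈ (A.θ (a * star a * a)).source := by rwa [mul_star_mul_self]
  have h1 := A.mem_mul.1 h0
  have h2 := A.mem_mul.1 h1.2
  refine ⟨h2.1, (A.θ a).injOn h2.2 h ?_⟩
  rw [← A.mul_apply h2.1 h2.2, ← A.mul_apply h1.1 h1.2, mul_star_mul_self]

theorem star_apply' {a : S} {x : X} (h : x ∈ (A.θ (star a)).source) :
    A.θ (star a) x ∈ (A.θ a).source ∧ A.θ a (A.θ (star a) x) = x := by
  simpa [InverseSemigroup.star_star] using A.star_apply h

theorem D_star_mul (a : S) : A.D (star a * a) = (A.θ a).source := by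
  ext x
  exact ⟨fun h => (A.mem_mul.1 h).1, fun h => A.mem_mul.2 ⟨h, (A.star_apply h).1⟩⟩

theorem D_mul_star (a : S) : A.D (a * star a) = (A.θ a).target := by
  ext x
  constructor
  · intro h
    have h1 := A.star_apply' (A.mem_mul.1 h).1
    rw [← h1.2]
    exact (A.θ a).map_source h1.1
  · intro h
    have h1 := A.star_apply ((A.θ a).map_target h)
    rw [(A.θ a).right_inv h] at h1
    exact A.mem_mul.2 ⟨h1.1, by rw [h1.2]; exact (A.θ a).map_target h⟩

theorem source_star (a : S) : (A.θ (star a)).source = A.D (a * star a) := by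
  rw [← D_star_mul, InverseSemigroup.star_star]

theorem target_star (a : S) : (A.θ (star a)).target = A.D (star a * a) := by
  rw [← D_mul_star, InverseSemigroup.star_star]

theorem idem_apply {e : S} (he : e * e = e) {x : X} (h : x ∈ A.D e) : A.θ e x = x := by
  have h1 := A.star_apply (a := e) h
  rw [star_of_idem he] at h1
  have h2 := A.mul_apply h h1.1
  rw [he] at h2
  exact h2.trans h1.2

end InverseSemigroupAction

/-! ### Functions vanishing at infinity -/

open scoped ZeroAtInfty

section Functions

variable {X : Type*} [TopologicalSpace X]

/-- `C₀(U)` for an open subset `U` of `X`, identified by extension by zero with the ideal of all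
functions in `C₀(X)` that vanish outside `U`. -/
def C0On (U : Set X) : NonUnitalStarSubalgebra ℂ C₀(X, ℂ) where
  carrier := {f | ∀ x ∉ U, f x = 0}
  add_mem' hf hg x hx := by simp [hf x hx, hg x hx]
  zero_mem' x _ := rfl
  mul_mem' hf hg x hx := by simp [hf x hx]
  smul_mem' c f hf x hx := by simp [hf x hx]
  star_mem' hf x hx := by simp [hf x hx]

theorem mem_C0On {U : Set X} {f : C₀(X, ℂ)} : f ∈ C0On U ↔ ∀ x ∉ U, f x = 0 := Iff.rfl

theorem isClosed_C0On (U : Set X) : IsClosed (C0On U : Set C₀(X, ℂ)) := by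
  have : (C0On U : Set C₀(X, ℂ)) = ⋂ x ∈ Uᶜ, {f | f x = 0} := by
    ext f; simp [mem_C0On]
  rw [this]
  refine isClosed_biInter fun x _ => isClosed_eq ?_ continuous_const
  exact (continuous_eval_const (F := BoundedContinuousFunction X ℂ) x).comp
    (ZeroAtInftyContinuousMap.isometry_toBCF (α := X) (β := ℂ)).continuous

open Classical in
/-- The function `f ∘ e`, extended by zero outside the domain of the partial homeomorphism `e`. -/
def compZero (e : OpenPartialHomeomorph X X) (f : X → ℂ) (x : X) : ℂ :=
  if x ∈ e.source then f (e x) else 0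

theorem exists_compact (e : OpenPartialHomeomorph X X) (f : C₀(X, ℂ)) (hf : f ∈ C0On e.target)
    {ε : ℝ} (hε : 0 < ε) : ∃ K : Set X, IsCompact K ∧ K ⊆ e.source ∧
      ∀ x ∉ K, ‖compZero e f x‖ < ε := by
  have h1 : {y : X | ‖f y‖ < ε} ∈ Filter.cocompact X := by
    have h2 := f.zero_at_infty'.norm
    rw [norm_zero] at h2
    exact h2.eventually (gt_mem_nhds hε)
  obtain ⟨L, hL, hL'⟩ := Filter.mem_cocompact.1 h1
  have hclosed : IsClosed {y : X | ε ≤ ‖f y‖} :=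
    isClosed_le continuous_const (map_continuous f).norm
  have hK : IsCompact {y : X | ε ≤ ‖f y‖} :=
    hL.of_isClosed_subset hclosed fun y hy => by
      by_contra h
      exact absurd (show ‖f y‖ < ε from hL' h) (not_lt.2 hy)
  have hsub : {y : X | ε ≤ ‖f y‖} ⊆ e.target := fun y hy => by
    by_contra h
    have h0 : ε ≤ ‖f y‖ := hy
    rw [hf y h, norm_zero] at h0
    exact absurd hε (not_lt.2 h0)
  refine ⟨e.symm '' {y : X | ε ≤ ‖f y‖}, hK.image_of_continuousOn
    (e.continuousOn_symm.mono hsub), ?_, ?_⟩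
  · rintro _ ⟨y, hy, rfl⟩
    exact e.map_target (hsub hy)
  · intro x hx
    unfold compZero
    split_ifs with hs
    · by_contra h
      exact hx ⟨e x, not_lt.1 h, e.left_inv hs⟩
    · simpa using hε

variable [T2Space X]

/-- `f ∘ e` as an element of `C₀(X)`, where `f ∈ C₀(X)` vanishes outside the codomain of `e`. -/
def pullbackC0 (e : OpenPartialHomeomorph X X) (f : C₀(X, ℂ)) (hf : f ∈ C0On e.target) :
    C₀(X, ℂ) where
  toFun := compZero e f
  continuous_toFun := by
    refine continuous_iff_continuousAt.2 fun x => ?_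
    by_cases hx : x ∈ e.source
    · have h1 : ContinuousAt (fun y => f (e y)) x :=
        (map_continuous f).continuousAt.comp (e.continuousAt hx)
      refine h1.congr ?_
      filter_upwards [e.open_source.mem_nhds hx] with y hy
      simp [compZero, hy]
    · have h0 : compZero e f x = 0 := by simp [compZero, hx]
      rw [Metric.continuousAt_iff']
      intro ε hε
      obtain ⟨K, hK, hKs, hKε⟩ := exists_compact e f hf hε
      filter_upwards [hK.isClosed.isOpen_compl.mem_nhds (fun h => hx (hKs h))] with y hy
      rw [h0, dist_zero_right]
      exact hKε y hy
  zero_at_infty' := by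
    rw [Metric.tendsto_nhds]
    intro ε hε
    obtain ⟨K, hK, -, hKε⟩ := exists_compact e f hf hε
    filter_upwards [hK.compl_mem_cocompact] with y hy
    rw [dist_zero_right]
    exact hKε y hy

theorem pullbackC0_apply (e : OpenPartialHomeomorph X X) (f : C₀(X, ℂ)) (hf : f ∈ C0On e.target)
    (x : X) : pullbackC0 e f hf x = compZero e f x := rfl

theorem pullbackC0_mem (e : OpenPartialHomeomorph X X) (f : C₀(X, ℂ)) (hf : f ∈ C0On e.target) :
    pullbackC0 e f hf ∈ C0On e.source := fun x hx => by
  simp [pullbackC0_apply, compZero, hx]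

end Functions

/-! ### The crossed product -/

namespace CStarSeminorm

variable {𝒜 : Type*} [NonUnitalRing 𝒜] [StarRing 𝒜] [Module ℂ 𝒜]

instance : Zero (CStarSeminorm 𝒜) where
  zero :=
    { toSeminorm := 0
      mul_le' := fun x y => by change (0 : ℝ) ≤ 0 * 0; simp
      star_mul_self' := fun x => by change (0 : ℝ) = 0 ^ 2; simp }

/-- The supremum of a pointwise bounded nonempty set of C*-seminorms. -/
def sup (P : Set (CStarSeminorm 𝒜)) (hne : P.Nonempty)
    (hP : ∀ x, BddAbove (Set.range fun q : P => q.1 x)) : CStarSeminorm 𝒜 :=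
  have : Nonempty P := hne.to_subtype
  have nonneg : ∀ x, 0 ≤ ⨆ q : P, q.1 x := fun x => Real.iSup_nonneg fun q => apply_nonneg _ x
  { toFun := fun x => ⨆ q : P, q.1 x
    map_zero' := by simp
    add_le' := fun x y => ciSup_le fun q => (map_add_le_add q.1.toSeminorm x y).trans
      (add_le_add (le_ciSup (hP x) q) (le_ciSup (hP y) q))
    neg' := fun x => by simp
    smul' := fun c x => by
      simp only [map_smul_eq_mul]
      exact (Real.mul_iSup_of_nonneg (norm_nonneg c) _).symm
    mul_le' := fun x y => ciSup_le fun q => (q.1.mul_le x y).trans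
      (mul_le_mul (le_ciSup (hP x) q) (le_ciSup (hP y) q) (apply_nonneg _ y) (nonneg x))
    star_mul_self' := fun x => by
      apply le_antisymm
      · refine ciSup_le fun q => ?_
        rw [q.1.star_mul_self]
        exact pow_le_pow_left₀ (apply_nonneg _ x) (le_ciSup (hP x) q) 2
      · refine (Real.le_sqrt (nonneg x) (nonneg _)).1 (ciSup_le fun q => ?_)
        refine Real.le_sqrt_of_sq_le ?_
        rw [← q.1.star_mul_self]
        exact le_ciSup (hP (star x * x)) q }

end CStarSeminorm

namespace InverseSemigroupAction

variable {S X : Type*} [InverseSemigroup S] [TopologicalSpace X] [T2Space X]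
  (A : InverseSemigroupAction S X)

/-- `f ∘ ϑ_a ∈ C₀(D_{a* a})` for `f ∈ C₀(D_{a a*})`. -/
def comp (a : S) (f : C0On (A.D (a * star a))) : C0On (A.D (star a * a)) :=
  ⟨pullbackC0 (A.θ a) f.1 (by rw [← A.D_mul_star]; exact f.2),
    by rw [A.D_star_mul]; exact pullbackC0_mem _ _ _⟩

/-- `f ∘ ϑ_{a*} ∈ C₀(D_{a a*})` for `f ∈ C₀(D_{a* a})`. -/
def compStar (a : S) (f : C0On (A.D (star a * a))) : C0On (A.D (a * star a)) :=
  ⟨pullbackC0 (A.θ (star a)) f.1 (by rw [A.target_star]; exact f.2),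
    by rw [← A.source_star]; exact pullbackC0_mem _ _ _⟩

/-- The function `((f ∘ ϑ_a) · g) ∘ ϑ_{a*} ∈ C₀(D_{(ab)(ab)*})`
for `f ∈ C₀(D_{a a*})` and `g ∈ C₀(D_{b b*})`. -/
def prodFun (a b : S) (f : C0On (A.D (a * star a))) (g : C0On (A.D (b * star b))) :
    C0On (A.D (a * b * star (a * b))) :=
  ⟨(A.compStar a ⟨(A.comp a f).1 * g.1, fun x hx => by
      simp [(A.comp a f).2 x hx]⟩).1, fun x hx => by
    by_contra h
    apply hx
    have h1 : compZero (A.θ (star a)) (fun y => (A.comp a f).1 y * g.1 y) x ≠ 0 := h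
    unfold compZero at h1
    split_ifs at h1 with hs
    · have hg : A.θ (star a) x ∈ A.D (b * star b) := by
        by_contra hg
        exact h1 (by simp [g.2 _ hg])
      · rw [D_mul_star] at hg
        rw [D_mul_star]
        have h2 := A.star_apply' hs
        have h3 := (A.θ b).map_target hg
        have h4 : A.θ b ((A.θ b).symm (A.θ (star a) x)) = A.θ (star a) x :=
          (A.θ b).right_inv hg
        have h5 : A.θ b ((A.θ b).symm (A.θ (star a) x)) ∈ (A.θ a).source := by
          rw [h4]; exact h2.1
        have h6 := (A.θ (a * b)).map_source (A.mem_mul.2 ⟨h3, h5⟩)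
        rwa [A.mul_apply h3 h5, h4, h2.2] at h6
    · exact absurd rfl h1⟩

/-- The function `conj f ∘ ϑ_a ∈ C₀(D_{a* a})` for `f ∈ C₀(D_{a a*})`. -/
def starFun (a : S) (f : C0On (A.D (a * star a))) : C0On (A.D (star a * star (star a))) :=
  ⟨(A.comp a (star f)).1, by rw [InverseSemigroup.star_star]; exact (A.comp a (star f)).2⟩

/-- Generators of the crossed product: pairs `(a, f)` with `a ∈ S` and `f ∈ C₀(D_{a a*})`. -/
abbrev Gen : Type _ := Σ a : S, C0On (A.D (a * star a))

/-- The formal expression `f δ_a`. -/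
def preδ (a : S) (f : C0On (A.D (a * star a))) : FreeStarAlgebra A.Gen :=
  FreeStarAlgebra.of ⟨a, f⟩

/-- The defining relations of the crossed product. -/
inductive Rel : FreeStarAlgebra A.Gen → FreeStarAlgebra A.Gen → Prop
  | add (a : S) (f g : C0On (A.D (a * star a))) : Rel (A.preδ a (f + g)) (A.preδ a f + A.preδ a g)
  | smul (a : S) (c : ℂ) (f : C0On (A.D (a * star a))) : Rel (A.preδ a (c • f)) (c • A.preδ a f)
  | le (a b : S) (hab : NatLE a b) (f : C0On (A.D (a * star a))) (g : C0On (A.D (b * star b)))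
      (hfg : (f : C₀(X, ℂ)) = g) : Rel (A.preδ a f) (A.preδ b g)
  | mul (a b : S) (f : C0On (A.D (a * star a))) (g : C0On (A.D (b * star b))) :
      Rel (A.preδ a f * A.preδ b g) (A.preδ (a * b) (A.prodFun a b f g))
  | star (a : S) (f : C0On (A.D (a * star a))) :
      Rel (star (A.preδ a f)) (A.preδ (star a) (A.starFun a f))

/-- The C*-seminorms on the free *-algebra that are compatible with the relations. -/
def Admissible : Set (CStarSeminorm (FreeStarAlgebra A.Gen)) :=
  {q | ∀ x y, A.Rel x y → q (x - y) = 0}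

section Bound

variable {A} {q : CStarSeminorm (FreeStarAlgebra A.Gen)}

theorem toCompletion_eq (hq : q ∈ A.Admissible) {x y : FreeStarAlgebra A.Gen} (h : A.Rel x y) :
    q.toCompletion x = q.toCompletion y := by
  rw [← sub_eq_zero, ← map_sub, ← norm_eq_zero, q.norm_toCompletion]
  exact hq x y h

theorem prodFun_apply (a b : S) (f : C0On (A.D (a * star a))) (g : C0On (A.D (b * star b)))
    {x : X} (hx : x ∈ A.D (a * star a)) :
    (A.prodFun a b f g).1 x = f.1 x * g.1 (A.θ (star a) x) := by
  have hs : x ∈ (A.θ (star a)).source := by rwa [A.source_star]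
  have h2 := A.star_apply' hs
  change compZero (A.θ (star a)) (fun y => compZero (A.θ a) f.1 y * g.1 y) x = _
  simp [compZero, hs, h2.1, h2.2]

theorem prodFun_apply_zero (a b : S) (f : C0On (A.D (a * star a))) (g : C0On (A.D (b * star b)))
    {x : X} (hx : x ∉ A.D (a * star a)) : (A.prodFun a b f g).1 x = 0 := by
  have hs : x ∉ (A.θ (star a)).source := by rwa [A.source_star]
  change compZero (A.θ (star a)) (fun y => compZero (A.θ a) f.1 y * g.1 y) x = _
  simp [compZero, hs]

theorem prodFun_idem {e : S} (he : e * e = e) (f g : C0On (A.D (e * star e))) :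
    ((A.prodFun e e f g : C0On _) : C₀(X, ℂ)) = (f * g : C0On (A.D (e * star e))) := by
  ext x
  by_cases hx : x ∈ A.D (e * star e)
  · rw [A.prodFun_apply e e f g hx]
    have h1 : A.θ (star e) x = x := by
      rw [star_of_idem he]
      apply A.idem_apply he
      rwa [star_of_idem he, he] at hx
    rw [h1]; rfl
  · rw [A.prodFun_apply_zero e e f g hx, (f * g : C0On _).2 x hx]

theorem starFun_idem {e : S} (he : e * e = e) (f : C0On (A.D (e * star e))) :
    ((A.starFun e f : C0On _) : C₀(X, ℂ)) = (star f : C0On (A.D (e * star e))) := by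
  ext x
  change compZero (A.θ e) (star f : C0On _).1 x = (star f : C0On _).1 x
  unfold compZero
  split_ifs with hs
  · rw [A.idem_apply he hs]
  · refine ((star f : C0On _).2 x ?_).symm
    rwa [star_of_idem he, he]

theorem natLE_of_eq {a b : S} (h : a = b) : NatLE a b := by
  subst h
  rw [NatLE, ← mul_assoc, mul_star_mul_self]

/-- For idempotent `e`, the map `f ↦ f δ_e` is a *-homomorphism modulo `q`. -/
def idemHom (hq : q ∈ A.Admissible) {e : S} (he : e * e = e) :
    C0On (A.D (e * star e)) →⋆ₙₐ[ℂ] q.Completion where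
  toFun f := q.toCompletion (A.preδ e f)
  map_smul' c f := by
    rw [toCompletion_eq hq (Rel.smul e c f), map_smul]; rfl
  map_zero' := by
    have h := toCompletion_eq hq (Rel.smul e 0 (0 : C0On (A.D (e * star e))))
    rwa [zero_smul, zero_smul, map_zero] at h
  map_add' f g := by
    rw [toCompletion_eq hq (Rel.add e f g), map_add]
  map_mul' f g := by
    rw [← q.toCompletion_mul, toCompletion_eq hq (Rel.mul e e f g)]
    exact (toCompletion_eq hq (Rel.le _ _ (natLE_of_eq he) _ _ (prodFun_idem he f g))).symm
  map_star' f := by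
    rw [← q.toCompletion_star, toCompletion_eq hq (Rel.star e f)]
    exact (toCompletion_eq hq
      (Rel.le _ _ (natLE_of_eq (star_of_idem he)) _ _ (starFun_idem he f))).symm

theorem idem_bound (hq : q ∈ A.Admissible) {e : S} (he : e * e = e)
    (f : C0On (A.D (e * star e))) : q (A.preδ e f) ≤ ‖f‖ := by
  have := isClosed_C0On (A.D (e * star e))
  rw [← q.norm_toCompletion]
  exact NonUnitalStarAlgHom.norm_apply_le (idemHom hq he) f

theorem gen_bound (hq : q ∈ A.Admissible) (a : S) (f : C0On (A.D (a * star a))) :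
    q (A.preδ a f) ^ 2 ≤ ‖A.prodFun a (star a) f (A.starFun a f)‖ := by
  rw [← q.map_star, ← q.star_mul_self, InvolutiveStar.star_involutive]
  have h : q.toCompletion (A.preδ a f * star (A.preδ a f))
      = q.toCompletion (A.preδ (a * star a) (A.prodFun a (star a) f (A.starFun a f))) := by
    rw [q.toCompletion_mul, toCompletion_eq hq (Rel.star a f), ← q.toCompletion_mul,
      toCompletion_eq hq (Rel.mul a (star a) f (A.starFun a f))]
  rw [← q.norm_toCompletion, h, q.norm_toCompletion]
  exact idem_bound hq (range_idem a) _

end Bound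

theorem letter_bound (g : A.Gen × Bool) : ∃ C : ℝ, ∀ q ∈ A.Admissible,
    q (MonoidAlgebra.single (FreeSemigroup.of g) 1) ≤ C := by
  obtain ⟨⟨a, f⟩, b⟩ := g
  refine ⟨Real.sqrt ‖A.prodFun a (star a) f (A.starFun a f)‖, fun q hq => ?_⟩
  have h1 := Real.le_sqrt_of_sq_le (gen_bound hq a f)
  cases b with
  | false => exact h1
  | true =>
    rw [← q.map_star] at h1
    simpa [preδ, FreeStarAlgebra.of, FreeStarAlgebra.star_single, starWord] using h1

theorem admissible_bound (x : FreeStarAlgebra A.Gen) :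
    BddAbove (Set.range fun q : A.Admissible => q.1 x) := by
  suffices h : ∃ C : ℝ, ∀ q ∈ A.Admissible, q x ≤ C by
    obtain ⟨C, hC⟩ := h
    exact ⟨C, by rintro _ ⟨q, rfl⟩; exact hC q.1 q.2⟩
  induction x using MonoidAlgebra.induction_linear with
  | zero => exact ⟨0, fun q _ => (map_zero q.toSeminorm).le⟩
  | add x y hx hy =>
    obtain ⟨C, hC⟩ := hx
    obtain ⟨C', hC'⟩ := hy
    exact ⟨C + C', fun q hq => (map_add_le_add q.toSeminorm x y).trans
      (add_le_add (hC q hq) (hC' q hq))⟩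
  | single w c =>
    have h : ∃ C : ℝ, ∀ q ∈ A.Admissible, q (MonoidAlgebra.single w 1) ≤ C := by
      induction w using FreeSemigroup.recOnMul with
      | ih1 g => exact A.letter_bound g
      | ih2 g w hg hw =>
        obtain ⟨C, hC⟩ := hg
        obtain ⟨C', hC'⟩ := hw
        refine ⟨C * C', fun q hq => ?_⟩
        have h1 := q.mul_le (MonoidAlgebra.single (FreeSemigroup.of g) 1)
          (MonoidAlgebra.single w 1)
        rw [MonoidAlgebra.single_mul_single, one_mul] at h1
        exact h1.trans (mul_le_mul (hC q hq) (hC' q hq) (apply_nonneg _ _)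
          ((apply_nonneg _ _).trans (hC q hq)))
    obtain ⟨C, hC⟩ := h
    refine ⟨‖c‖ * C, fun q hq => ?_⟩
    have h1 : (MonoidAlgebra.single w c : FreeStarAlgebra A.Gen)
        = c • MonoidAlgebra.single w 1 := by simp
    rw [h1, map_smul_eq_mul]
    exact mul_le_mul_of_nonneg_left (hC q hq) (norm_nonneg c)

/-- The largest C*-seminorm on the free *-algebra that is compatible with the relations. -/
def maxSeminorm : CStarSeminorm (FreeStarAlgebra A.Gen) :=
  CStarSeminorm.sup A.Admissible ⟨0, fun _ _ _ => rfl⟩ A.admissible_bound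

/-- The crossed product `S ⋉ C₀(X)`: the universal C*-algebra generated by the expressions `f δ_a`
with `a ∈ S` and `f ∈ C₀(D_{a a*})`, subject to the relations `Rel`.  It is
the Hausdorff completion of the free *-algebra on these generators
in the largest C*-seminorm compatible with the relations. -/
def CrossedProduct : Type _ := A.maxSeminorm.Completion

instance : NonUnitalCStarAlgebra A.CrossedProduct :=
  inferInstanceAs (NonUnitalCStarAlgebra A.maxSeminorm.Completion)

/-- The element `f δ_a` of the crossed product. -/
def δ (a : S) (f : C0On (A.D (a * star a))) : A.CrossedProduct :=
  A.maxSeminorm.toCompletion (A.preδ a f)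

end InverseSemigroupAction

/-! ### Hilbert modules -/

/-- A right Hilbert `D`-module `F`: a right action of `D` (written as a scalar action of `Dᵐᵒᵖ`) and
a `D`-valued inner product, linear in the second variable, such that `F` is complete
for the norm `‖ξ‖ = ‖⟪ξ, ξ⟫‖ ^ (1/2)`.  The module axioms for the right action
follow from the axioms for the inner product. -/
class HilbertModule (D F : Type*) [NonUnitalCStarAlgebra D] [NormedAddCommGroup F]
    [NormedSpace ℂ F] [CompleteSpace F] extends SMul Dᵐᵒᵖ F, Inner D F where
  inner_add_right : ∀ ξ η ζ : F, inner ξ (η + ζ) = inner ξ η + inner ξ ζ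
  inner_smul_right : ∀ (c : ℂ) (ξ η : F), inner ξ (c • η) = c • inner ξ η
  inner_op_smul_right : ∀ (d : D) (ξ η : F), inner ξ (MulOpposite.op d • η) = inner ξ η * d
  star_inner : ∀ ξ η : F, star (inner ξ η) = inner η ξ
  inner_self_pos : ∀ ξ : F, ∃ d : D, inner ξ ξ = star d * d
  norm_inner_self : ∀ ξ : F, ‖inner ξ ξ‖ = ‖ξ‖ ^ 2

section Positive

variable {D : Type*} [NonUnitalCStarAlgebra D]

theorem pos_iff (x : D) : (∃ d : D, x = star d * d) ↔
    (letI := CStarAlgebra.spectralOrder D; 0 ≤ x) := by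
  let _ := CStarAlgebra.spectralOrder D
  have _ := CStarAlgebra.spectralOrderedRing D
  constructor
  · rintro ⟨d, rfl⟩
    exact star_mul_self_nonneg d
  · intro h
    obtain ⟨s, hs, -, hs'⟩ := CFC.exists_sqrt_of_isSelfAdjoint_of_quasispectrumRestricts h.1 h.2
    exact ⟨s, by rw [hs.star_eq, hs', sub_zero]⟩

theorem isClosed_pos : IsClosed {x : D | ∃ d : D, x = star d * d} := by
  let _ := CStarAlgebra.spectralOrder D
  have _ := CStarAlgebra.spectralOrderedRing D
  simp only [pos_iff]
  exact CStarAlgebra.isClosed_nonneg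

theorem pos_sum {ι : Type*} (s : Finset ι) (x : ι → D) (h : ∀ i ∈ s, ∃ d : D, x i = star d * d) :
    ∃ d : D, ∑ i ∈ s, x i = star d * d := by
  let _ := CStarAlgebra.spectralOrder D
  have _ := CStarAlgebra.spectralOrderedRing D
  simp only [pos_iff] at h ⊢
  exact Finset.sum_nonneg h

end Positive

/-- A semi-inner product `D`-module: like a Hilbert module, but not necessarily
separated or complete. -/
structure PreHilbertModule (D V : Type*) [NonUnitalCStarAlgebra D] [AddCommGroup V]
    [Module ℂ V] where
  form : V →ₗ⋆[ℂ] V →ₗ[ℂ] D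
  act : D → V →ₗ[ℂ] V
  form_act : ∀ d x y, form x (act d y) = form x y * d
  star_form : ∀ x y, star (form x y) = form y x
  form_pos : ∀ x, ∃ d : D, form x x = star d * d

namespace PreHilbertModule

variable {D V : Type*} [NonUnitalCStarAlgebra D] [AddCommGroup V] [Module ℂ V]
  (H : PreHilbertModule D V)

theorem form_act_left (d : D) (x y : V) : H.form (H.act d x) y = star d * H.form x y := by
  rw [← H.star_form, H.form_act, star_mul, H.star_form]

theorem cauchy_schwarz (x y : V) :
    ‖H.form x y‖ ^ 2 ≤ ‖H.form x x‖ * ‖H.form y y‖ := by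
  let _ := CStarAlgebra.spectralOrder D
  have _ := CStarAlgebra.spectralOrderedRing D
  set c := H.form x y with hc
  have key : ∀ t : ℝ, 0 < t → ‖H.form x x‖ ≤ t → ‖c‖ ^ 2 ≤ t * ‖H.form y y‖ := by
    intro t ht hxt
    have h1 : 0 ≤ H.form (H.act c x - (t : ℂ) • y) (H.act c x - (t : ℂ) • y) :=
      (pos_iff _).1 (H.form_pos _)
    have h2 : H.form (H.act c x - (t : ℂ) • y) (H.act c x - (t : ℂ) • y)
        = star c * H.form x x * c - t • (star c * c) - t • (star c * c)
          + t • t • H.form y y := by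
      have hyx : H.form y x = star c := by rw [hc, H.star_form]
      simp only [map_sub, LinearMap.sub_apply, map_smulₛₗ, LinearMap.smul_apply, H.form_act,
        H.form_act_left, hyx, ← hc, Complex.conj_ofReal, mul_assoc]
      simp only [RingHom.id_apply, Complex.coe_smul, smul_sub]
      abel
    have h3 : star c * H.form x x * c ≤ t • (star c * c) := by
      refine (CStarAlgebra.star_left_conjugate_le_norm_smul
        (hb := H.star_form x x)).trans ?_
      exact smul_le_smul_of_nonneg_right hxt (star_mul_self_nonneg c)
    rw [h2] at h1
    have h4 : t • (star c * c) ≤ t • t • H.form y y := by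
      have h5 := add_le_add h1 h3
      rw [← sub_nonneg] at h5 ⊢
      convert h5 using 1
      abel
    have h6 := CStarAlgebra.norm_le_norm_of_nonneg_of_le
      (smul_nonneg ht.le (star_mul_self_nonneg c)) h4
    rw [norm_smul, norm_smul, norm_smul, CStarRing.norm_star_mul_self, Real.norm_eq_abs,
      abs_of_pos ht] at h6
    have h7 := le_of_mul_le_mul_left h6 ht
    rwa [pow_two]
  refine le_of_forall_pos_le_add fun ε hε => ?_
  have h8 : ‖c‖ ^ 2 ≤ (‖H.form x x‖ + ε / (‖H.form y y‖ + 1)) * ‖H.form y y‖ := by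
    apply key
    · positivity
    · have : 0 ≤ ε / (‖H.form y y‖ + 1) := by positivity
      linarith
  refine h8.trans ?_
  rw [add_mul]
  have h9 : ε / (‖H.form y y‖ + 1) * ‖H.form y y‖ ≤ ε := by
    rw [div_mul_eq_mul_div, div_le_iff₀ (by positivity)]
    nlinarith [norm_nonneg (H.form y y)]
  linarith

/-- The space `V` with the seminorm `‖⟪x, x⟫‖ ^ (1/2)`. -/
@[nolint unusedArguments]
def Carrier (_H : PreHilbertModule D V) : Type _ := V

instance instAddCommGroupCarrier : AddCommGroup H.Carrier := inferInstanceAs (AddCommGroup V)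

/-- The seminorm of a semi-inner product module. -/
def nm (x : V) : ℝ := Real.sqrt ‖H.form x x‖

theorem nm_sq (x : V) : H.nm x ^ 2 = ‖H.form x x‖ := Real.sq_sqrt (norm_nonneg _)

theorem nm_nonneg (x : V) : 0 ≤ H.nm x := Real.sqrt_nonneg _

theorem norm_form_le (x y : V) : ‖H.form x y‖ ≤ H.nm x * H.nm y := by
  refine le_of_sq_le_sq ?_ (mul_nonneg (H.nm_nonneg x) (H.nm_nonneg y))
  rw [mul_pow, H.nm_sq, H.nm_sq]
  exact H.cauchy_schwarz x y

theorem nm_add_le (x y : V) : H.nm (x + y) ≤ H.nm x + H.nm y := by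
  refine le_of_sq_le_sq ?_ (add_nonneg (H.nm_nonneg x) (H.nm_nonneg y))
  rw [H.nm_sq]
  have h : H.form (x + y) (x + y)
      = H.form x x + H.form x y + (H.form y x + H.form y y) := by
    simp only [map_add, LinearMap.add_apply]; abel
  rw [h]
  have h1 := norm_add_le (H.form x x + H.form x y) (H.form y x + H.form y y)
  have h2 := norm_add_le (H.form x x) (H.form x y)
  have h3 := norm_add_le (H.form y x) (H.form y y)
  have h4 := H.norm_form_le x y
  have h5 := H.norm_form_le y x
  rw [← H.nm_sq] at h2 h3
  nlinarith

theorem nm_smul (c : ℂ) (x : V) : H.nm (c • x) = ‖c‖ * H.nm x := by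
  unfold nm
  rw [LinearMap.map_smul, LinearMap.map_smulₛₗ, LinearMap.smul_apply, norm_smul, norm_smul, ← mul_assoc,
    RCLike.norm_conj, ← pow_two, Real.sqrt_mul (by positivity), Real.sqrt_sq (norm_nonneg c)]

instance : SeminormedAddCommGroup H.Carrier where
  __ := H.instAddCommGroupCarrier
  norm := fun x : V => H.nm x
  dist := fun x y : V => H.nm (-x + y)
  dist_self := fun x : V => by
    change H.nm (-x + x) = 0
    simp [nm]
  dist_comm := fun x y : V => by
    change H.nm (-x + y) = H.nm (-y + x)
    have h : -y + x = (-1 : ℂ) • (-x + y) := by simp [add_comm]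
    rw [h, H.nm_smul]; simp
  dist_triangle := fun x y z : V => by
    change H.nm (-x + z) ≤ H.nm (-x + y) + H.nm (-y + z)
    have h : -x + z = (-x + y) + (-y + z) := by abel
    rw [h]; exact H.nm_add_le _ _
  dist_eq _ _ := rfl

instance instModuleCarrier : Module ℂ H.Carrier := inferInstanceAs (Module ℂ V)

instance : NormedSpace ℂ H.Carrier where
  __ := H.instModuleCarrier
  norm_smul_le := fun c (x : V) => (H.nm_smul c x).le

/-- The Hausdorff completion of a semi-inner product module. -/
def Completion : Type _ := UniformSpace.Completion H.Carrier

instance : NormedAddCommGroup H.Completion :=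
  inferInstanceAs (NormedAddCommGroup (UniformSpace.Completion H.Carrier))
instance : NormedSpace ℂ H.Completion :=
  inferInstanceAs (NormedSpace ℂ (UniformSpace.Completion H.Carrier))
instance : CompleteSpace H.Completion :=
  inferInstanceAs (CompleteSpace (UniformSpace.Completion H.Carrier))

/-- The canonical map to the completion. -/
def toCompletion : V →ₗ[ℂ] H.Completion :=
  (UniformSpace.Completion.toComplₗᵢ (𝕜 := ℂ) (E := H.Carrier)).toLinearMap

theorem isDenseInducing : IsDenseInducing (fun x : H.Carrier => H.toCompletion x) :=
  UniformSpace.Completion.isDenseInducing_coe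

theorem norm_toCompletion (x : V) : ‖H.toCompletion x‖ = H.nm x :=
  UniformSpace.Completion.norm_coe (E := H.Carrier) x

@[elab_as_elim]
theorem induction {P : H.Completion → Prop} (x : H.Completion) (hc : IsClosed {x | P x})
    (h : ∀ a : V, P (H.toCompletion a)) : P x :=
  UniformSpace.Completion.induction_on x hc h

@[elab_as_elim]
theorem induction₂ {P : H.Completion → H.Completion → Prop} (x y : H.Completion)
    (hc : IsClosed {x : H.Completion × H.Completion | P x.1 x.2})
    (h : ∀ a b : V, P (H.toCompletion a) (H.toCompletion b)) : P x y :=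
  UniformSpace.Completion.induction_on₂ x y hc h

@[elab_as_elim]
theorem induction₃ {P : H.Completion → H.Completion → H.Completion → Prop}
    (x y z : H.Completion)
    (hc : IsClosed {x : H.Completion × H.Completion × H.Completion | P x.1 x.2.1 x.2.2})
    (h : ∀ a b c : V, P (H.toCompletion a) (H.toCompletion b) (H.toCompletion c)) :
    P x y z :=
  UniformSpace.Completion.induction_on₃ x y z hc h

/-- The inner product, extended to the completion. -/
def innerC (x y : H.Completion) : D :=
  (H.isDenseInducing.prodMap H.isDenseInducing).extend
    (fun z : H.Carrier × H.Carrier => H.form z.1 z.2) (x, y)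

/-- The inner product as an additive map in both variables. -/
def formAdd : H.Carrier →+ H.Carrier →+ D :=
  AddMonoidHom.mk' (fun x : V => (H.form x).toAddMonoidHom)
    (fun x y : V => AddMonoidHom.ext fun z : V => by
      change H.form (x + y) z = H.form x z + H.form y z
      rw [map_add, LinearMap.add_apply])

theorem continuous_form : Continuous (fun z : H.Carrier × H.Carrier => H.formAdd z.1 z.2) := by
  let L : H.Carrier →ₗ⋆[ℂ] H.Carrier →ₗ[ℂ] D := H.form
  let M := L.mkContinuous₂ 1 (fun x y : V => by rw [one_mul]; exact H.norm_form_le x y)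
  exact (M.continuous.comp continuous_fst).clm_apply continuous_snd

theorem innerC_coe (x y : V) : H.innerC (H.toCompletion x) (H.toCompletion y) = H.form x y :=
  (H.isDenseInducing.prodMap H.isDenseInducing).extend_eq H.continuous_form (x, y)

theorem continuous_innerC : Continuous (fun z : H.Completion × H.Completion =>
    H.innerC z.1 z.2) := by
  let i : H.Carrier →+ H.Completion := H.toCompletion.toAddMonoidHom
  have di : IsDenseInducing i := H.isDenseInducing
  exact (di.extend_Z_bilin di H.continuous_form :)

/-- The right action, extended to the completion. -/
def actC (d : D) : H.Completion → H.Completion :=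
  UniformSpace.Completion.map (α := H.Carrier) (β := H.Carrier) (H.act d)

theorem uniformContinuous_act (d : D) :
    UniformContinuous (α := H.Carrier) (β := H.Carrier) (H.act d) := by
  let T : H.Carrier →ₗ[ℂ] H.Carrier := H.act d
  refine (T.mkContinuous ‖d‖ fun x : V => ?_).uniformContinuous
  change H.nm (H.act d x) ≤ ‖d‖ * H.nm x
  refine le_of_sq_le_sq ?_ (mul_nonneg (norm_nonneg d) (H.nm_nonneg x))
  rw [mul_pow, H.nm_sq, H.nm_sq, H.form_act, H.form_act_left]
  have h1 := norm_mul_le (star d * H.form x x) d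
  have h2 := norm_mul_le (star d) (H.form x x)
  rw [norm_star] at h2
  nlinarith [norm_nonneg d, norm_nonneg (H.form x x)]

theorem actC_coe (d : D) (x : V) : H.actC d (H.toCompletion x) = H.toCompletion (H.act d x) :=
  UniformSpace.Completion.map_coe (H.uniformContinuous_act d) x

theorem continuous_actC (d : D) : Continuous (H.actC d) := UniformSpace.Completion.continuous_map

theorem continuous_innerC' {T : Type*} [TopologicalSpace T] {f g : T → H.Completion}
    (hf : Continuous f) (hg : Continuous g) : Continuous (fun t => H.innerC (f t) (g t)) :=
  H.continuous_innerC.comp (hf.prodMk hg)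

instance : HilbertModule D H.Completion where
  smul d x := H.actC d.unop x
  inner := H.innerC
  inner_add_right ξ η ζ := by
    change H.innerC ξ (η + ζ) = H.innerC ξ η + H.innerC ξ ζ
    refine H.induction₃ ξ η ζ (isClosed_eq ?_ (Continuous.add ?_ ?_)) fun a b c => ?_
    · exact H.continuous_innerC' (by fun_prop) (by fun_prop)
    · exact H.continuous_innerC' (by fun_prop) (by fun_prop)
    · exact H.continuous_innerC' (by fun_prop) (by fun_prop)
    · rw [← map_add, H.innerC_coe, H.innerC_coe, H.innerC_coe, map_add]
  inner_smul_right c ξ η := by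
    change H.innerC ξ (c • η) = c • H.innerC ξ η
    have hc : Continuous (fun x : H.Completion => c • x) := continuous_const_smul c
    have hc' : Continuous (fun x : D => c • x) := continuous_const_smul c
    refine H.induction₂ ξ η (isClosed_eq ?_ (hc'.comp ?_)) fun a b => ?_
    · exact H.continuous_innerC' continuous_fst (hc.comp continuous_snd)
    · exact H.continuous_innerC
    · rw [← map_smul, H.innerC_coe, H.innerC_coe, map_smul]
  inner_op_smul_right d ξ η := by
    change H.innerC ξ (H.actC d η) = H.innerC ξ η * d
    refine H.induction₂ ξ η (isClosed_eq ?_ (Continuous.mul ?_ continuous_const)) fun a b => ?_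
    · exact H.continuous_innerC' continuous_fst ((H.continuous_actC d).comp continuous_snd)
    · exact H.continuous_innerC
    · rw [H.actC_coe, H.innerC_coe, H.innerC_coe, H.form_act]
  star_inner ξ η := by
    change star (H.innerC ξ η) = H.innerC η ξ
    refine H.induction₂ ξ η (isClosed_eq ?_ ?_) fun a b => ?_
    · exact H.continuous_innerC.star
    · exact H.continuous_innerC' continuous_snd continuous_fst
    · rw [H.innerC_coe, H.innerC_coe, H.star_form]
  inner_self_pos ξ := by
    change ∃ d : D, H.innerC ξ ξ = star d * d
    refine H.induction ξ ?_ fun a => ?_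
    · exact (isClosed_pos (D := D)).preimage (H.continuous_innerC' continuous_id continuous_id)
    · rw [H.innerC_coe]; exact H.form_pos a
  norm_inner_self ξ := by
    change ‖H.innerC ξ ξ‖ = ‖ξ‖ ^ 2
    refine H.induction ξ (isClosed_eq ?_ ?_) fun a => ?_
    · exact (H.continuous_innerC' continuous_id continuous_id).norm
    · exact continuous_norm.pow 2
    · rw [H.innerC_coe, H.norm_toCompletion, H.nm_sq]

end PreHilbertModule

namespace HilbertModule

variable {D F : Type*} [NonUnitalCStarAlgebra D] [NormedAddCommGroup F] [NormedSpace ℂ F]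
  [CompleteSpace F] [HilbertModule D F]

theorem inner_add_left (ξ η ζ : F) : inner D (ξ + η) ζ = inner D ξ ζ + inner D η ζ := by
  rw [← star_inner, inner_add_right, star_add, star_inner, star_inner]

theorem inner_smul_left (c : ℂ) (ξ η : F) : inner D (c • ξ) η = star c • inner D ξ η := by
  rw [← star_inner, inner_smul_right, star_smul, star_inner]

theorem inner_op_smul_left (d : D) (ξ η : F) :
    inner D (MulOpposite.op d • ξ) η = star d * inner D ξ η := by
  rw [← star_inner, inner_op_smul_right, star_mul, star_inner]

/-- The inner product as a sesquilinear map. -/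
def form : F →ₗ⋆[ℂ] F →ₗ[ℂ] D :=
  LinearMap.mk₂'ₛₗ (starRingEnd ℂ) (RingHom.id ℂ) (fun ξ η => inner D ξ η)
    inner_add_left inner_smul_left inner_add_right inner_smul_right

theorem form_apply (ξ η : F) : form (D := D) ξ η = inner D ξ η := rfl

theorem inner_sum_sum {ι κ : Type*} (s : Finset ι) (t : Finset κ) (x : ι → F) (y : κ → F) :
    inner D (∑ i ∈ s, x i) (∑ j ∈ t, y j) = ∑ i ∈ s, ∑ j ∈ t, inner D (x i) (y j) := by
  simp only [← form_apply]
  simp only [map_sum, LinearMap.sum_apply]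
  exact Finset.sum_comm

theorem ext_inner (ξ η : F) (h : ∀ ζ : F, inner D ζ ξ = inner D ζ η) : ξ = η := by
  rw [← sub_eq_zero, ← norm_eq_zero, ← sq_eq_zero_iff, ← norm_inner_self (D := D), norm_eq_zero,
    ← form_apply, map_sub, form_apply, form_apply, h, sub_self]

/-- Right multiplication by `d` as a linear map. -/
def act (d : D) : F →ₗ[ℂ] F where
  toFun ξ := MulOpposite.op d • ξ
  map_add' ξ η := ext_inner (D := D) _ _ fun ζ => by
    simp only [inner_op_smul_right, inner_add_right, add_mul]
  map_smul' c ξ := ext_inner (D := D) _ _ fun ζ => by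
    simp only [inner_op_smul_right, inner_smul_right, smul_mul_assoc, RingHom.id_apply]

theorem act_apply (d : D) (ξ : F) : act d ξ = MulOpposite.op d • ξ := rfl

/-- The negative part of a self-adjoint element, with its characteristic properties. -/
theorem exists_negPart {M : Type*} [NonUnitalCStarAlgebra M] (P : M) (hP : IsSelfAdjoint P) :
    ∃ N s : M, star N = N ∧ N = star s * s ∧ N * P * N = -(N * N * N) ∧
      (N = 0 → ∃ t : M, P = star t * t) := by
  let _ := CStarAlgebra.spectralOrder M
  have _ := CStarAlgebra.spectralOrderedRing M
  have hN0 : 0 ≤ P⁻ := CFC.negPart_nonneg P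
  obtain ⟨s, hs⟩ := (pos_iff (P⁻)).2 hN0
  refine ⟨P⁻, s, (IsSelfAdjoint.of_nonneg hN0).star_eq, hs, ?_, fun h => ?_⟩
  · have h1 : P⁻ * P = -(P⁻ * P⁻) := by
      have h2 : P⁻ * P = P⁻ * (P⁺ - P⁻) := by rw [CFC.posPart_sub_negPart P hP]
      rw [h2, mul_sub, CFC.negPart_mul_posPart, zero_sub]
    rw [h1, neg_mul]
  · exact (pos_iff P).2 ((CFC.negPart_eq_zero_iff P hP).1 h)

/-- Gram matrices over `D` are positive. -/
theorem gram_pos {ι : Type*} [Fintype ι] (ξ : ι → F) :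
    ∃ c : ι → ι → D, ∀ i j, inner D (ξ i) (ξ j) = ∑ k, star (c k i) * c k j := by
  classical
  let _ := CStarAlgebra.spectralOrder D
  have _ := CStarAlgebra.spectralOrderedRing D
  let P : CStarMatrix ι ι D := CStarMatrix.ofMatrix (fun i j => inner D (ξ i) (ξ j))
  have hPe : ∀ i j, P i j = inner D (ξ i) (ξ j) := fun i j => rfl
  have hP : IsSelfAdjoint P := by
    ext i j
    rw [CStarMatrix.star_apply, hPe, hPe, star_inner]
  have hent : ∀ s : CStarMatrix ι ι D, ∀ i j, (star s * s) i j = ∑ k, star (s k i) * s k j :=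
    fun s i j => by simp [CStarMatrix.mul_apply, CStarMatrix.star_apply]
  obtain ⟨N, s, hNs, hs, hNPN, hfin⟩ := exists_negPart P hP
  have hdiag : ∀ k, 0 ≤ (N * P * N) k k := by
    intro k
    have h1 : (N * P * N) k k = inner D (∑ i, act (N i k) (ξ i)) (∑ j, act (N j k) (ξ j)) := by
      rw [inner_sum_sum]
      simp only [act_apply, inner_op_smul_right, inner_op_smul_left]
      rw [mul_assoc, CStarMatrix.mul_apply]
      refine Finset.sum_congr rfl fun i _ => ?_
      rw [CStarMatrix.mul_apply, Finset.mul_sum]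
      refine Finset.sum_congr rfl fun j _ => ?_
      have h2 : star (N i k) = N k i := by
        rw [← CStarMatrix.star_apply, hNs]
      rw [h2, hPe, mul_assoc]
    rw [h1]
    exact (pos_iff _).1 (inner_self_pos _)
  have hM : star (s * N) * (s * N) = N * N * N := by
    rw [star_mul, hNs, mul_assoc, ← mul_assoc (star s), ← hs, mul_assoc]
  have hM0 : s * N = 0 := by
    ext l k
    have h1 : ∑ l, star ((s * N) l k) * (s * N) l k = -((N * P * N) k k) := by
      rw [← hent, hM, hNPN]; simp
    have h2 : ∑ l, star ((s * N) l k) * (s * N) l k = 0 :=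
      le_antisymm (by rw [h1]; exact neg_nonpos.2 (hdiag k))
        (Finset.sum_nonneg fun i _ => star_mul_self_nonneg _)
    have h3 := (Finset.sum_eq_zero_iff_of_nonneg
      (fun i _ => star_mul_self_nonneg ((s * N) i k))).1 h2 l (Finset.mem_univ l)
    exact CStarRing.star_mul_self_eq_zero_iff _ |>.1 h3
  have hN3 : N * N * N = 0 := by rw [← hM, hM0, mul_zero]
  have hNN : N * N = 0 := by
    rw [← CStarRing.star_mul_self_eq_zero_iff, star_mul, hNs, ← mul_assoc, hN3, zero_mul]
  have hNz : N = 0 := by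
    rw [← CStarRing.star_mul_self_eq_zero_iff, hNs, hNN]
  obtain ⟨t, ht⟩ := hfin hNz
  exact ⟨fun i j => t i j, fun i j => by rw [← hPe, ht, hent]⟩

end HilbertModule

/-! ### Representations on Hilbert modules and interior tensor products -/

/-- A representation of the C*-algebra `B` on the Hilbert `D`-module `F`: a nondegenerate
*-homomorphism from `B` to the adjointable operators on `F`. -/
structure HilbertRep (B D F : Type*) [NonUnitalCStarAlgebra B] [NonUnitalCStarAlgebra D]
    [NormedAddCommGroup F] [NormedSpace ℂ F] [CompleteSpace F] [HilbertModule D F] where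
  op : B →ₙₐ[ℂ] (F →L[ℂ] F)
  adjoint : ∀ (b : B) (ξ η : F), inner D (op b ξ) η = inner D ξ (op (star b) η)
  nondegenerate : (Submodule.span ℂ {ζ : F | ∃ b ξ, ζ = op b ξ}).topologicalClosure = ⊤

/-- Adjoints, on the other side. -/
theorem HilbertRep.adjoint_right {B D F : Type*} [NonUnitalCStarAlgebra B]
    [NonUnitalCStarAlgebra D] [NormedAddCommGroup F] [NormedSpace ℂ F] [CompleteSpace F]
    [HilbertModule D F] (ρ : HilbertRep B D F) (b : B) (ξ η : F) :
    inner D ξ (ρ.op b η) = inner D (ρ.op (star b) ξ) η := by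
  rw [ρ.adjoint, _root_.star_star]

section Interior

variable {D D' F E : Type*} [NonUnitalCStarAlgebra D] [NonUnitalCStarAlgebra D']
  [NormedAddCommGroup F] [NormedSpace ℂ F] [CompleteSpace F] [HilbertModule D F]
  [NormedAddCommGroup E] [NormedSpace ℂ E] [CompleteSpace E] [HilbertModule D' E]

open TensorProduct

variable (F) in
/-- The sesquilinear form `⟪ξ ⊗ η, ξ' ⊗ η'⟫ = ⟪η, ψ(⟪ξ, ξ'⟫) η'⟫` on `F ⊗ E`. -/
def interiorForm (ψ : HilbertRep D D' E) : F ⊗[ℂ] E →ₗ⋆[ℂ] F ⊗[ℂ] E →ₗ[ℂ] D' :=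
  TensorProduct.lift (LinearMap.mk₂'ₛₗ (starRingEnd ℂ) (starRingEnd ℂ)
    (fun (ξ : F) (η : E) => TensorProduct.lift (LinearMap.mk₂ ℂ
      (fun (ξ' : F) (η' : E) => inner D' η (ψ.op (inner D ξ ξ') η'))
      (fun ξ₁ ξ₂ η' => by simp [HilbertModule.inner_add_right])
      (fun c ξ' η' => by simp [HilbertModule.inner_smul_right])
      (fun ξ' η₁ η₂ => by simp [HilbertModule.inner_add_right])
      (fun c ξ' η' => by simp [HilbertModule.inner_smul_right])))
    (fun ξ₁ ξ₂ η => by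
      ext ξ' η'
      simp [HilbertModule.inner_add_left, HilbertModule.inner_add_right])
    (fun c ξ η => by
      ext ξ' η'
      simp [HilbertModule.inner_smul_left, HilbertModule.inner_smul_right])
    (fun ξ η₁ η₂ => by
      ext ξ' η'
      simp [HilbertModule.inner_add_left])
    (fun c ξ η => by
      ext ξ' η'
      simp [HilbertModule.inner_smul_left]))

theorem interiorForm_tmul (ψ : HilbertRep D D' E) (ξ ξ' : F) (η η' : E) :
    interiorForm F ψ (ξ ⊗ₜ η) (ξ' ⊗ₜ η') = inner D' η (ψ.op (inner D ξ ξ') η') := rfl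

variable (F) in
/-- The algebraic tensor product `F ⊗ E` with its `D'`-valued semi-inner product. -/
def interiorPre (ψ : HilbertRep D D' E) : PreHilbertModule D' (F ⊗[ℂ] E) where
  form := interiorForm F ψ
  act d := LinearMap.lTensor F (HilbertModule.act d)
  form_act d x y := by
    induction x using TensorProduct.induction_on with
    | zero => simp
    | add x x' hx hx' => simp only [map_add, LinearMap.add_apply, hx, hx', add_mul]
    | tmul ξ η =>
      induction y using TensorProduct.induction_on with
      | zero => simp
      | add x x' hx hx' => simp only [map_add, hx, hx', add_mul]
      | tmul ξ' η' =>
        rw [LinearMap.lTensor_tmul, interiorForm_tmul, interiorForm_tmul, ψ.adjoint_right,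
          HilbertModule.act_apply, HilbertModule.inner_op_smul_right, ψ.adjoint_right]
  star_form x y := by
    induction x using TensorProduct.induction_on with
    | zero => simp
    | add x x' hx hx' => simp only [map_add, LinearMap.add_apply, star_add, hx, hx']
    | tmul ξ η =>
      induction y using TensorProduct.induction_on with
      | zero => simp
      | add x x' hx hx' => simp only [map_add, LinearMap.add_apply, star_add, hx, hx']
      | tmul ξ' η' =>
        rw [interiorForm_tmul, interiorForm_tmul, HilbertModule.star_inner, ψ.adjoint, HilbertModule.star_inner]
  form_pos x := by
    obtain ⟨n, ξ, η, rfl⟩ : ∃ (n : ℕ) (ξ : Fin n → F) (η : Fin n → E), x = ∑ i, ξ i ⊗ₜ η i := by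
      induction x using TensorProduct.induction_on with
      | zero => exact ⟨0, Fin.elim0, Fin.elim0, by simp⟩
      | tmul ξ η => exact ⟨1, fun _ => ξ, fun _ => η, by simp⟩
      | add x y hx hy =>
        obtain ⟨n, ξ, η, rfl⟩ := hx
        obtain ⟨m, ξ', η', rfl⟩ := hy
        exact ⟨n + m, Fin.append ξ ξ', Fin.append η η', by simp [Fin.sum_univ_add]⟩
    obtain ⟨c, hc⟩ := HilbertModule.gram_pos (D := D) ξ
    have h : interiorForm F ψ (∑ i, ξ i ⊗ₜ η i) (∑ i, ξ i ⊗ₜ η i)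
        = ∑ k, inner D' (∑ i, ψ.op (c k i) (η i)) (∑ i, ψ.op (c k i) (η i)) := by
      have h1 : ∀ k, inner D' (∑ i, ψ.op (c k i) (η i)) (∑ j, ψ.op (c k j) (η j))
          = ∑ i, ∑ j, inner D' (η i) (ψ.op (star (c k i) * c k j) (η j)) := by
        intro k
        rw [HilbertModule.inner_sum_sum]
        refine Finset.sum_congr rfl fun i _ => Finset.sum_congr rfl fun j _ => ?_
        rw [ψ.adjoint, map_mul]
        rfl
      simp only [h1]
      simp only [map_sum, LinearMap.sum_apply]
      trans ∑ i, ∑ j, ∑ k, inner D' (η i) (ψ.op (star (c k i) * c k j) (η j))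
      · rw [Finset.sum_comm]
        refine Finset.sum_congr rfl fun i _ => Finset.sum_congr rfl fun j _ => ?_
        rw [interiorForm_tmul, hc, map_sum, sum_apply, ← HilbertModule.form_apply, map_sum]
        rfl
      · exact (Finset.sum_congr rfl fun i _ => Finset.sum_comm).trans Finset.sum_comm
    rw [h]
    exact pos_sum _ _ fun k _ => HilbertModule.inner_self_pos _

/-- The interior tensor product `F ⊗_D E`: the Hausdorff completion of the algebraic
tensor product `F ⊗ E` for the inner product `⟪ξ ⊗ η, ξ' ⊗ η'⟫ = ⟪η, ψ(⟪ξ, ξ'⟫) η'⟫`. -/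
abbrev InteriorTensor (F : Type*) {D D' E : Type*} [NonUnitalCStarAlgebra D]
    [NonUnitalCStarAlgebra D'] [NormedAddCommGroup F] [NormedSpace ℂ F] [CompleteSpace F]
    [HilbertModule D F] [NormedAddCommGroup E] [NormedSpace ℂ E] [CompleteSpace E]
    [HilbertModule D' E] (ψ : HilbertRep D D' E) : Type _ :=
  (interiorPre F ψ).Completion

/-- The elementary tensor `ξ ⊗ η` in the interior tensor product. -/
def tmul (ψ : HilbertRep D D' E) (ξ : F) (η : E) : InteriorTensor F ψ :=
  (interiorPre F ψ).toCompletion (ξ ⊗ₜ[ℂ] η)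

namespace HilbertRep

variable {B : Type*} [NonUnitalCStarAlgebra B]

/-- The representation `ρ'` of `B` on `F ⊗_D E` is induced by the representation `ρ` on `F`, that is,
`ρ'(b) = ρ(b) ⊗ 1` for all `b`. -/
def IsInduced (ψ : HilbertRep D D' E) (ρ : HilbertRep B D F)
    (ρ' : HilbertRep B D' (InteriorTensor F ψ)) : Prop :=
  ∀ (b : B) (ξ : F) (η : E), ρ'.op b (tmul ψ ξ η) = tmul ψ (ρ.op b ξ) η

/-- The map `V` intertwines two representations. -/
def Intertwines {F₁ F₂ : Type*}
    [NormedAddCommGroup F₁] [NormedSpace ℂ F₁] [CompleteSpace F₁] [HilbertModule D F₁]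
    [NormedAddCommGroup F₂] [NormedSpace ℂ F₂] [CompleteSpace F₂] [HilbertModule D F₂]
    (V : F₁ →ₗ[ℂ] F₂) (ρ₁ : HilbertRep B D F₁) (ρ₂ : HilbertRep B D F₂) : Prop :=
  ∀ (b : B) (ξ : F₁), V (ρ₁.op b ξ) = ρ₂.op b (V ξ)

end HilbertRep

end Interior

/-! ### Covariant representations -/

section Covariant

open scoped ZeroAtInfty

variable {X D D' F E : Type*} [TopologicalSpace X]
  [NonUnitalCStarAlgebra D] [NonUnitalCStarAlgebra D']
  [NormedAddCommGroup F] [NormedSpace ℂ F] [CompleteSpace F] [HilbertModule D F]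
  [NormedAddCommGroup E] [NormedSpace ℂ E] [CompleteSpace E] [HilbertModule D' E]

/-- The Hilbert submodule `φ(C₀(U)) F`, for an open subset `U` of `X`. -/
def HilbertRep.sub (φ : HilbertRep C₀(X, ℂ) D F) (U : Set X) : Submodule ℂ F :=
  (Submodule.span ℂ {ζ : F | ∃ f ∈ C0On U, ∃ ξ : F, ζ = φ.op f ξ}).topologicalClosure

namespace InverseSemigroupAction

variable {S : Type*} [InverseSemigroup S] [T2Space X]

/-- A covariant representation of an inverse semigroup action on the Hilbert `D`-module `F`.  The
equations between partially defined operators are stated elementwise. -/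
structure CovariantRep (A : InverseSemigroupAction S X) (D F : Type*) [NonUnitalCStarAlgebra D]
    [NormedAddCommGroup F] [NormedSpace ℂ F] [CompleteSpace F] [HilbertModule D F] where
  /-- the nondegenerate representation of `C₀(X)` -/
  φ : HilbertRep C₀(X, ℂ) D F
  /-- the unitaries `U_a` from `F_{a* a}` onto `F_{a a*}` -/
  U : ∀ a : S, φ.sub (A.D (star a * a)) ≃ₗ[ℂ] φ.sub (A.D (a * star a))
  inner_U : ∀ (a : S) (ξ η : φ.sub (A.D (star a * a))),
    inner D (U a ξ : F) (U a η : F) = inner D (ξ : F) (η : F)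
  /-- `U_b` restricts to `U_a` if `a ≤ b` -/
  restrict : ∀ a b : S, InverseSemigroup.NatLE a b →
    ∀ ξ : φ.sub (A.D (star a * a)), ∃ η : φ.sub (A.D (star b * b)),
      (η : F) = ξ ∧ (U b η : F) = U a ξ
  /-- `U_a^* = U_{a*}` -/
  adjoint : ∀ (a : S) (ξ : φ.sub (A.D (star a * a))) (η : φ.sub (A.D (a * star a)))
    (η' : φ.sub (A.D (star (star a) * star a))), (η' : F) = η →
      inner D (U a ξ : F) (η : F) = inner D (ξ : F) (U (star a) η' : F)
  /-- `U_a U_b = U_{ab}` if `a* a = b b*` -/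
  mul : ∀ a b : S, star a * a = b * star b →
    ∀ (ξ : φ.sub (A.D (star b * b))) (ζ : φ.sub (A.D (star a * a)))
      (η : φ.sub (A.D (star (a * b) * (a * b)))), (ζ : F) = U b ξ → (η : F) = ξ →
      (U a ζ : F) = U (a * b) η
  /-- `U_a φ(f) U_a^* = φ(f ∘ ϑ_{a*})` for `f ∈ C₀(D_{a* a})` -/
  covariant : ∀ (a : S) (f : C0On (A.D (star a * a))) (ξ : φ.sub (A.D (a * star a)))
    (ζ : φ.sub (A.D (star a * a))), (ζ : F) = φ.op f ((U a).symm ξ) →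
      (U a ζ : F) = φ.op (A.compStar a f) ξ

namespace CovariantRep

variable {A : InverseSemigroupAction S X}

/-- The covariant representation `c'` on `F ⊗_D E` is induced by the covariant
representation `c` on `F`, that is, `φ'(f) = φ(f) ⊗ 1` and `U'_a = U_a ⊗ 1`. -/
def IsInduced (ψ : HilbertRep D D' E) (c : A.CovariantRep D F)
    (c' : A.CovariantRep D' (InteriorTensor F ψ)) : Prop :=
  HilbertRep.IsInduced ψ c.φ c'.φ ∧
    ∀ (a : S) (ζ : c.φ.sub (A.D (star a * a))) (η : E), ∃ ω : c'.φ.sub (A.D (star a * a)),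
      (ω : InteriorTensor F ψ) = tmul ψ (ζ : F) η ∧
      (c'.U a ω : InteriorTensor F ψ) = tmul ψ (c.U a ζ : F) η

/-- The map `V` intertwines two covariant representations. -/
def Intertwines {F₁ F₂ : Type*}
    [NormedAddCommGroup F₁] [NormedSpace ℂ F₁] [CompleteSpace F₁] [HilbertModule D F₁]
    [NormedAddCommGroup F₂] [NormedSpace ℂ F₂] [CompleteSpace F₂] [HilbertModule D F₂]
    (V : F₁ →ₗ[ℂ] F₂) (c₁ : A.CovariantRep D F₁) (c₂ : A.CovariantRep D F₂) : Prop :=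
  HilbertRep.Intertwines V c₁.φ c₂.φ ∧
    ∀ (a : S) (ξ : c₁.φ.sub (A.D (star a * a))), ∃ η : c₂.φ.sub (A.D (star a * a)),
      (η : F₂) = V ξ ∧ (c₂.U a η : F₂) = V (c₁.U a ξ)

end CovariantRep

end InverseSemigroupAction

end Covariant

end

universe u v w z

/-!
# Representations of `S ⋉ C₀(X)` are covariant representations

Integration. A covariant representation `(φ, U)` turns `f δ_a` into the operator
`ξ ↦ U_a φ(f ∘ ϑ_a) ξ` (`CovariantRep.genOp`), which is defined on all of `F` because
`φ(f ∘ ϑ_a) ξ` lies in the domain of `U_a`, and which is `φ(f) U_a` on that domain.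
Writing `f = g h` in `C₀(D_{a a*})` (`exists_mul_eq`) gives the rule `φ(k) · f δ_a = (k f) δ_a`
and the formula for adjoints.  The product formula needs `U_a U_b = U_{ab}` without any condition on
`a` and `b`; it follows by restricting to `a b b*` and `a* a b` (`CovariantRep.u_mul`).  These
operators satisfy the defining relations, so their norm defines an admissible C*-seminorm
on the free *-algebra, and the representation extends to the crossed product.  It is nondegenerate
because the ideals `C₀(D_e)` span a dense subspace of `C₀(X)` (`dense_span_C0On`).

Disintegration. A representation `ρ` of the crossed product determines `φ` by
`φ(k) ρ(f δ_a) ξ = ρ(k f δ_a) ξ` and `U` by `U_a φ(f ∘ ϑ_a) ξ = ρ(f δ_a) ξ`.  The second formula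
is isometric since `(f δ_a)^* (g δ_a) = (conj f · g) ∘ ϑ_a δ_{a* a}`.  The first one defines a
bounded operator by `HilbertRep.exists_of_dense`: a C*-algebra acting by formally adjointable
operators, with any bound `‖M_b w‖ ≤ C_w ‖b‖`, acts by contractions; iterating
`‖M_b w‖² ≤ ‖w‖ ‖M_{b* b} w‖` removes the constant.  The same lemma constructs `ρ ⊗ 1`
on interior tensor products.

Naturality. For a continuous linear map `V : F₁ → F₂`, where the Hilbert modules may be over
different C*-algebras, intertwining the integrated forms is equivalent to intertwining the covariant
representations (`CovariantRep.integrate_intertwines_iff`).  Three choices of `V` are used: `V = 1`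
shows that integration is injective, isometries give the first naturality statement, and the maps
`ξ ↦ ξ ⊗ η` give compatibility with induction.
-/

noncomputable section

open InverseSemigroup
open scoped ZeroAtInfty

/-! ### Inverse semigroups -/

namespace InverseSemigroup

variable {S : Type*} [InverseSemigroup S]

theorem mul_star_mul_self_assoc (a : S) : a * (star a * a) = a := by
  rw [← mul_assoc, mul_star_mul_self]

theorem domain_idem (a : S) : (star a * a) * (star a * a) = star a * a := by
  rw [← mul_assoc, star_mul_self_star]

/-- The generalised inverse `x` of `e f` equals `f x e`, hence is idempotent; so is
`e f = star x`. -/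
theorem idem_mul_idem {e f : S} (he : e * e = e) (hf : f * f = f) :
    (e * f) * (e * f) = e * f := by
  set x := star (e * f) with hx
  have h1 : e * f * x * (e * f) = e * f := mul_star_mul_self _
  have h2 : x * (e * f) * x = x := star_mul_self_star _
  have he' : ∀ y, e * (e * y) = e * y := fun y => by rw [← mul_assoc, he]
  have hf' : ∀ y, f * (f * y) = f * y := fun y => by rw [← mul_assoc, hf]
  simp only [mul_assoc] at h1 h2
  have h3 : f * x * e = x := by
    refine star_unique (e * f) (f * x * e) ?_ ?_
    · simp only [mul_assoc, he', hf', h1]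
    · have h4 := congrArg (fun y => f * (y * e)) h2
      simp only [mul_assoc] at h4
      simp only [mul_assoc, he', hf', h4]
  have h5 : x * x = x := by
    have h4 := congrArg (fun y => f * (y * e)) h2
    simp only [mul_assoc] at h4
    calc x * x = (f * x * e) * (f * x * e) := by rw [h3]
      _ = f * x * e := by simp only [mul_assoc, h4]
      _ = x := h3
  have h6 : x = e * f := by
    have h7 := star_of_idem h5
    rwa [hx, InverseSemigroup.star_star, eq_comm] at h7
  rw [← h6, h5]

theorem idem_comm {e f : S} (he : e * e = e) (hf : f * f = f) : e * f = f * e := by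
  have he' : ∀ y, e * (e * y) = e * y := fun y => by rw [← mul_assoc, he]
  have hf' : ∀ y, f * (f * y) = f * y := fun y => by rw [← mul_assoc, hf]
  have h1 := idem_mul_idem he hf
  have h2 := idem_mul_idem hf he
  have h3 : f * e = star (e * f) := by
    refine star_unique _ _ ?_ ?_
    · simp only [mul_assoc, he', hf']
      simpa only [mul_assoc] using h1
    · simp only [mul_assoc, he', hf']
      simpa only [mul_assoc] using h2
  rw [h3, star_of_idem h1]

theorem star_mul_rev (a b : S) : star (a * b) = star b * star a := by
  have h := idem_comm (domain_idem a) (range_idem b)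
  refine (star_unique _ _ ?_ ?_).symm
  · calc a * b * (star b * star a) * (a * b)
        = a * ((b * star b) * (star a * a)) * b := by simp only [mul_assoc]
      _ = (a * star a * a) * (b * star b * b) := by rw [← h]; simp only [mul_assoc]
      _ = a * b := by rw [mul_star_mul_self, mul_star_mul_self]
  · calc star b * star a * (a * b) * (star b * star a)
        = star b * ((star a * a) * (b * star b)) * star a := by simp only [mul_assoc]
      _ = (star b * b * star b) * (star a * a * star a) := by rw [h]; simp only [mul_assoc]
      _ = star b * star a := by rw [star_mul_self_star, star_mul_self_star]

theorem natLE_idem_mul {e : S} (he : e * e = e) (a : S) : NatLE (e * a) a := by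
  have he' : ∀ y, e * (e * y) = e * y := fun y => by rw [← mul_assoc, he]
  calc e * a = e * (a * star a) * a := by rw [mul_assoc, mul_star_mul_self]
    _ = (a * star a) * e * a := by rw [idem_comm he (range_idem a)]
    _ = a * (star (e * a) * (e * a)) := by
      rw [star_mul_rev, star_of_idem he]; simp only [mul_assoc, he']

theorem natLE_mul_idem {e : S} (he : e * e = e) (a : S) : NatLE (a * e) a := by
  have he' : ∀ y, e * (e * y) = e * y := fun y => by rw [← mul_assoc, he]
  calc a * e = a * ((star a * a) * (e * e)) := by
        rw [he, ← mul_assoc, mul_star_mul_self_assoc]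
    _ = a * (e * (star a * a) * e) := by rw [idem_comm he (domain_idem a)]; simp only [mul_assoc]
    _ = a * (star (a * e) * (a * e)) := by
      rw [star_mul_rev, star_of_idem he]; simp only [mul_assoc]

end InverseSemigroup

/-! ### Transporting functions along the action -/

namespace InverseSemigroupAction

variable {S X : Type*} [InverseSemigroup S] [TopologicalSpace X] (A : InverseSemigroupAction S X)

theorem mem_source_of_natLE {a b : S} (h : NatLE a b) {x : X} (hx : x ∈ (A.θ a).source) :
    x ∈ (A.θ b).source ∧ A.θ b x = A.θ a x := by
  have h0 : x ∈ (A.θ (b * (star a * a))).source := by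
    rw [← show a = b * (star a * a) from h]; exact hx
  have h1 := A.mem_mul.1 h0
  have h2 : A.θ (star a * a) x = x := A.idem_apply (domain_idem a) h1.1
  refine ⟨h2 ▸ h1.2, ?_⟩
  have h3 := A.mul_apply h1.1 h1.2
  rw [h2, ← show a = b * (star a * a) from h] at h3
  exact h3.symm

theorem D_domain_mono {a b : S} (h : NatLE a b) : A.D (star a * a) ⊆ A.D (star b * b) := by
  rw [A.D_star_mul, A.D_star_mul]
  exact fun x hx => (A.mem_source_of_natLE h hx).1

theorem D_range_mono {a b : S} (h : NatLE a b) : A.D (a * star a) ⊆ A.D (b * star b) := by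
  rw [A.D_mul_star, A.D_mul_star]
  intro x hx
  have h1 := A.mem_source_of_natLE h ((A.θ a).map_target hx)
  rw [(A.θ a).right_inv hx] at h1
  rw [← h1.2]
  exact (A.θ b).map_source h1.1

theorem isOpen_D (e : S) : IsOpen (A.D e) := (A.θ e).open_source

variable [T2Space X]

theorem comp_apply {a : S} (f : C0On (A.D (a * star a))) {x : X} (hx : x ∈ (A.θ a).source) :
    (A.comp a f).1 x = f.1 (A.θ a x) := by
  change compZero _ _ _ = _
  simp [compZero, hx]

theorem comp_apply_zero {a : S} (f : C0On (A.D (a * star a))) {x : X}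
    (hx : x ∉ (A.θ a).source) : (A.comp a f).1 x = 0 := by
  change compZero _ _ _ = _
  simp [compZero, hx]

theorem compStar_apply {a : S} (f : C0On (A.D (star a * a))) {x : X}
    (hx : x ∈ A.D (a * star a)) : (A.compStar a f).1 x = f.1 (A.θ (star a) x) := by
  rw [← A.source_star] at hx
  change compZero _ _ _ = _
  simp [compZero, hx]

theorem comp_compStar (a : S) (f : C0On (A.D (star a * a))) : A.comp a (A.compStar a f) = f := by
  ext x
  by_cases hx : x ∈ (A.θ a).source
  · have h := A.star_apply hx
    rw [A.comp_apply _ hx, A.compStar_apply _ (by rw [← A.source_star]; exact h.1), h.2]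
  · rw [A.comp_apply_zero _ hx, f.2 x (by rwa [A.D_star_mul])]

theorem compStar_comp (a : S) (f : C0On (A.D (a * star a))) : A.compStar a (A.comp a f) = f := by
  ext x
  by_cases hx : x ∈ A.D (a * star a)
  · have h := A.star_apply' (by rwa [A.source_star] : x ∈ (A.θ (star a)).source)
    rw [A.compStar_apply _ hx, A.comp_apply _ h.1, h.2]
  · rw [(A.compStar a (A.comp a f)).2 x hx, f.2 x hx]

theorem comp_add (a : S) (f g : C0On (A.D (a * star a))) :
    A.comp a (f + g) = A.comp a f + A.comp a g := by
  ext x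
  change _ = (A.comp a f).1 x + (A.comp a g).1 x
  by_cases hx : x ∈ (A.θ a).source
  · simp only [A.comp_apply _ hx]; rfl
  · simp only [A.comp_apply_zero _ hx, add_zero]

theorem comp_smul (a : S) (c : ℂ) (f : C0On (A.D (a * star a))) :
    A.comp a (c • f) = c • A.comp a f := by
  ext x
  change _ = c • (A.comp a f).1 x
  by_cases hx : x ∈ (A.θ a).source
  · simp only [A.comp_apply _ hx]; rfl
  · simp only [A.comp_apply_zero _ hx, smul_zero]

theorem comp_mul (a : S) (f g : C0On (A.D (a * star a))) :
    A.comp a (f * g) = A.comp a f * A.comp a g := by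
  ext x
  change _ = (A.comp a f).1 x * (A.comp a g).1 x
  by_cases hx : x ∈ (A.θ a).source
  · simp only [A.comp_apply _ hx]; rfl
  · simp only [A.comp_apply_zero _ hx, mul_zero]

theorem comp_star (a : S) (f : C0On (A.D (a * star a))) :
    A.comp a (star f) = star (A.comp a f) := by
  ext x
  change _ = star ((A.comp a f).1 x)
  by_cases hx : x ∈ (A.θ a).source
  · simp only [A.comp_apply _ hx]; rfl
  · simp only [A.comp_apply_zero _ hx, star_zero]

theorem comp_of_natLE {a b : S} (h : NatLE a b) (f : C0On (A.D (a * star a)))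
    (g : C0On (A.D (b * star b))) (hfg : (f : C₀(X, ℂ)) = g) :
    (A.comp a f : C₀(X, ℂ)) = A.comp b g := by
  ext x
  by_cases hx : x ∈ (A.θ a).source
  · have h1 := A.mem_source_of_natLE h hx
    rw [A.comp_apply _ hx, A.comp_apply _ h1.1, h1.2, hfg]
  · rw [A.comp_apply_zero _ hx]
    by_cases hb : x ∈ (A.θ b).source
    · rw [A.comp_apply _ hb, ← hfg]
      refine (f.2 _ fun h1 => hx ?_).symm
      rw [A.D_mul_star] at h1
      have h2 := (A.θ a).map_target h1
      have h3 := A.mem_source_of_natLE h h2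
      rw [(A.θ a).right_inv h1] at h3
      rwa [(A.θ b).injOn h3.1 hb h3.2] at h2
    · rw [A.comp_apply_zero _ hb]

theorem starFun_apply {a : S} (f : C0On (A.D (a * star a))) {x : X} (hx : x ∈ (A.θ a).source) :
    (A.starFun a f).1 x = star (f.1 (A.θ a x)) := A.comp_apply (star f) hx

theorem starFun_coe (a : S) (f : C0On (A.D (a * star a))) :
    (A.starFun a f : C₀(X, ℂ)) = star (A.comp a f : C₀(X, ℂ)) :=
  congrArg Subtype.val (A.comp_star a f)

theorem comp_starFun (a : S) (f : C0On (A.D (a * star a))) :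
    (A.comp (star a) (A.starFun a f) : C₀(X, ℂ)) = star (f : C₀(X, ℂ)) := by
  ext x
  change _ = star (f.1 x)
  by_cases hx : x ∈ (A.θ (star a)).source
  · have h := A.star_apply' hx
    rw [A.comp_apply _ hx, A.starFun_apply f h.1, h.2]
  · rw [A.comp_apply_zero _ hx, f.2 x (by rwa [← A.source_star]), star_zero]

/-- The function of `(f δ_a) (g δ_b)`, composed with `ϑ_{ab}`, is `(f ∘ ϑ_a · g) ∘ ϑ_b`. -/
theorem comp_prodFun (a b : S) (f : C0On (A.D (a * star a))) (g : C0On (A.D (b * star b)))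
    (h : C0On (A.D (b * star b))) (hh : (h : C₀(X, ℂ)) = (A.comp a f : C₀(X, ℂ)) * g) :
    (A.comp (a * b) (A.prodFun a b f g) : C₀(X, ℂ)) = A.comp b h := by
  ext x
  by_cases hx : x ∈ (A.θ b).source
  · rw [A.comp_apply _ hx, hh]
    change _ = (A.comp a f).1 _ * g.1 _
    by_cases hx' : A.θ b x ∈ (A.θ a).source
    · have h1 := A.mem_mul.2 ⟨hx, hx'⟩
      have h2 := (A.θ a).map_source hx'
      rw [← A.D_mul_star] at h2
      rw [A.comp_apply _ h1, A.comp_apply _ hx', A.mul_apply hx hx', A.prodFun_apply a b f g h2,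
        (A.star_apply hx').2]
    · rw [A.comp_apply_zero _ (fun h1 => hx' (A.mem_mul.1 h1).2), A.comp_apply_zero _ hx', zero_mul]
  · rw [A.comp_apply_zero _ hx, A.comp_apply_zero _ (fun h1 => hx (A.mem_mul.1 h1).1)]

theorem comp_idem {e : S} (he : e * e = e) (f : C0On (A.D (e * star e))) :
    (A.comp e f : C₀(X, ℂ)) = f := by
  ext x
  by_cases hx : x ∈ (A.θ e).source
  · rw [A.comp_apply _ hx, A.idem_apply he hx]
  · rw [A.comp_apply_zero _ hx, f.2 x]
    rwa [star_of_idem he, he]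

end InverseSemigroupAction

/-! ### The ideals of functions vanishing outside an open set -/

section Functions

variable {X : Type*} [TopologicalSpace X]

theorem C0On_mono {U V : Set X} (h : U ⊆ V) {f : C₀(X, ℂ)} (hf : f ∈ C0On U) : f ∈ C0On V :=
  fun x hx => hf x fun hU => hx (h hU)

/-- Multiplication by `k ∈ C₀(X)` on the ideal `C₀(U)`. -/
def mulC0On {U : Set X} (k : C₀(X, ℂ)) (f : C0On U) : C0On U :=
  ⟨k * f, fun x hx => by simp [f.2 x hx]⟩

/-- Every function in `C₀(U)` is a product of two functions in `C₀(U)`, namely `√|f|` and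
`f / √|f|`. -/
theorem exists_mul_eq {U : Set X} (f : C0On U) : ∃ g h : C0On U, f = g * h := by
  have hsq : ∀ x, ‖f.1 x / (Real.sqrt ‖f.1 x‖ : ℂ)‖ = Real.sqrt ‖f.1 x‖ := fun x => by
    rw [norm_div, Complex.norm_real, Real.norm_eq_abs, abs_of_nonneg (Real.sqrt_nonneg _),
      Real.div_sqrt]
  have hc : Continuous fun x => Real.sqrt ‖f.1 x‖ :=
    Real.continuous_sqrt.comp (map_continuous f.1).norm
  have ht : Filter.Tendsto (fun x => Real.sqrt ‖f.1 x‖) (Filter.cocompact X) (nhds 0) := by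
    have := (Real.continuous_sqrt.tendsto _).comp f.1.zero_at_infty'.norm
    simpa [Function.comp_def] using this
  let g : C₀(X, ℂ) :=
    { toFun := fun x => (Real.sqrt ‖f.1 x‖ : ℂ)
      continuous_toFun := Complex.continuous_ofReal.comp hc
      zero_at_infty' := by
        have := (Complex.continuous_ofReal.tendsto 0).comp ht
        simpa [Function.comp_def] using this }
  let h : C₀(X, ℂ) :=
    { toFun := fun x => f.1 x / (Real.sqrt ‖f.1 x‖ : ℂ)
      continuous_toFun := by
        refine continuous_iff_continuousAt.2 fun x => ?_
        by_cases hx : f.1 x = 0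
        · have h0 : f.1 x / (Real.sqrt ‖f.1 x‖ : ℂ) = 0 := by simp [hx]
          rw [ContinuousAt, h0, tendsto_zero_iff_norm_tendsto_zero]
          simp only [hsq]
          have := hc.tendsto x
          simpa [hx] using this
        · refine ContinuousAt.div (map_continuous f.1).continuousAt
            (Complex.continuous_ofReal.comp hc).continuousAt ?_
          simp [hx]
      zero_at_infty' := by
        rw [tendsto_zero_iff_norm_tendsto_zero]
        simpa only [hsq] using ht }
  refine ⟨⟨g, fun x hx => ?_⟩, ⟨h, fun x hx => ?_⟩, ?_⟩
  · change (Real.sqrt ‖f.1 x‖ : ℂ) = 0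
    simp [f.2 x hx]
  · change f.1 x / (Real.sqrt ‖f.1 x‖ : ℂ) = 0
    simp [f.2 x hx]
  · ext x
    change f.1 x = (Real.sqrt ‖f.1 x‖ : ℂ) * (f.1 x / (Real.sqrt ‖f.1 x‖ : ℂ))
    by_cases hx : f.1 x = 0
    · simp [hx]
    · rw [mul_div_cancel₀]
      simp [hx]

variable [T2Space X] [LocallyCompactSpace X]

/-- If open sets cover `X`, then the ideals of functions supported in them span a dense subspace of
`C₀(X)`: cut a function off outside a compact set and use a partition of unity there. -/
theorem dense_span_C0On {ι : Type*} (U : ι → Set X) (hU : ∀ i, IsOpen (U i))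
    (hcov : ∀ x, ∃ i, x ∈ U i) :
    (Submodule.span ℂ {f : C₀(X, ℂ) | ∃ i, f ∈ C0On (U i)}).topologicalClosure = ⊤ := by
  set P := Submodule.span ℂ {f : C₀(X, ℂ) | ∃ i, f ∈ C0On (U i)}
  refine Submodule.eq_top_iff'.2 fun f => ?_
  refine Metric.mem_closure_iff.2 fun ε hε => ?_
  have h1 : {y : X | ‖f y‖ < ε / 2} ∈ Filter.cocompact X := by
    have h2 := f.zero_at_infty'.norm
    rw [norm_zero] at h2
    exact h2.eventually (gt_mem_nhds (half_pos hε))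
  obtain ⟨L, hL, hL'⟩ := Filter.mem_cocompact.1 h1
  obtain ⟨χ, hχ1, -, hχc, hχ⟩ := exists_continuous_one_zero_of_isCompact hL isClosed_empty
    (Set.disjoint_empty L)
  obtain ⟨t, ht⟩ := hχc.isCompact.elim_finite_subcover U hU fun x _ => Set.mem_iUnion.2 (hcov x)
  let e := t.equivFin
  obtain ⟨σ, hσU, hσ1, hσ, hσc⟩ := exists_continuous_sum_one_of_isOpen_isCompact
    (s := fun j => U (e.symm j).1) (fun j => hU _) hχc.isCompact (fun x hx => by
      obtain ⟨i, hi, hx⟩ := Set.mem_iUnion₂.1 (ht hx)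
      exact Set.mem_iUnion.2 ⟨e ⟨i, hi⟩, by simpa using hx⟩)
  let cut : C(X, ℝ) → C₀(X, ℂ) := fun s =>
    { toFun := fun x => (s x : ℂ) * ((χ x : ℂ) * f x)
      continuous_toFun := by fun_prop
      zero_at_infty' := by
        have h3 : HasCompactSupport fun x => (s x : ℂ) * ((χ x : ℂ) * f x) := by
          refine HasCompactSupport.mul_left ?_
          refine HasCompactSupport.mul_right ?_
          exact hχc.comp_left (g := fun r : ℝ => (r : ℂ)) Complex.ofReal_zero
        exact h3.is_zero_at_infty }
  have hcut : ∀ s x, cut s x = (s x : ℂ) * ((χ x : ℂ) * f x) := fun s x => rfl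
  refine ⟨∑ j, cut (σ j), Submodule.sum_mem _ fun j _ => Submodule.subset_span
    ⟨(e.symm j).1, fun x hx => ?_⟩, ?_⟩
  · rw [hcut, image_eq_zero_of_notMem_tsupport fun h => hx (hσU j h)]
    simp
  · have h4 : ∀ x, (∑ j, cut (σ j)) x = (χ x : ℂ) * f x := by
      intro x
      rw [show (∑ j, cut (σ j)) x = ∑ j, cut (σ j) x from
        map_sum (⟨⟨fun f => f x, rfl⟩, fun _ _ => rfl⟩ : C₀(X, ℂ) →+ ℂ) _ _]
      simp only [hcut]
      rw [← Finset.sum_mul, ← Complex.ofReal_sum]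
      by_cases hx : x ∈ tsupport χ
      · have h5 := hσ1 hx
        rw [Finset.sum_apply] at h5
        simp only [h5, Pi.one_apply, Complex.ofReal_one, one_mul]
      · rw [image_eq_zero_of_notMem_tsupport hx]
        simp
    refine lt_of_le_of_lt ?_ (half_lt_self hε)
    rw [dist_eq_norm, ← ZeroAtInftyContinuousMap.norm_toBCF_eq_norm,
      BoundedContinuousFunction.norm_le (half_pos hε).le]
    intro x
    change ‖f x - (∑ j, cut (σ j)) x‖ ≤ _
    rw [h4]
    by_cases hx : x ∈ L
    · simp [hχ1 hx, (half_pos hε).le]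
    · have h6 : ‖f x‖ < ε / 2 := hL' hx
      have h7 : f x - (χ x : ℂ) * f x = ((1 - χ x : ℝ) : ℂ) * f x := by push_cast; ring
      rw [h7, norm_mul, Complex.norm_real, Real.norm_eq_abs,
        abs_of_nonneg (sub_nonneg.2 (hχ x).2)]
      nlinarith [norm_nonneg (f x), (hχ x).1]

end Functions

/-! ### Operators on Hilbert modules -/

namespace HilbertModule

variable {D F : Type*} [NonUnitalCStarAlgebra D] [NormedAddCommGroup F] [NormedSpace ℂ F]
  [CompleteSpace F] [HilbertModule D F]

theorem norm_inner_le (ξ η : F) : ‖inner D ξ η‖ ≤ ‖ξ‖ * ‖η‖ := by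
  let H : PreHilbertModule D F :=
    { form := form
      act := act
      form_act := fun d x y => inner_op_smul_right d x y
      star_form := star_inner
      form_pos := inner_self_pos }
  have h : ∀ x, H.nm x = ‖x‖ := fun x => by
    change Real.sqrt ‖inner D x x‖ = _
    rw [norm_inner_self, Real.sqrt_sq (norm_nonneg x)]
  have h1 := H.norm_form_le ξ η
  rwa [h, h] at h1

theorem continuous_inner : Continuous fun z : F × F => inner D z.1 z.2 := by
  let M := (form (D := D) (F := F)).mkContinuous₂ 1 (fun x y => by
    rw [one_mul]; exact norm_inner_le x y)
  exact (M.continuous.comp continuous_fst).clm_apply continuous_snd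

theorem continuous_inner_comp {T : Type*} [TopologicalSpace T] {f g : T → F}
    (hf : Continuous f) (hg : Continuous g) : Continuous fun t => inner D (f t) (g t) :=
  continuous_inner.comp (hf.prodMk hg)

theorem norm_eq_of_inner_eq {F' : Type*} [NormedAddCommGroup F'] [NormedSpace ℂ F']
    [CompleteSpace F'] [HilbertModule D F'] {ξ : F} {ξ' : F'} (h : inner D ξ ξ = inner D ξ' ξ') :
    ‖ξ‖ = ‖ξ'‖ := by
  rw [← sq_eq_sq₀ (norm_nonneg _) (norm_nonneg _), ← norm_inner_self (D := D), h, norm_inner_self]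

/-- The map `v i ↦ w i` extends isometrically to the closed linear span of the `v i` if
both families have the same Gram matrix. -/
theorem exists_isometric_extension {ι F' : Type*} [NormedAddCommGroup F'] [NormedSpace ℂ F']
    [CompleteSpace F'] [HilbertModule D F'] (v : ι → F) (w : ι → F')
    (h : ∀ i j, inner D (w i) (w j) = inner D (v i) (v j)) (t : Submodule ℂ F)
    (ht : t = (Submodule.span ℂ (Set.range v)).topologicalClosure) :
    ∃ T : t →L[ℂ] F',
      (∀ i hi, T ⟨v i, hi⟩ = w i) ∧ (∀ ξ η, inner D (T ξ) (T η) = inner D (ξ : F) (η : F)) ∧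
        ∀ ξ, T ξ ∈ (Submodule.span ℂ (Set.range w)).topologicalClosure := by
  subst ht
  set s := Submodule.span ℂ (Set.range v) with hs
  have hv : ∀ x, Finsupp.linearCombination ℂ v x ∈ s := fun x => by
    rw [hs, ← Finsupp.range_linearCombination]
    exact LinearMap.mem_range_self _ x
  let e : (ι →₀ ℂ) →ₗ[ℂ] s.topologicalClosure :=
    (Finsupp.linearCombination ℂ v).codRestrict _ fun x => s.le_topologicalClosure (hv x)
  let f : (ι →₀ ℂ) →ₗ[ℂ] F' := Finsupp.linearCombination ℂ w
  have hin : ∀ x y, inner D (f x) (f y) = inner D (e x : F) (e y : F) := by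
    intro x y
    change inner D (Finsupp.linearCombination ℂ w x) (Finsupp.linearCombination ℂ w y)
      = inner D (Finsupp.linearCombination ℂ v x) (Finsupp.linearCombination ℂ v y)
    simp only [Finsupp.linearCombination_apply, Finsupp.sum, inner_sum_sum, inner_smul_left,
      inner_smul_right, h]
  have hd : DenseRange e := by
    have h1 : DenseRange (Set.inclusion (s.le_topologicalClosure : (s : Set F) ⊆ _)) :=
      (denseRange_inclusion_iff _).2 subset_rfl
    have h2 : Set.range (Set.inclusion (s.le_topologicalClosure : (s : Set F) ⊆ _))
        ⊆ Set.range e := by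
      rintro _ ⟨⟨x, hx⟩, rfl⟩
      have hx' := hx
      rw [SetLike.mem_coe, hs, ← Finsupp.range_linearCombination] at hx'
      obtain ⟨y, hy⟩ := hx'
      exact ⟨y, Subtype.ext hy⟩
    exact h1.mono h2
  have hn : ∃ C : ℝ, ∀ x, ‖f x‖ ≤ C * ‖e x‖ :=
    ⟨1, fun x => by rw [one_mul]; exact (norm_eq_of_inner_eq (D := D) (hin x x)).le⟩
  have hT : ∀ x, f.extendOfNorm e (e x) = f x := LinearMap.extendOfNorm_eq hd hn
  refine ⟨f.extendOfNorm e, fun i hi => ?_, fun ξ η => ?_, fun ξ => ?_⟩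
  · have h1 := hT (Finsupp.single i 1)
    have h2 : e (Finsupp.single i 1) = ⟨v i, hi⟩ := Subtype.ext (by simp [e])
    rw [h2] at h1
    simpa [f] using h1
  · refine hd.induction_on₂ (p := fun ξ η => inner D (f.extendOfNorm e ξ) (f.extendOfNorm e η)
      = inner D (ξ : F) (η : F)) ?_ (fun x y => ?_) ξ η
    · exact isClosed_eq (continuous_inner_comp (by fun_prop) (by fun_prop))
        (continuous_inner_comp (by fun_prop) (by fun_prop))
    · rw [hT, hT, hin]
  · refine hd.induction_on (p := fun ξ => f.extendOfNorm e ξ ∈ _) ξ ?_ fun x => ?_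
    · exact (Submodule.isClosed_topologicalClosure _).preimage (by fun_prop)
    · rw [hT]
      refine Submodule.le_topologicalClosure _ ?_
      rw [← Finsupp.range_linearCombination]
      exact LinearMap.mem_range_self _ x

end HilbertModule

/-! ### Representations by adjointable operators are contractive -/

/-- The operator norm of a *-representation by adjointable operators is a C*-seminorm. -/
def operatorSeminorm (D : Type*) {𝒜 F : Type*} [NonUnitalRing 𝒜] [StarRing 𝒜] [Module ℂ 𝒜]
    [NonUnitalCStarAlgebra D] [NormedAddCommGroup F] [NormedSpace ℂ F] [CompleteSpace F]
    [HilbertModule D F] (P : 𝒜 →ₙₐ[ℂ] (F →L[ℂ] F))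
    (hP : ∀ x (ξ η : F), inner D (P x ξ) η = inner D ξ (P (star x) η)) : CStarSeminorm 𝒜 where
  toFun x := ‖P x‖
  map_zero' := by simp
  add_le' x y := by rw [map_add]; exact norm_add_le _ _
  neg' x := by
    have h : P (-x) = -P x := by
      rw [← sub_eq_zero, sub_neg_eq_add, ← map_add, neg_add_cancel, map_zero]
    rw [h, norm_neg]
  smul' c x := by rw [map_smul, norm_smul]
  mul_le' x y := by rw [map_mul]; exact norm_mul_le _ _
  star_mul_self' := by
    have key : ∀ x, ‖P x‖ ^ 2 ≤ ‖P (star x * x)‖ := fun x => by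
      rw [← Real.le_sqrt (norm_nonneg _) (norm_nonneg _)]
      refine ContinuousLinearMap.opNorm_le_bound _ (Real.sqrt_nonneg _) fun ξ => ?_
      refine le_of_sq_le_sq ?_ (by positivity)
      rw [mul_pow, Real.sq_sqrt (norm_nonneg _), ← HilbertModule.norm_inner_self (D := D), hP]
      refine (HilbertModule.norm_inner_le _ _).trans ?_
      have h1 : P (star x) (P x ξ) = P (star x * x) ξ := by rw [map_mul]; rfl
      rw [h1]
      have h2 := (P (star x * x)).le_opNorm ξ
      nlinarith [norm_nonneg ξ]
    have key' : ∀ x, ‖P x‖ ≤ ‖P (star x)‖ := fun x => by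
      rcases (norm_nonneg (P x)).eq_or_lt with h | h
      · rw [← h]; exact norm_nonneg _
      · have h1 := key x
        rw [map_mul, pow_two] at h1
        exact le_of_mul_le_mul_right (h1.trans (norm_mul_le _ _)) h
    intro x
    refine le_antisymm ?_ (key x)
    rw [map_mul, pow_two]
    refine (norm_mul_le _ _).trans (mul_le_mul_of_nonneg_right ?_ (norm_nonneg _))
    simpa using key' (star x)

namespace HilbertRep

section Basic

variable {B D F : Type*} [NonUnitalCStarAlgebra B] [NonUnitalCStarAlgebra D]
  [NormedAddCommGroup F] [NormedSpace ℂ F] [CompleteSpace F] [HilbertModule D F]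

@[ext]
theorem ext {ρ ρ' : HilbertRep B D F} (h : ∀ b ξ, ρ.op b ξ = ρ'.op b ξ) : ρ = ρ' := by
  obtain ⟨p, _, _⟩ := ρ
  obtain ⟨p', _, _⟩ := ρ'
  have : p = p' := NonUnitalAlgHom.ext fun b => ContinuousLinearMap.ext fun ξ => h b ξ
  subst this
  rfl

/-- Representations are contractive: the completion of `B` in the operator seminorm is a C*-algebra,
and *-homomorphisms between C*-algebras are contractive. -/
theorem norm_op_le (ρ : HilbertRep B D F) (b : B) : ‖ρ.op b‖ ≤ ‖b‖ := by
  let q := operatorSeminorm D ρ.op ρ.adjoint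
  let j : B →⋆ₙₐ[ℂ] q.Completion :=
    { toFun := q.toCompletion
      map_smul' := map_smul q.toCompletion
      map_zero' := map_zero q.toCompletion
      map_add' := map_add q.toCompletion
      map_mul' := q.toCompletion_mul
      map_star' := q.toCompletion_star }
  have h := NonUnitalStarAlgHom.norm_apply_le j b
  change ‖q.toCompletion b‖ ≤ _ at h
  rwa [q.norm_toCompletion] at h

theorem norm_op_apply_le (ρ : HilbertRep B D F) (b : B) (ξ : F) : ‖ρ.op b ξ‖ ≤ ‖b‖ * ‖ξ‖ :=
  ((ρ.op b).le_opNorm ξ).trans (mul_le_mul_of_nonneg_right (ρ.norm_op_le b) (norm_nonneg ξ))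

theorem op_mul_apply (ρ : HilbertRep B D F) (b c : B) (ξ : F) :
    ρ.op (b * c) ξ = ρ.op b (ρ.op c ξ) := by
  rw [map_mul]; rfl

/-- The representation as a continuous linear map. -/
def opL (ρ : HilbertRep B D F) : B →L[ℂ] (F →L[ℂ] F) :=
  LinearMap.mkContinuous
    { toFun := ρ.op
      map_add' := map_add ρ.op
      map_smul' := map_smul ρ.op } 1 fun b => by
    rw [one_mul]; exact ρ.norm_op_le b

/-- A dense subspace of `B` still acts nondegenerately. -/
theorem nondegenerate_of_dense (ρ : HilbertRep B D F) {s : Set B}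
    (hs : (Submodule.span ℂ s).topologicalClosure = ⊤) :
    (Submodule.span ℂ {ζ : F | ∃ b ∈ s, ∃ ξ, ζ = ρ.op b ξ}).topologicalClosure = ⊤ := by
  set t := (Submodule.span ℂ {ζ : F | ∃ b ∈ s, ∃ ξ, ζ = ρ.op b ξ}).topologicalClosure
  rw [eq_top_iff, ← ρ.nondegenerate]
  refine Submodule.topologicalClosure_minimal _ (Submodule.span_le.2 ?_)
    (Submodule.isClosed_topologicalClosure _)
  rintro _ ⟨b, ξ, rfl⟩
  let N : Submodule ℂ B := t.comap ((ContinuousLinearMap.apply ℂ F ξ).comp ρ.opL).toLinearMap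
  have hN : IsClosed (N : Set B) := (Submodule.isClosed_topologicalClosure _).preimage
    ((ContinuousLinearMap.apply ℂ F ξ).comp ρ.opL).continuous
  have h1 : (Submodule.span ℂ s).topologicalClosure ≤ N :=
    Submodule.topologicalClosure_minimal _ (Submodule.span_le.2 fun b hb =>
      Submodule.le_topologicalClosure _ (Submodule.subset_span ⟨b, hb, ξ, rfl⟩)) hN
  rw [hs] at h1
  exact h1 (Submodule.mem_top : b ∈ _)

end Basic

end HilbertRep

/-- If `r b ^ 2 ≤ t * r (star b * b)` and `r` is bounded by some multiple of the norm, then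
iterating the estimate replaces the unknown constant by `t`. -/
theorem le_norm_mul_of_sq_le {B : Type*} [NonUnitalCStarAlgebra B] (r : B → ℝ)
    {t : ℝ} (ht : 0 ≤ t) (h : ∀ b, r b ^ 2 ≤ t * r (star b * b)) {C : ℝ}
    (hC : ∀ b, r b ≤ C * ‖b‖) (b : B) : r b ≤ ‖b‖ * t := by
  have key : ∀ (n : ℕ) (b : B), r b ^ (2 ^ n) * t ≤ t ^ (2 ^ n) * (C * ‖b‖ ^ (2 ^ n)) := by
    intro n
    induction n with
    | zero =>
      intro b
      simpa [mul_comm] using mul_le_mul_of_nonneg_left (hC b) ht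
    | succ n ih =>
      intro b
      have h1 : r b ^ (2 ^ (n + 1)) ≤ t ^ (2 ^ n) * r (star b * b) ^ (2 ^ n) := by
        rw [pow_succ', pow_mul, ← mul_pow]
        exact pow_le_pow_left₀ (by positivity) (h b) _
      calc r b ^ (2 ^ (n + 1)) * t
          ≤ t ^ (2 ^ n) * r (star b * b) ^ (2 ^ n) * t := mul_le_mul_of_nonneg_right h1 ht
        _ = t ^ (2 ^ n) * (r (star b * b) ^ (2 ^ n) * t) := by ring
        _ ≤ t ^ (2 ^ n) * (t ^ (2 ^ n) * (C * ‖star b * b‖ ^ (2 ^ n))) :=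
          mul_le_mul_of_nonneg_left (ih _) (by positivity)
        _ = t ^ (2 ^ (n + 1)) * (C * ‖b‖ ^ (2 ^ (n + 1))) := by
          rw [CStarRing.norm_star_mul_self]; ring
  by_contra! hlt
  rcases ht.eq_or_lt with h0 | h0
  · have h1 := h b
    rw [← h0, zero_mul] at h1
    rw [← h0, mul_zero] at hlt
    nlinarith
  set s := ‖b‖ * t with hs
  have key' : ∀ n : ℕ, r b ^ (2 ^ n) * t ≤ C * s ^ (2 ^ n) := fun n =>
    (key n b).trans (by rw [hs, mul_pow]; exact le_of_eq (by ring))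
  have hs0 : 0 ≤ s := by positivity
  rcases hs0.eq_or_lt with h1 | h1
  · have h2 := key' 0
    rw [← h1] at h2 hlt
    simp only [pow_zero, pow_one, mul_zero] at h2
    nlinarith
  · obtain ⟨n, hn⟩ := pow_unbounded_of_one_lt (C / t) ((one_lt_div h1).2 hlt)
    have h2 : (r b / s) ^ n ≤ (r b / s) ^ (2 ^ n) :=
      pow_le_pow_right₀ ((one_lt_div h1).2 hlt).le Nat.lt_two_pow_self.le
    have h3 : C < r b ^ (2 ^ n) / s ^ (2 ^ n) * t := by
      rw [← div_pow, ← div_lt_iff₀ h0]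
      exact hn.trans_le h2
    rw [div_mul_eq_mul_div, lt_div_iff₀ (by positivity)] at h3
    exact absurd (key' n) (not_le.2 h3)

/-- A C*-algebra acting by formally adjointable operators on a space `W` that maps onto a dense
subspace of a Hilbert module `F`, with a crude bound, is represented on `F`. -/
theorem HilbertRep.exists_of_dense {B D F W : Type*} [NonUnitalCStarAlgebra B]
    [NonUnitalCStarAlgebra D] [NormedAddCommGroup F] [NormedSpace ℂ F] [CompleteSpace F]
    [HilbertModule D F] [AddCommGroup W] [Module ℂ W] (p : W →ₗ[ℂ] F) (hp : DenseRange p)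
    (M : B → W →ₗ[ℂ] W) (hadd : ∀ b c w, p (M (b + c) w) = p (M b w) + p (M c w))
    (hsmul : ∀ (a : ℂ) b w, p (M (a • b) w) = a • p (M b w))
    (hmul : ∀ b c w, p (M (b * c) w) = p (M b (M c w)))
    (hadj : ∀ b w w', inner D (p (M b w)) (p w') = inner D (p w) (p (M (star b) w')))
    (hbd : ∀ w, ∃ C : ℝ, ∀ b, ‖p (M b w)‖ ≤ C * ‖b‖)
    (hnd : (Submodule.span ℂ {ζ : F | ∃ b w, ζ = p (M b w)}).topologicalClosure = ⊤) :
    ∃ ρ : HilbertRep B D F, ∀ b w, ρ.op b (p w) = p (M b w) := by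
  have hle : ∀ b w, ‖(p ∘ₗ M b) w‖ ≤ ‖b‖ * ‖p w‖ := by
    intro b w
    obtain ⟨C, hC⟩ := hbd w
    refine le_norm_mul_of_sq_le (fun b => ‖p (M b w)‖) (norm_nonneg _)
      (fun b => ?_) hC b
    rw [← HilbertModule.norm_inner_self (D := D), hadj, ← hmul]
    exact HilbertModule.norm_inner_le _ _
  let T : B → F →L[ℂ] F := fun b => (p ∘ₗ M b).extendOfNorm p
  have hT : ∀ b w, T b (p w) = p (M b w) := fun b =>
    LinearMap.extendOfNorm_eq hp ⟨‖b‖, hle b⟩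
  have hext : ∀ {S S' : F →L[ℂ] F}, (∀ w, S (p w) = S' (p w)) → S = S' := fun {S S'} h =>
    ContinuousLinearMap.ext fun ξ => hp.induction_on (p := fun ξ => S ξ = S' ξ) ξ
      (isClosed_eq S.continuous S'.continuous) h
  let op : B →ₙₐ[ℂ] (F →L[ℂ] F) :=
    { toFun := T
      map_smul' := fun a b => hext fun w => by
        rw [hT, hsmul, MonoidHom.id_apply, _root_.smul_apply, hT]
      map_zero' := hext fun w => by
        have := hsmul 0 0 w
        rw [zero_smul, zero_smul] at this
        rw [hT, this]; rfl
      map_add' := fun b c => hext fun w => by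
        rw [hT, hadd, _root_.add_apply, hT, hT]
      map_mul' := fun b c => hext fun w => by
        rw [hT, hmul, mul_apply_eq_comp, hT, hT] }
  refine ⟨⟨op, fun b ξ η => ?_, ?_⟩, hT⟩
  · refine hp.induction_on₂ (p := fun ξ η => inner D (T b ξ) η = inner D ξ (T (star b) η))
      ?_ (fun x y => ?_) ξ η
    · exact isClosed_eq (HilbertModule.continuous_inner_comp (by fun_prop) (by fun_prop))
        (HilbertModule.continuous_inner_comp (by fun_prop) (by fun_prop))
    · rw [hT, hT, hadj]
  · rw [eq_top_iff, ← hnd]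
    refine Submodule.topologicalClosure_mono (Submodule.span_mono ?_)
    rintro _ ⟨b, w, rfl⟩
    exact ⟨b, p w, (hT b w).symm⟩

/-! ### The submodules on which ideals of functions act nondegenerately -/

namespace HilbertRep

variable {X D F : Type*} [TopologicalSpace X] [NonUnitalCStarAlgebra D]
  [NormedAddCommGroup F] [NormedSpace ℂ F] [CompleteSpace F] [HilbertModule D F]
  (φ : HilbertRep C₀(X, ℂ) D F)

theorem op_mem_sub {U : Set X} {f : C₀(X, ℂ)} (hf : f ∈ C0On U) (ξ : F) :
    φ.op f ξ ∈ φ.sub U :=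
  Submodule.le_topologicalClosure _ (Submodule.subset_span ⟨f, hf, ξ, rfl⟩)

theorem sub_mono {U V : Set X} (h : U ⊆ V) : φ.sub U ≤ φ.sub V :=
  Submodule.topologicalClosure_mono (Submodule.span_mono fun _ ⟨f, hf, ξ, hξ⟩ =>
    ⟨f, C0On_mono h hf, ξ, hξ⟩)

/-- Continuous linear maps on `φ(C₀(U)) F` are determined by their values on the
vectors `φ(f) ξ`. -/
theorem sub_hom_ext {U : Set X} {G : Type*} [NormedAddCommGroup G] [NormedSpace ℂ G]
    {T T' : φ.sub U →L[ℂ] G}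
    (h : ∀ (f : C0On U) (ξ : F), T ⟨φ.op f ξ, φ.op_mem_sub f.2 ξ⟩
      = T' ⟨φ.op f ξ, φ.op_mem_sub f.2 ξ⟩) : T = T' := by
  set s := Submodule.span ℂ {ζ : F | ∃ f ∈ C0On U, ∃ ξ : F, ζ = φ.op f ξ}
  have hd : DenseRange (Submodule.inclusion s.le_topologicalClosure) :=
    (denseRange_inclusion_iff (s.le_topologicalClosure : (s : Set F) ⊆ _)).2 subset_rfl
  refine ContinuousLinearMap.ext fun ζ => hd.induction_on (p := fun ζ => T ζ = T' ζ) ζ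
    (isClosed_eq T.continuous T'.continuous) fun ζ => ?_
  have h1 : s ≤ (LinearMap.eqLocus (T : φ.sub U →ₗ[ℂ] G) (T' : φ.sub U →ₗ[ℂ] G)).map
      (φ.sub U).subtype := by
    refine Submodule.span_le.2 ?_
    rintro _ ⟨f, hf, ξ, rfl⟩
    exact ⟨⟨φ.op f ξ, φ.op_mem_sub hf ξ⟩, h ⟨f, hf⟩ ξ, rfl⟩
  obtain ⟨z, hz, hz'⟩ := h1 ζ.2
  have h2 : z = Submodule.inclusion s.le_topologicalClosure ζ := Subtype.ext hz'
  rw [← h2]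
  exact hz

end HilbertRep

/-! ### The crossed product -/

/-- A *-representation of `𝒜` that is bounded by the C*-seminorm `p` extends to the completion. -/
theorem CStarSeminorm.exists_hilbertRep {𝒜 D F : Type*} [NonUnitalRing 𝒜] [StarRing 𝒜]
    [Module ℂ 𝒜] [IsScalarTower ℂ 𝒜 𝒜] [SMulCommClass ℂ 𝒜 𝒜] [StarModule ℂ 𝒜]
    [NonUnitalCStarAlgebra D] [NormedAddCommGroup F] [NormedSpace ℂ F] [CompleteSpace F]
    [HilbertModule D F] (p : CStarSeminorm 𝒜) (P : 𝒜 →ₙₐ[ℂ] (F →L[ℂ] F))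
    (hP : ∀ x (ξ η : F), inner D (P x ξ) η = inner D ξ (P (star x) η)) (hle : ∀ x, ‖P x‖ ≤ p x)
    (hnd : (Submodule.span ℂ {ζ : F | ∃ x ξ, ζ = P x ξ}).topologicalClosure = ⊤) :
    ∃ ρ : HilbertRep p.Completion D F, ∀ x, ρ.op (p.toCompletion x) = P x := by
  let L : p.Completion →L[ℂ] (F →L[ℂ] F) := (P : 𝒜 →ₗ[ℂ] (F →L[ℂ] F)).extendOfNorm p.toCompletion
  have hL : ∀ x, L (p.toCompletion x) = P x :=
    LinearMap.extendOfNorm_eq p.denseRange_toCompletion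
      ⟨1, fun x => by rw [one_mul, p.norm_toCompletion]; exact hle x⟩
  let op : p.Completion →ₙₐ[ℂ] (F →L[ℂ] F) :=
    { toFun := L
      map_smul' := map_smul L
      map_zero' := map_zero L
      map_add' := map_add L
      map_mul' := fun x y => p.induction₂ x y (isClosed_eq (by fun_prop) (by fun_prop))
        fun a b => by rw [← p.toCompletion_mul, hL, hL, hL, map_mul] }
  refine ⟨⟨op, fun b ξ η => ?_, ?_⟩, hL⟩
  · refine p.induction b ?_ fun x => ?_
    · exact isClosed_eq
        (HilbertModule.continuous_inner_comp (L.continuous.clm_apply continuous_const)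
          continuous_const)
        (HilbertModule.continuous_inner_comp continuous_const
          ((L.continuous.comp continuous_star).clm_apply continuous_const))
    · change inner D (L _ ξ) η = inner D ξ (L _ η)
      rw [← p.toCompletion_star, hL, hL, hP]
  · rw [eq_top_iff, ← hnd]
    refine Submodule.topologicalClosure_mono (Submodule.span_mono ?_)
    rintro _ ⟨x, ξ, rfl⟩
    exact ⟨p.toCompletion x, ξ, (congrArg (fun T => T ξ) (hL x)).symm⟩

namespace InverseSemigroupAction

variable {S X : Type*} [InverseSemigroup S] [TopologicalSpace X] [T2Space X]
  (A : InverseSemigroupAction S X)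

theorem maxSeminorm_mem : A.maxSeminorm ∈ A.Admissible := fun x y h => by
  change ⨆ q : A.Admissible, q.1 (x - y) = 0
  have h1 : ∀ q : A.Admissible, q.1 (x - y) = 0 := fun q => q.2 x y h
  simp only [h1, Real.iSup_const_zero]

theorem le_maxSeminorm {q : CStarSeminorm (FreeStarAlgebra A.Gen)} (hq : q ∈ A.Admissible)
    (x : FreeStarAlgebra A.Gen) : q x ≤ A.maxSeminorm x :=
  le_ciSup (A.admissible_bound x) ⟨q, hq⟩

theorem δ_add (a : S) (f g : C0On (A.D (a * star a))) : A.δ a (f + g) = A.δ a f + A.δ a g :=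
  (toCompletion_eq A.maxSeminorm_mem (Rel.add a f g)).trans (map_add A.maxSeminorm.toCompletion _ _)

theorem δ_smul (a : S) (c : ℂ) (f : C0On (A.D (a * star a))) : A.δ a (c • f) = c • A.δ a f :=
  (toCompletion_eq A.maxSeminorm_mem (Rel.smul a c f)).trans
    (map_smul A.maxSeminorm.toCompletion _ _)

theorem δ_natLE {a b : S} (h : NatLE a b) (f : C0On (A.D (a * star a)))
    (g : C0On (A.D (b * star b))) (hfg : (f : C₀(X, ℂ)) = g) : A.δ a f = A.δ b g :=
  toCompletion_eq A.maxSeminorm_mem (Rel.le a b h f g hfg)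

theorem δ_mul (a b : S) (f : C0On (A.D (a * star a))) (g : C0On (A.D (b * star b))) :
    A.δ a f * A.δ b g = A.δ (a * b) (A.prodFun a b f g) :=
  (A.maxSeminorm.toCompletion_mul _ _).symm.trans
    (toCompletion_eq A.maxSeminorm_mem (Rel.mul a b f g))

theorem star_δ (a : S) (f : C0On (A.D (a * star a))) :
    star (A.δ a f) = A.δ (star a) (A.starFun a f) :=
  (A.maxSeminorm.toCompletion_star _).symm.trans
    (toCompletion_eq A.maxSeminorm_mem (Rel.star a f))

theorem norm_δ_le (a : S) (f : C0On (A.D (a * star a))) : ‖A.δ a f‖ ≤ ‖(f : C₀(X, ℂ))‖ := by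
  refine le_of_sq_le_sq ?_ (norm_nonneg _)
  have h1 : ‖A.δ a f‖ = A.maxSeminorm (A.preδ a f) := A.maxSeminorm.norm_toCompletion _
  rw [h1]
  refine (gen_bound A.maxSeminorm_mem a f).trans ?_
  have hb : ∀ y, ‖f.1 y‖ ≤ ‖(f : C₀(X, ℂ))‖ := fun y =>
    (f.1.toBCF.norm_coe_le_norm y).trans_eq (ZeroAtInftyContinuousMap.norm_toBCF_eq_norm)
  change ‖(A.prodFun a (star a) f (A.starFun a f)).1‖ ≤ _
  rw [← ZeroAtInftyContinuousMap.norm_toBCF_eq_norm,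
    BoundedContinuousFunction.norm_le (by positivity)]
  intro x
  change ‖(A.prodFun a (star a) f (A.starFun a f)).1 x‖ ≤ _
  by_cases hx : x ∈ A.D (a * star a)
  · have h2 := A.star_apply' (by rwa [A.source_star] : x ∈ (A.θ (star a)).source)
    rw [A.prodFun_apply a (star a) f _ hx, A.starFun_apply f h2.1, h2.2, norm_mul,
      norm_star, ← pow_two]
    exact pow_le_pow_left₀ (norm_nonneg _) (hb x) 2
  · rw [A.prodFun_apply_zero a (star a) f _ hx, norm_zero]
    positivity

/-- Products and adjoints of the elements `f δ_a` have the same form, so that their linear span is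
dense in the crossed product. -/
theorem dense_span_δ :
    (Submodule.span ℂ {b : A.CrossedProduct | ∃ a f, b = A.δ a f}).topologicalClosure = ⊤ := by
  have hw : ∀ w : FreeSemigroup (A.Gen × Bool), ∃ a f,
      (A.maxSeminorm.toCompletion (MonoidAlgebra.single w 1) : A.CrossedProduct) = A.δ a f := by
    have h1 : ∀ g : A.Gen × Bool, ∃ a f, (A.maxSeminorm.toCompletion
        (MonoidAlgebra.single (FreeSemigroup.of g) 1) : A.CrossedProduct) = A.δ a f := by
      rintro ⟨⟨a, f⟩, b⟩
      cases b with
      | false => exact ⟨a, f, rfl⟩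
      | true =>
        refine ⟨star a, A.starFun a f, ?_⟩
        rw [← star_δ]
        refine Eq.trans ?_ (A.maxSeminorm.toCompletion_star _)
        simp [preδ, FreeStarAlgebra.of, FreeStarAlgebra.star_single, starWord]
    intro w
    induction w using FreeSemigroup.recOnMul with
    | ih1 g => exact h1 g
    | ih2 g w hg hw =>
      obtain ⟨a, f, hf⟩ := h1 g
      obtain ⟨b, k, hk⟩ := hw
      refine ⟨a * b, A.prodFun a b f k, ?_⟩
      rw [← δ_mul, ← hf, ← hk]
      refine Eq.trans ?_ (A.maxSeminorm.toCompletion_mul _ _)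
      rw [MonoidAlgebra.single_mul_single, one_mul]
  rw [Submodule.eq_top_iff']
  intro b
  have hcl := Submodule.isClosed_topologicalClosure
    (Submodule.span ℂ {b : A.CrossedProduct | ∃ a f, b = A.δ a f})
  refine A.maxSeminorm.induction b hcl fun x => ?_
  refine Submodule.le_topologicalClosure _ ?_
  induction x using MonoidAlgebra.induction_linear with
  | zero =>
    rw [map_zero]
    exact Submodule.zero_mem _
  | add x y hx hy =>
    rw [map_add]
    exact Submodule.add_mem _ hx hy
  | single w c =>
    obtain ⟨a, f, hf⟩ := hw w
    have h1 : (MonoidAlgebra.single w c : FreeStarAlgebra A.Gen)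
        = c • MonoidAlgebra.single w 1 := by simp
    rw [h1, show A.maxSeminorm.toCompletion (c • MonoidAlgebra.single w 1) = c • A.δ a f from
      (A.maxSeminorm.toCompletion.map_smul c _).trans (congrArg (fun z => c • z) hf)]
    exact Submodule.smul_mem _ c (Submodule.subset_span ⟨a, f, rfl⟩)

end InverseSemigroupAction

/-! ### Integrating covariant representations -/

namespace InverseSemigroupAction.CovariantRep

variable {S X D F : Type*} [InverseSemigroup S] [TopologicalSpace X] [T2Space X]
  {A : InverseSemigroupAction S X} [NonUnitalCStarAlgebra D]
  [NormedAddCommGroup F] [NormedSpace ℂ F] [CompleteSpace F] [HilbertModule D F]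
  (c : A.CovariantRep D F)

/-- The unitary `U_a` as a continuous linear map to `F`. -/
def UL (a : S) : c.φ.sub (A.D (star a * a)) →L[ℂ] F :=
  LinearMap.mkContinuous ((c.φ.sub (A.D (a * star a))).subtype ∘ₗ (c.U a).toLinearMap) 1 fun ξ => by
    rw [one_mul]
    exact (HilbertModule.norm_eq_of_inner_eq (D := D) (c.inner_U a ξ ξ)).le

open Classical in
/-- The unitary `U_a` as a function on all of `F`, with junk value `0` outside its domain. -/
def u (a : S) (ξ : F) : F := if h : ξ ∈ c.φ.sub (A.D (star a * a)) then c.U a ⟨ξ, h⟩ else 0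

theorem u_of_mem {a : S} {ξ : F} (h : ξ ∈ c.φ.sub (A.D (star a * a))) : c.u a ξ = c.U a ⟨ξ, h⟩ :=
  dif_pos h

theorem u_coe {a : S} (ξ : c.φ.sub (A.D (star a * a))) : c.u a ξ = c.U a ξ := c.u_of_mem ξ.2

theorem u_mem (a : S) (ξ : F) : c.u a ξ ∈ c.φ.sub (A.D (a * star a)) := by
  unfold u
  split_ifs
  · exact Subtype.property _
  · exact Submodule.zero_mem _

theorem u_injOn {a : S} {ξ η : F} (hξ : ξ ∈ c.φ.sub (A.D (star a * a)))
    (hη : η ∈ c.φ.sub (A.D (star a * a))) (h : c.u a ξ = c.u a η) : ξ = η := by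
  rw [c.u_of_mem hξ, c.u_of_mem hη] at h
  exact congrArg Subtype.val ((c.U a).injective (Subtype.ext h))

theorem u_natLE {a b : S} (h : NatLE a b) {ξ : F} (hξ : ξ ∈ c.φ.sub (A.D (star a * a))) :
    c.u b ξ = c.u a ξ := by
  obtain ⟨η, hη, hU⟩ := c.restrict a b h ⟨ξ, hξ⟩
  rw [c.u_of_mem hξ, ← hU, ← c.u_coe, hη]

theorem u_adjoint {a : S} {ξ η : F} (hξ : ξ ∈ c.φ.sub (A.D (star a * a)))
    (hη : η ∈ c.φ.sub (A.D (a * star a))) :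
    inner D (c.u a ξ) η = inner D ξ (c.u (star a) η) := by
  have hη' : η ∈ c.φ.sub (A.D (star (star a) * star a)) := by rwa [InverseSemigroup.star_star]
  rw [c.u_of_mem hξ, c.u_of_mem hη']
  exact c.adjoint a ⟨ξ, hξ⟩ ⟨η, hη⟩ ⟨η, hη'⟩ rfl

theorem u_mul_of_eq {a b : S} (h : star a * a = b * star b) {ξ : F}
    (hξ : ξ ∈ c.φ.sub (A.D (star (a * b) * (a * b)))) : c.u a (c.u b ξ) = c.u (a * b) ξ := by
  have h1 : star (a * b) * (a * b) = star b * b := by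
    calc star (a * b) * (a * b) = star b * (star a * a) * b := by
          rw [star_mul_rev]; simp only [mul_assoc]
      _ = star b * b := by rw [h, ← mul_assoc, star_mul_self_star]
  have hξ' : ξ ∈ c.φ.sub (A.D (star b * b)) := by rwa [← h1]
  have h2 : c.u b ξ ∈ c.φ.sub (A.D (star a * a)) := by rw [h]; exact c.u_mem b ξ
  rw [c.u_of_mem h2, c.u_of_mem hξ]
  exact c.mul a b h ⟨ξ, hξ'⟩ ⟨_, h2⟩ ⟨ξ, hξ⟩ (c.u_of_mem hξ') rfl

/-- `U_a U_b = U_{ab}` on the domain of `U_{ab}`: restrict to `a b b*` and `a* a b`,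
whose product is `a b`. -/
theorem u_mul (a b : S) {ξ : F} (hξ : ξ ∈ c.φ.sub (A.D (star (a * b) * (a * b)))) :
    c.u a (c.u b ξ) = c.u (a * b) ξ := by
  have hE := domain_idem a
  have hP := range_idem b
  have hEs := star_of_idem hE
  have hPs := star_of_idem hP
  set e := star a * a with he
  set p := b * star b with hp
  have hc : e * p = p * e := idem_comm hE hP
  have h1 : a * p * (e * b) = a * b := by
    calc a * p * (e * b) = a * (p * e) * b := by simp only [mul_assoc]
      _ = (a * e) * (p * b) := by rw [← hc]; simp only [mul_assoc]
      _ = a * b := by rw [he, hp, mul_star_mul_self_assoc, mul_star_mul_self]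
  have h2 : star (a * p) * (a * p) = (e * b) * star (e * b) := by
    calc star (a * p) * (a * p) = p * e * p := by
          rw [star_mul_rev, hPs, he]; simp only [mul_assoc]
      _ = e * p * e := by rw [← hc, mul_assoc e p p, hP, hc, mul_assoc p e e, hE]
      _ = (e * b) * star (e * b) := by rw [star_mul_rev, hEs, hp]; simp only [mul_assoc]
  have h3 : star (e * b) * (e * b) = star (a * b) * (a * b) := by
    rw [star_mul_rev e b, star_mul_rev a b, hEs]
    calc star b * e * (e * b) = star b * (e * e) * b := by simp only [mul_assoc]
      _ = star b * star a * (a * b) := by rw [hE, he]; simp only [mul_assoc]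
  have hξ' : ξ ∈ c.φ.sub (A.D (star (e * b) * (e * b))) := by rwa [h3]
  rw [c.u_natLE (natLE_idem_mul hE b) hξ',
    c.u_natLE (natLE_mul_idem hP a) (by rw [h2]; exact c.u_mem _ _),
    c.u_mul_of_eq h2 (by rwa [h1]), h1]

theorem u_op (a : S) (f : C0On (A.D (a * star a))) {ξ : F}
    (hξ : ξ ∈ c.φ.sub (A.D (star a * a))) :
    c.u a (c.φ.op (A.comp a f) ξ) = c.φ.op f (c.u a ξ) := by
  have h := c.φ.op_mem_sub (A.comp a f).2 ξ
  rw [c.u_of_mem h, c.u_of_mem hξ]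
  have h1 := c.covariant a (A.comp a f) (c.U a ⟨ξ, hξ⟩) ⟨_, h⟩ (by simp)
  rwa [A.compStar_comp] at h1

theorem u_idem {e : S} (he : e * e = e) {ξ : F} (hξ : ξ ∈ c.φ.sub (A.D e)) : c.u e ξ = ξ := by
  have hs := star_of_idem he
  have h1 : star e * e = e := by rw [hs, he]
  have h2 : e * star e = e := by rw [hs, he]
  have h3 := c.u_mem e ξ
  rw [h2] at h3
  refine c.u_injOn (a := e) (by rwa [h1]) (by rwa [h1]) ?_
  rw [c.u_mul_of_eq (by rw [h1, h2]) (by rwa [he, h1]), he]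

/-- The operator by which `f δ_a` acts: `ξ ↦ U_a φ(f ∘ ϑ_a) ξ`.  It extends `φ(f) U_a` to
all of `F`. -/
def genOp (a : S) (f : C0On (A.D (a * star a))) : F →L[ℂ] F :=
  (c.UL a).comp ((c.φ.op (A.comp a f)).codRestrict _ (c.φ.op_mem_sub (A.comp a f).2))

theorem genOp_apply (a : S) (f : C0On (A.D (a * star a))) (ξ : F) :
    c.genOp a f ξ = c.u a (c.φ.op (A.comp a f) ξ) :=
  (c.u_of_mem (c.φ.op_mem_sub (A.comp a f).2 ξ)).symm

theorem genOp_apply_of_mem (a : S) (f : C0On (A.D (a * star a)))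
    (ξ : c.φ.sub (A.D (star a * a))) : c.genOp a f ξ = c.φ.op f (c.U a ξ) := by
  rw [genOp_apply, c.u_op a f ξ.2, u_coe]

theorem genOp_mul_apply (a : S) (f g : C0On (A.D (a * star a))) (ξ : F) :
    c.genOp a (f * g) ξ = c.φ.op f (c.u a (c.φ.op (A.comp a g) ξ)) := by
  rw [← c.u_op a f (c.φ.op_mem_sub (A.comp a g).2 ξ), ← c.φ.op_mul_apply, genOp_apply, comp_mul]
  rfl

theorem op_genOp (k : C₀(X, ℂ)) (a : S) (f : C0On (A.D (a * star a))) (ξ : F) :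
    c.φ.op k (c.genOp a f ξ) = c.genOp a (mulC0On k f) ξ := by
  obtain ⟨g, h, rfl⟩ := exists_mul_eq f
  have h1 : mulC0On k (g * h) = mulC0On k g * h := Subtype.ext (mul_assoc k g.1 h.1).symm
  rw [h1, genOp_mul_apply, genOp_mul_apply, ← c.φ.op_mul_apply]
  rfl

theorem genOp_add (a : S) (f g : C0On (A.D (a * star a))) :
    c.genOp a (f + g) = c.genOp a f + c.genOp a g := by
  refine ContinuousLinearMap.ext fun ξ => ?_
  have h : ∀ f, c.genOp a f ξ = c.UL a ⟨_, c.φ.op_mem_sub (A.comp a f).2 ξ⟩ := fun f => rfl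
  rw [_root_.add_apply, h, h, h, ← map_add]
  congr 1
  refine Subtype.ext ?_
  change c.φ.op (A.comp a (f + g)).1 ξ = c.φ.op (A.comp a f).1 ξ + c.φ.op (A.comp a g).1 ξ
  rw [comp_add]
  exact congrArg (fun T => T ξ) (map_add c.φ.op (A.comp a f).1 (A.comp a g).1)

theorem genOp_smul (a : S) (r : ℂ) (f : C0On (A.D (a * star a))) :
    c.genOp a (r • f) = r • c.genOp a f := by
  refine ContinuousLinearMap.ext fun ξ => ?_
  have h : ∀ f, c.genOp a f ξ = c.UL a ⟨_, c.φ.op_mem_sub (A.comp a f).2 ξ⟩ := fun f => rfl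
  rw [_root_.smul_apply, h, h, ← map_smul]
  congr 1
  refine Subtype.ext ?_
  change c.φ.op (A.comp a (r • f)).1 ξ = r • c.φ.op (A.comp a f).1 ξ
  rw [comp_smul]
  exact congrArg (fun T => T ξ) (map_smul c.φ.op r (A.comp a f).1)

theorem genOp_natLE {a b : S} (h : NatLE a b) (f : C0On (A.D (a * star a)))
    (g : C0On (A.D (b * star b))) (hfg : (f : C₀(X, ℂ)) = g) : c.genOp a f = c.genOp b g := by
  refine ContinuousLinearMap.ext fun ξ => ?_
  rw [genOp_apply, genOp_apply, ← A.comp_of_natLE h f g hfg,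
    c.u_natLE h (c.φ.op_mem_sub (A.comp a f).2 ξ)]

theorem genOp_genOp (a b : S) (f : C0On (A.D (a * star a))) (g : C0On (A.D (b * star b))) :
    c.genOp a f * c.genOp b g = c.genOp (a * b) (A.prodFun a b f g) := by
  refine ContinuousLinearMap.ext fun ξ => ?_
  rw [mul_apply_eq_comp, genOp_apply, op_genOp, genOp_apply, genOp_apply,
    ← A.comp_prodFun a b f g _ rfl, c.u_mul a b (c.φ.op_mem_sub (A.comp _ _).2 ξ)]

/-- Splitting `f = g h` moves `φ(g)` to the other side of the inner product, where it
provides a vector in the domain of `U_{a*}`. -/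
theorem genOp_adjoint (a : S) (f : C0On (A.D (a * star a))) (ξ η : F) :
    inner D (c.genOp a f ξ) η = inner D ξ (c.genOp (star a) (A.starFun a f) η) := by
  obtain ⟨g, h, rfl⟩ := exists_mul_eq f
  have hg : star (g : C₀(X, ℂ)) ∈ C0On (A.D (a * star a)) := star_mem g.2
  rw [genOp_mul_apply, c.φ.adjoint,
    c.u_adjoint (c.φ.op_mem_sub (A.comp a h).2 ξ) (c.φ.op_mem_sub hg η), c.φ.adjoint,
    ← A.comp_starFun, ← genOp_apply, op_genOp]
  congr 3
  refine Subtype.ext ?_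
  change star (A.comp a h : C₀(X, ℂ)) * (A.starFun a g : C₀(X, ℂ)) = _
  rw [starFun_coe, starFun_coe, comp_mul]
  exact (star_mul (A.comp a g : C₀(X, ℂ)) (A.comp a h)).symm

/-- The operator of a letter of the free *-algebra. -/
def letterOp : A.Gen × Bool → F →L[ℂ] F
  | (⟨a, f⟩, false) => c.genOp a f
  | (⟨a, f⟩, true) => c.genOp (star a) (A.starFun a f)

/-- The representation of the free *-algebra on the generators. -/
def freeOp : FreeStarAlgebra A.Gen →ₙₐ[ℂ] (F →L[ℂ] F) :=
  MonoidAlgebra.liftMagma ℂ (FreeSemigroup.lift c.letterOp)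

theorem freeOp_single (w : FreeSemigroup (A.Gen × Bool)) (r : ℂ) :
    c.freeOp (MonoidAlgebra.single w r) = r • FreeSemigroup.lift c.letterOp w := by
  simp [freeOp, MonoidAlgebra.liftMagma]

theorem freeOp_preδ (a : S) (f : C0On (A.D (a * star a))) :
    c.freeOp (A.preδ a f) = c.genOp a f := by
  rw [preδ, FreeStarAlgebra.of, freeOp_single, one_smul, FreeSemigroup.lift_of]
  rfl

theorem freeOp_star_preδ (a : S) (f : C0On (A.D (a * star a))) :
    c.freeOp (star (A.preδ a f)) = c.genOp (star a) (A.starFun a f) := by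
  have h : star (A.preδ a f) = MonoidAlgebra.single (FreeSemigroup.of (⟨a, f⟩, true)) 1 := by
    simp [preδ, FreeStarAlgebra.of, FreeStarAlgebra.star_single, starWord]
  rw [h, freeOp_single, one_smul, FreeSemigroup.lift_of]
  rfl

theorem letterOp_adjoint (g : A.Gen × Bool) (ξ η : F) :
    inner D (c.letterOp g ξ) η = inner D ξ (c.letterOp (g.1, !g.2) η) := by
  obtain ⟨⟨a, f⟩, b⟩ := g
  cases b with
  | false => exact c.genOp_adjoint a f ξ η
  | true =>
    rw [← HilbertModule.star_inner, ← HilbertModule.star_inner (c.letterOp _ η)]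
    exact congrArg star (c.genOp_adjoint a f η ξ).symm

theorem freeOp_adjoint (x : FreeStarAlgebra A.Gen) (ξ η : F) :
    inner D (c.freeOp x ξ) η = inner D ξ (c.freeOp (star x) η) := by
  have hw : ∀ (w : FreeSemigroup (A.Gen × Bool)) (ξ η : F),
      inner D (FreeSemigroup.lift c.letterOp w ξ) η
        = inner D ξ (FreeSemigroup.lift c.letterOp (starWord w).unop η) := by
    intro w
    induction w using FreeSemigroup.recOnMul with
    | ih1 g => simpa [starWord] using c.letterOp_adjoint g
    | ih2 g w hg hw =>
      intro ξ η
      rw [map_mul, mul_apply_eq_comp, hg, hw, map_mul, MulOpposite.unop_mul, map_mul,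
        mul_apply_eq_comp]
  induction x using MonoidAlgebra.induction_linear with
  | zero =>
    rw [star_zero, map_zero, _root_.zero_apply, _root_.zero_apply,
      ← HilbertModule.form_apply, ← HilbertModule.form_apply, map_zero, map_zero]
    rfl
  | add x y hx hy =>
    rw [star_add, map_add, map_add, _root_.add_apply, _root_.add_apply,
      HilbertModule.inner_add_left, HilbertModule.inner_add_right, hx, hy]
  | single w r =>
    rw [FreeStarAlgebra.star_single, freeOp_single, freeOp_single, _root_.smul_apply,
      _root_.smul_apply, HilbertModule.inner_smul_left, HilbertModule.inner_smul_right, hw]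

theorem freeOp_rel {x y : FreeStarAlgebra A.Gen} (h : A.Rel x y) : c.freeOp x = c.freeOp y := by
  cases h with
  | add a f g => rw [map_add]; simp only [freeOp_preδ, genOp_add]
  | smul a r f => rw [map_smul]; simp only [freeOp_preδ, genOp_smul]
  | le a b hab f g hfg => simp only [freeOp_preδ, c.genOp_natLE hab f g hfg]
  | mul a b f g => rw [map_mul]; simp only [freeOp_preδ, genOp_genOp]
  | star a f => rw [freeOp_star_preδ, freeOp_preδ]

/-- The vectors `f δ_e ξ` for idempotent `e` already span a dense subspace, as the `D_e`
cover `X`. -/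
theorem dense_span_genOp [LocallyCompactSpace X] :
    (Submodule.span ℂ {ζ : F | ∃ a f ξ, ζ = c.genOp a f ξ}).topologicalClosure = ⊤ := by
  have h := c.φ.nondegenerate_of_dense (dense_span_C0On (fun a : S => A.D (star a * a))
    (fun a => A.isOpen_D _) (fun x => by
      obtain ⟨a, ha⟩ := A.cover x
      exact ⟨a, by rwa [A.D_star_mul]⟩))
  rw [eq_top_iff, ← h]
  refine Submodule.topologicalClosure_mono (Submodule.span_mono ?_)
  rintro _ ⟨f, ⟨a, hf⟩, ξ, rfl⟩
  have he := domain_idem a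
  have hf' : f ∈ C0On (A.D ((star a * a) * star (star a * a))) := by
    rwa [star_of_idem he, he]
  refine ⟨star a * a, ⟨f, hf'⟩, ξ, ?_⟩
  rw [genOp_apply, A.comp_idem he, c.u_idem he (c.φ.op_mem_sub hf ξ)]

theorem exists_integrated [LocallyCompactSpace X] : ∃ ρ : HilbertRep A.CrossedProduct D F,
    ∀ a f ξ, ρ.op (A.δ a f) ξ = c.genOp a f ξ := by
  let q := operatorSeminorm D c.freeOp c.freeOp_adjoint
  have hq : q ∈ A.Admissible := fun x y h => by
    change ‖c.freeOp (x - y)‖ = 0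
    rw [sub_eq_add_neg, ← neg_one_smul ℂ y, map_add, map_smul, c.freeOp_rel h,
      neg_one_smul, add_neg_cancel, norm_zero]
  obtain ⟨ρ, hρ⟩ := A.maxSeminorm.exists_hilbertRep (D := D) c.freeOp c.freeOp_adjoint
    (A.le_maxSeminorm hq) (by
      rw [eq_top_iff, ← c.dense_span_genOp]
      refine Submodule.topologicalClosure_mono (Submodule.span_mono ?_)
      rintro _ ⟨a, f, ξ, rfl⟩
      exact ⟨A.preδ a f, ξ, by rw [freeOp_preδ]⟩)
  refine ⟨ρ, fun a f ξ => ?_⟩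
  rw [← c.freeOp_preδ, ← hρ]
  rfl

/-- The integrated form `U ⋉ φ` of a covariant representation. -/
def integrate [LocallyCompactSpace X] : HilbertRep A.CrossedProduct D F :=
  c.exists_integrated.choose

theorem integrate_δ [LocallyCompactSpace X] (a : S) (f : C0On (A.D (a * star a))) (ξ : F) :
    c.integrate.op (A.δ a f) ξ = c.genOp a f ξ := c.exists_integrated.choose_spec a f ξ

end InverseSemigroupAction.CovariantRep

/-! ### Disintegrating representations of the crossed product -/

namespace InverseSemigroupAction

variable {S X : Type*} [InverseSemigroup S] [TopologicalSpace X] [T2Space X]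
  (A : InverseSemigroupAction S X)

theorem prodFun_idem_left {e : S} (he : e * e = e) (b : S) (f : C0On (A.D (e * star e)))
    (g : C0On (A.D (b * star b))) :
    (A.prodFun e b f g : C₀(X, ℂ)) = (f : C₀(X, ℂ)) * g := by
  ext x
  by_cases hx : x ∈ A.D (e * star e)
  · have h1 : A.θ (star e) x = x := by
      rw [star_of_idem he]
      apply A.idem_apply he
      rwa [star_of_idem he, he] at hx
    rw [A.prodFun_apply e b f g hx, h1]; rfl
  · rw [A.prodFun_apply_zero e b f g hx]
    simp [f.2 x hx]

theorem prodFun_star_left (a b : S) (f : C0On (A.D (a * star a)))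
    (g : C0On (A.D (b * star b))) {x : X} (hx : x ∈ (A.θ a).source) :
    (A.prodFun (star a) b (A.starFun a f) g).1 x = star (f.1 (A.θ a x)) * g.1 (A.θ a x) := by
  have h : x ∈ A.D (star a * star (star a)) := by
    rwa [InverseSemigroup.star_star, A.D_star_mul]
  rw [A.prodFun_apply (star a) b _ g h, A.starFun_apply f hx, InverseSemigroup.star_star]

theorem prodFun_star_left_zero (a b : S) (f : C0On (A.D (a * star a)))
    (g : C0On (A.D (b * star b))) {x : X} (hx : x ∉ (A.θ a).source) :
    (A.prodFun (star a) b (A.starFun a f) g).1 x = 0 :=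
  A.prodFun_apply_zero (star a) b _ g (by rwa [InverseSemigroup.star_star, A.D_star_mul])

/-- `(f δ_a)^* (g δ_a) = (conj f · g) ∘ ϑ_a δ_{a* a}`. -/
theorem prodFun_star_self (a : S) (f g : C0On (A.D (a * star a))) :
    (A.prodFun (star a) a (A.starFun a f) g : C₀(X, ℂ))
      = star (A.comp a f : C₀(X, ℂ)) * A.comp a g := by
  ext x
  change _ = star ((A.comp a f).1 x) * (A.comp a g).1 x
  by_cases hx : x ∈ (A.θ a).source
  · rw [A.prodFun_star_left a a f g hx, A.comp_apply _ hx, A.comp_apply _ hx]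
  · rw [A.prodFun_star_left_zero a a f g hx, A.comp_apply_zero _ hx, A.comp_apply_zero _ hx,
      mul_zero]

/-- Multiplication by `k` and by its conjugate are adjoint to each other on the generators. -/
theorem star_δ_mul_δ (k : C₀(X, ℂ)) (a b : S) (f : C0On (A.D (a * star a)))
    (g : C0On (A.D (b * star b))) :
    star (A.δ a (mulC0On k f)) * A.δ b g = star (A.δ a f) * A.δ b (mulC0On (star k) g) := by
  rw [star_δ, star_δ, δ_mul, δ_mul]
  congr 1
  ext x
  by_cases hx : x ∈ (A.θ a).source
  · rw [A.prodFun_star_left _ _ _ _ hx, A.prodFun_star_left _ _ _ _ hx]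
    change star (k _ * f.1 _) * g.1 _ = star (f.1 _) * (star (k _) * g.1 _)
    rw [star_mul, mul_assoc]
  · rw [A.prodFun_star_left_zero _ _ _ _ hx, A.prodFun_star_left_zero _ _ _ _ hx]

end InverseSemigroupAction

namespace HilbertRep

variable {S X D F : Type*} [InverseSemigroup S] [TopologicalSpace X] [T2Space X]
  {A : InverseSemigroupAction S X} [NonUnitalCStarAlgebra D]
  [NormedAddCommGroup F] [NormedSpace ℂ F] [CompleteSpace F] [HilbertModule D F]

theorem ext_δ {ρ ρ' : HilbertRep A.CrossedProduct D F}
    (h : ∀ a f ξ, ρ.op (A.δ a f) ξ = ρ'.op (A.δ a f) ξ) : ρ = ρ' := by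
  have h1 : ρ.opL = ρ'.opL := ContinuousLinearMap.ext_on
    (Submodule.dense_iff_topologicalClosure_eq_top.2 A.dense_span_δ) (by
      rintro _ ⟨a, f, rfl⟩
      exact ContinuousLinearMap.ext (h a f))
  refine HilbertRep.ext fun b ξ => ?_
  exact congrArg (fun T => T b ξ) h1

variable (ρ : HilbertRep A.CrossedProduct D F)

theorem dense_span_op_δ : Dense (Submodule.span ℂ
    (Set.range fun q : A.Gen × F => ρ.op (A.δ q.1.1 q.1.2) q.2) : Set F) := by
  have h := ρ.nondegenerate_of_dense A.dense_span_δ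
  rw [Submodule.dense_iff_topologicalClosure_eq_top, eq_top_iff, ← h]
  refine Submodule.topologicalClosure_mono (Submodule.span_mono ?_)
  rintro _ ⟨_, ⟨a, f, rfl⟩, ξ, rfl⟩
  exact ⟨(⟨a, f⟩, ξ), rfl⟩

theorem hom_ext_δ {G : Type*} [NormedAddCommGroup G] [NormedSpace ℂ G] {T T' : F →L[ℂ] G}
    (h : ∀ a f ξ, T (ρ.op (A.δ a f) ξ) = T' (ρ.op (A.δ a f) ξ)) : T = T' :=
  ContinuousLinearMap.ext_on ρ.dense_span_op_δ (by rintro _ ⟨⟨⟨a, f⟩, ξ⟩, rfl⟩; exact h a f ξ)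

/-- `C₀(X)` acts on `F` by `k · (f δ_a) ξ = (k f) δ_a ξ`. -/
theorem exists_coeff : ∃ φ : HilbertRep C₀(X, ℂ) D F, ∀ k a f ξ,
    φ.op k (ρ.op (A.δ a f) ξ) = ρ.op (A.δ a (mulC0On k f)) ξ := by
  -- formal sums of the vectors `(f δ_a) ξ`, on which `k` acts by multiplying the functions `f`
  let v : C₀(X, ℂ) → A.Gen × F → F := fun k q => ρ.op (A.δ q.1.1 (mulC0On k q.1.2)) q.2
  let m : C₀(X, ℂ) → A.Gen × F → A.Gen × F := fun k q => (⟨q.1.1, mulC0On k q.1.2⟩, q.2)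
  let p : (A.Gen × F →₀ ℂ) →ₗ[ℂ] F :=
    Finsupp.linearCombination ℂ fun q => ρ.op (A.δ q.1.1 q.1.2) q.2
  let M : C₀(X, ℂ) → (A.Gen × F →₀ ℂ) →ₗ[ℂ] (A.Gen × F →₀ ℂ) := fun k =>
    Finsupp.lmapDomain ℂ ℂ (m k)
  have hpM : ∀ k w, p (M k w) = w.sum fun q r => r • v k q := fun k w => by
    change Finsupp.linearCombination ℂ _ (Finsupp.mapDomain _ w) = _
    rw [Finsupp.linearCombination_mapDomain, Finsupp.linearCombination_apply]
    rfl
  have hp : DenseRange p := by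
    have h := ρ.dense_span_op_δ
    rwa [← Finsupp.range_linearCombination] at h
  refine Exists.imp (fun φ hφ k a f ξ => ?_)
    (HilbertRep.exists_of_dense (D := D) p hp M ?_ ?_ ?_ ?_ ?_ ?_)
  · have h := hφ k (Finsupp.single (⟨a, f⟩, ξ) 1)
    rw [hpM] at h
    simpa [p, v] using h
  · intro k l w
    simp only [hpM, ← Finsupp.sum_add]
    refine Finsupp.sum_congr fun q _ => ?_
    have h1 : mulC0On (k + l) q.1.2 = mulC0On k q.1.2 + mulC0On l q.1.2 :=
      Subtype.ext (add_mul k l q.1.2.1)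
    simp only [v]
    rw [h1, A.δ_add, map_add, _root_.add_apply, smul_add]
  · intro r k w
    simp only [hpM, Finsupp.smul_sum]
    refine Finsupp.sum_congr fun q _ => ?_
    have h1 : mulC0On (r • k) q.1.2 = r • mulC0On k q.1.2 :=
      Subtype.ext (smul_mul_assoc r k q.1.2.1)
    simp only [v]
    rw [h1, A.δ_smul, map_smul, _root_.smul_apply, smul_comm]
  · intro k l w
    have h1 : M (k * l) w = M k (M l w) := by
      change Finsupp.mapDomain _ _ = Finsupp.mapDomain _ (Finsupp.mapDomain _ _)
      rw [← Finsupp.mapDomain_comp]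
      congr 1
      funext q
      simp only [m, Function.comp]
      congr 2
      exact Subtype.ext (mul_assoc k l q.1.2.1)
    rw [h1]
  · intro k w w'
    rw [hpM, hpM]
    simp only [p, Finsupp.linearCombination_apply, Finsupp.sum, HilbertModule.inner_sum_sum,
      HilbertModule.inner_smul_left, HilbertModule.inner_smul_right]
    refine Finset.sum_congr rfl fun q _ => Finset.sum_congr rfl fun q' _ => ?_
    congr 2
    simp only [v]
    rw [ρ.adjoint, ← ρ.op_mul_apply, ρ.adjoint, ← ρ.op_mul_apply, A.star_δ_mul_δ]
  · intro w
    refine ⟨w.sum fun q r => ‖r‖ * (‖(q.1.2 : C₀(X, ℂ))‖ * ‖q.2‖), fun k => ?_⟩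
    rw [hpM, Finsupp.sum, Finsupp.sum, Finset.sum_mul]
    refine norm_sum_le_of_le _ fun q _ => ?_
    rw [norm_smul, mul_assoc]
    refine mul_le_mul_of_nonneg_left ?_ (norm_nonneg _)
    refine (ρ.norm_op_apply_le _ _).trans ?_
    have h1 : ‖A.δ q.1.1 (mulC0On k q.1.2)‖ ≤ ‖k‖ * ‖(q.1.2 : C₀(X, ℂ))‖ :=
      (A.norm_δ_le _ _).trans (norm_mul_le k q.1.2.1)
    calc _ ≤ ‖k‖ * ‖(q.1.2 : C₀(X, ℂ))‖ * ‖q.2‖ :=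
          mul_le_mul_of_nonneg_right h1 (norm_nonneg _)
      _ = _ := by ring
  · rw [eq_top_iff, ← Submodule.dense_iff_topologicalClosure_eq_top.1 ρ.dense_span_op_δ]
    refine Submodule.topologicalClosure_mono (Submodule.span_mono ?_)
    rintro _ ⟨⟨⟨a, f⟩, ξ⟩, rfl⟩
    obtain ⟨g, h, rfl⟩ := exists_mul_eq f
    refine ⟨g, Finsupp.single (⟨a, h⟩, ξ) 1, ?_⟩
    rw [hpM, Finsupp.sum_single_index (a := (⟨a, h⟩, ξ)) (h := fun q r => r • v g q)
      (zero_smul ℂ _), one_smul]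
    rfl

/-- The representation of `C₀(X)` underlying a representation of the crossed product. -/
def coeff : HilbertRep C₀(X, ℂ) D F := ρ.exists_coeff.choose

theorem coeff_op_δ (k : C₀(X, ℂ)) (a : S) (f : C0On (A.D (a * star a))) (ξ : F) :
    ρ.coeff.op k (ρ.op (A.δ a f) ξ) = ρ.op (A.δ a (mulC0On k f)) ξ :=
  ρ.exists_coeff.choose_spec k a f ξ

theorem coeff_op_of_idem {e : S} (he : e * e = e) (f : C0On (A.D (e * star e))) (ξ : F) :
    ρ.coeff.op f ξ = ρ.op (A.δ e f) ξ := by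
  refine congrArg (fun T : F →L[ℂ] F => T ξ) (ρ.hom_ext_δ fun b g ξ => ?_)
  rw [coeff_op_δ, ← ρ.op_mul_apply, A.δ_mul,
    A.δ_natLE (natLE_idem_mul he b) _ (mulC0On f g) (A.prodFun_idem_left he b f g)]

theorem op_δ_mem_sub (a : S) (f : C0On (A.D (a * star a))) (ξ : F) :
    ρ.op (A.δ a f) ξ ∈ ρ.coeff.sub (A.D (a * star a)) := by
  obtain ⟨g, h, rfl⟩ := exists_mul_eq f
  have h1 := ρ.coeff_op_δ g a h ξ
  change _ = ρ.op (A.δ a (g * h)) ξ at h1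
  rw [← h1]
  exact ρ.coeff.op_mem_sub g.2 _

theorem inner_op_δ (a : S) (f g : C0On (A.D (a * star a))) (ξ η : F) :
    inner D (ρ.op (A.δ a f) ξ) (ρ.op (A.δ a g) η)
      = inner D (ρ.coeff.op (A.comp a f) ξ) (ρ.coeff.op (A.comp a g) η) := by
  rw [ρ.adjoint, ρ.coeff.adjoint, ← ρ.op_mul_apply, ← ρ.coeff.op_mul_apply, A.star_δ, A.δ_mul,
    ← ρ.coeff_op_of_idem (domain_idem a), A.prodFun_star_self]

/-- The unitary `U_a` is determined by `U_a φ(f ∘ ϑ_a) ξ = (f δ_a) ξ`. -/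
theorem exists_transport (a : S) : ∃ T : ρ.coeff.sub (A.D (star a * a)) →L[ℂ] F,
    (∀ (f : C0On (A.D (a * star a))) ξ,
      T ⟨_, ρ.coeff.op_mem_sub (A.comp a f).2 ξ⟩ = ρ.op (A.δ a f) ξ) ∧
    (∀ ξ η, inner D (T ξ) (T η) = inner D (ξ : F) (η : F)) ∧
    ∀ ξ, T ξ ∈ ρ.coeff.sub (A.D (a * star a)) := by
  let v : C0On (A.D (a * star a)) × F → F := fun q => ρ.coeff.op (A.comp a q.1) q.2
  let w : C0On (A.D (a * star a)) × F → F := fun q => ρ.op (A.δ a q.1) q.2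
  have hs : ρ.coeff.sub (A.D (star a * a))
      = (Submodule.span ℂ (Set.range v)).topologicalClosure := by
    unfold HilbertRep.sub
    congr 2
    ext ζ
    constructor
    · rintro ⟨f, hf, ξ, rfl⟩
      refine ⟨(A.compStar a ⟨f, hf⟩, ξ), ?_⟩
      simp only [v, A.comp_compStar]
    · rintro ⟨⟨f, ξ⟩, rfl⟩
      exact ⟨_, (A.comp a f).2, ξ, rfl⟩
  obtain ⟨T, hT, hT', hT''⟩ := HilbertModule.exists_isometric_extension (D := D) v w
    (fun q q' => ρ.inner_op_δ a q.1 q'.1 q.2 q'.2) _ hs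
  refine ⟨T, fun f ξ => hT (f, ξ) _, hT', fun ξ => ?_⟩
  refine Submodule.topologicalClosure_minimal _ (Submodule.span_le.2 ?_)
    (Submodule.isClosed_topologicalClosure _) (hT'' ξ)
  rintro _ ⟨⟨f, η⟩, rfl⟩
  exact ρ.op_δ_mem_sub a f η

/-- The unitary `U_a` belonging to a representation of the crossed product, as a map from
`φ(C₀(D_{a* a})) F` to `F`. -/
def transport (a : S) : ρ.coeff.sub (A.D (star a * a)) →L[ℂ] F := (ρ.exists_transport a).choose

theorem transport_op (a : S) (f : C0On (A.D (a * star a))) (ξ : F) :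
    ρ.transport a ⟨_, ρ.coeff.op_mem_sub (A.comp a f).2 ξ⟩ = ρ.op (A.δ a f) ξ :=
  (ρ.exists_transport a).choose_spec.1 f ξ

theorem transport_op_of_eq (a : S) (f : C0On (A.D (a * star a))) (ξ : F)
    (ζ : ρ.coeff.sub (A.D (star a * a))) (h : (ζ : F) = ρ.coeff.op (A.comp a f) ξ) :
    ρ.transport a ζ = ρ.op (A.δ a f) ξ := by
  rw [← transport_op]
  exact congrArg _ (Subtype.ext h)

theorem inner_transport (a : S) (ξ η : ρ.coeff.sub (A.D (star a * a))) :
    inner D (ρ.transport a ξ) (ρ.transport a η) = inner D (ξ : F) (η : F) :=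
  (ρ.exists_transport a).choose_spec.2.1 ξ η

theorem transport_mem (a : S) (ξ : ρ.coeff.sub (A.D (star a * a))) :
    ρ.transport a ξ ∈ ρ.coeff.sub (A.D (a * star a)) :=
  (ρ.exists_transport a).choose_spec.2.2 ξ

theorem transport_star_mem (a : S) (η : ρ.coeff.sub (A.D (star (star a) * star a))) :
    ρ.transport (star a) η ∈ ρ.coeff.sub (A.D (star a * a)) := by
  have h := ρ.transport_mem (star a) η
  have h1 : star a * star (star a) = star a * a := by rw [InverseSemigroup.star_star]
  rwa [h1] at h

/-- Continuous linear maps on the domain of `U_a` are determined by their values on the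
vectors `φ(f ∘ ϑ_a) ξ`, because every function in `C₀(D_{a* a})` has the form `f ∘ ϑ_a`. -/
theorem sub_hom_ext_comp (φ : HilbertRep C₀(X, ℂ) D F) {a : S} {G : Type*} [NormedAddCommGroup G]
    [NormedSpace ℂ G] {T T' : φ.sub (A.D (star a * a)) →L[ℂ] G}
    (h : ∀ (f : C0On (A.D (a * star a))) ξ, T ⟨_, φ.op_mem_sub (A.comp a f).2 ξ⟩
      = T' ⟨_, φ.op_mem_sub (A.comp a f).2 ξ⟩) : T = T' :=
  φ.sub_hom_ext fun f ξ => by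
    have h1 := h (A.compStar a f) ξ
    simpa only [A.comp_compStar] using h1

theorem transport_natLE {a b : S} (h : NatLE a b) (ξ : ρ.coeff.sub (A.D (star a * a)))
    (hξ : (ξ : F) ∈ ρ.coeff.sub (A.D (star b * b))) : ρ.transport b ⟨ξ, hξ⟩ = ρ.transport a ξ := by
  let i : ρ.coeff.sub (A.D (star a * a)) →L[ℂ] ρ.coeff.sub (A.D (star b * b)) :=
    (ρ.coeff.sub (A.D (star a * a))).subtypeL.codRestrict _ fun ξ =>
      ρ.coeff.sub_mono (A.D_domain_mono h) ξ.2
  have h1 : (ρ.transport b).comp i = ρ.transport a := ρ.coeff.sub_hom_ext_comp fun f ξ => by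
    let g : C0On (A.D (b * star b)) := ⟨f, C0On_mono (A.D_range_mono h) f.2⟩
    rw [transport_op, A.δ_natLE h f g rfl]
    refine ρ.transport_op_of_eq b g ξ _ ?_
    rw [← A.comp_of_natLE h f g rfl]
    rfl
  exact congrArg (fun T => T ξ) h1

theorem transport_transport {a b : S} (h : star a * a = b * star b)
    (ξ : ρ.coeff.sub (A.D (star b * b))) (ζ : ρ.coeff.sub (A.D (star a * a)))
    (η : ρ.coeff.sub (A.D (star (a * b) * (a * b)))) (hζ : (ζ : F) = ρ.transport b ξ)
    (hη : (η : F) = ξ) : ρ.transport a ζ = ρ.transport (a * b) η := by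
  have hd : A.D (star b * b) = A.D (star (a * b) * (a * b)) := by
    congr 1
    symm
    calc star (a * b) * (a * b) = star b * (star a * a) * b := by
          rw [star_mul_rev]; simp only [mul_assoc]
      _ = star b * b := by rw [h, ← mul_assoc, star_mul_self_star]
  let i : ρ.coeff.sub (A.D (star b * b)) →L[ℂ] ρ.coeff.sub (A.D (star (a * b) * (a * b))) :=
    (ρ.coeff.sub (A.D (star b * b))).subtypeL.codRestrict _ fun ξ => by
      rw [← hd]; exact ξ.2
  let j : ρ.coeff.sub (A.D (star b * b)) →L[ℂ] ρ.coeff.sub (A.D (star a * a)) :=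
    (ρ.transport b).codRestrict _ fun ξ => by rw [h]; exact ρ.transport_mem b ξ
  have h1 : (ρ.transport a).comp j = (ρ.transport (a * b)).comp i :=
    ρ.coeff.sub_hom_ext_comp fun f ξ => by
      obtain ⟨g, k, rfl⟩ := exists_mul_eq f
      let g' : C0On (A.D (star a * a)) := ⟨g, by rw [h]; exact g.2⟩
      -- both sides equal `(g ∘ ϑ_{a*} δ_a) (k δ_b) ξ`
      have hgk : g * k = mulC0On g k := rfl
      have h2 : (ρ.transport a).comp j ⟨_, ρ.coeff.op_mem_sub (A.comp b (g * k)).2 ξ⟩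
          = ρ.op (A.δ a (A.compStar a g')) (ρ.op (A.δ b k) ξ) := by
        rw [ContinuousLinearMap.comp_apply]
        refine ρ.transport_op_of_eq a _ _ _ ?_
        rw [A.comp_compStar, ContinuousLinearMap.coe_codRestrict_apply, transport_op, hgk,
          ← coeff_op_δ]
      rw [h2, ← ρ.op_mul_apply, A.δ_mul, ContinuousLinearMap.comp_apply]
      refine (ρ.transport_op_of_eq (a * b) _ ξ _ ?_).symm
      rw [A.comp_prodFun a b (A.compStar a g') k (g * k) (by rw [A.comp_compStar]; rfl)]
      rfl
  have h2 : ζ = j ξ :=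
    Subtype.ext (hζ.trans (ContinuousLinearMap.coe_codRestrict_apply _ _ _ _).symm)
  have h3 : η = i ξ := Subtype.ext <| by
    rw [hη, ContinuousLinearMap.coe_codRestrict_apply, Submodule.subtypeL_apply]
  rw [h2, h3]
  exact congrArg (fun T => T ξ) h1

theorem transport_idem {e : S} (he : e * e = e) (ξ : ρ.coeff.sub (A.D (star e * e))) :
    ρ.transport e ξ = ξ := by
  have h : ρ.transport e = (ρ.coeff.sub (A.D (star e * e))).subtypeL :=
    ρ.coeff.sub_hom_ext_comp fun f ξ => by
      rw [transport_op, ← ρ.coeff_op_of_idem he, ← A.comp_idem he]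
      rfl
  rw [h]
  rfl

theorem transport_transport_star (a : S) (η : ρ.coeff.sub (A.D (star (star a) * star a)))
    (ζ : ρ.coeff.sub (A.D (star a * a))) (hζ : (ζ : F) = ρ.transport (star a) η) :
    ρ.transport a ζ = η := by
  have he := range_idem a
  have hη : (η : F) ∈ ρ.coeff.sub (A.D (star (a * star a) * (a * star a))) := by
    rw [star_of_idem he, he]
    simpa only [InverseSemigroup.star_star] using η.2
  rw [ρ.transport_transport (by rw [InverseSemigroup.star_star]) η ζ ⟨η, hη⟩ hζ rfl,
    ρ.transport_idem he]

theorem exists_transport_eq (a : S) (η : ρ.coeff.sub (A.D (a * star a))) :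
    ∃ ζ, ρ.transport a ζ = η := by
  have hη : (η : F) ∈ ρ.coeff.sub (A.D (star (star a) * star a)) := by
    simpa only [InverseSemigroup.star_star] using η.2
  have hζ := ρ.transport_star_mem a ⟨η, hη⟩
  exact ⟨⟨_, hζ⟩, ρ.transport_transport_star a ⟨η, hη⟩ ⟨_, hζ⟩ rfl⟩

theorem transport_coeff_op (a : S) (f : C0On (A.D (star a * a)))
    (ξ ζ : ρ.coeff.sub (A.D (star a * a))) (hζ : (ζ : F) = ρ.coeff.op f ξ) :
    ρ.transport a ζ = ρ.coeff.op (A.compStar a f) (ρ.transport a ξ) := by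
  let j : ρ.coeff.sub (A.D (star a * a)) →L[ℂ] ρ.coeff.sub (A.D (star a * a)) :=
    ((ρ.coeff.op f).comp (Submodule.subtypeL _)).codRestrict _ fun ξ =>
      ρ.coeff.op_mem_sub f.2 (ξ : F)
  have h1 : (ρ.transport a).comp j = (ρ.coeff.op (A.compStar a f)).comp (ρ.transport a) :=
    ρ.coeff.sub_hom_ext_comp fun g ξ => by
      rw [ContinuousLinearMap.comp_apply, ContinuousLinearMap.comp_apply, transport_op, coeff_op_δ]
      refine ρ.transport_op_of_eq a (A.compStar a f * g) ξ _ ?_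
      rw [A.comp_mul, A.comp_compStar]
      exact (ρ.coeff.op_mul_apply f.1 (A.comp a g).1 ξ).symm
  have h2 : ζ = j ξ := Subtype.ext hζ
  rw [h2]
  exact congrArg (fun T => T ξ) h1

/-- The map `transport` as an equivalence onto its range; the inverse of `U_a` is `U_{a*}`. -/
def transportEquiv (a : S) :
    ρ.coeff.sub (A.D (star a * a)) ≃ₗ[ℂ] ρ.coeff.sub (A.D (a * star a)) :=
  LinearEquiv.ofBijective
    ((ρ.transport a).toLinearMap.codRestrict (ρ.coeff.sub (A.D (a * star a))) (ρ.transport_mem a))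
    ⟨fun ξ η h => by
      have h1 : ρ.transport a (ξ - η) = 0 := by
        rw [map_sub, sub_eq_zero]
        exact congrArg Subtype.val h
      have h2 := HilbertModule.norm_eq_of_inner_eq (D := D) (ρ.inner_transport a (ξ - η) (ξ - η))
      rw [h1, norm_zero] at h2
      exact sub_eq_zero.1 (Subtype.ext (norm_eq_zero.1 h2.symm)),
    fun η => by
      obtain ⟨ζ, hζ⟩ := ρ.exists_transport_eq a η
      exact ⟨ζ, Subtype.ext hζ⟩⟩

/-- The covariant representation belonging to a representation of the crossed product. -/
def disintegrate : A.CovariantRep D F where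
  φ := ρ.coeff
  U := ρ.transportEquiv
  inner_U a ξ η := ρ.inner_transport a ξ η
  restrict a b h ξ := ⟨⟨ξ, ρ.coeff.sub_mono (A.D_domain_mono h) ξ.2⟩, rfl,
    ρ.transport_natLE h ξ _⟩
  adjoint a ξ η η' h := by
    have hζ := ρ.transport_star_mem a η'
    have h1 := ρ.transport_transport_star a η' ⟨_, hζ⟩ rfl
    rw [← h]
    conv_lhs => rw [← h1]
    exact ρ.inner_transport a ξ ⟨_, hζ⟩
  mul a b h ξ ζ η hζ hη := ρ.transport_transport h ξ ζ η hζ hη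
  covariant a f ξ ζ hζ := by
    refine (ρ.transport_coeff_op a f _ ζ hζ).trans ?_
    congr 1
    exact congrArg Subtype.val ((ρ.transportEquiv a).apply_symm_apply ξ)

theorem integrate_disintegrate [LocallyCompactSpace X] : ρ.disintegrate.integrate = ρ :=
  ext_δ fun a f ξ => by
    rw [InverseSemigroupAction.CovariantRep.integrate_δ]
    exact ρ.transport_op a f ξ

end HilbertRep

/-! ### Naturality -/

theorem HilbertRep.map_mem_sub {X D₁ D₂ F₁ F₂ : Type*} [TopologicalSpace X]
    [NonUnitalCStarAlgebra D₁] [NonUnitalCStarAlgebra D₂]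
    [NormedAddCommGroup F₁] [NormedSpace ℂ F₁] [CompleteSpace F₁] [HilbertModule D₁ F₁]
    [NormedAddCommGroup F₂] [NormedSpace ℂ F₂] [CompleteSpace F₂] [HilbertModule D₂ F₂]
    {φ₁ : HilbertRep C₀(X, ℂ) D₁ F₁} {φ₂ : HilbertRep C₀(X, ℂ) D₂ F₂}
    {V : F₁ →L[ℂ] F₂} (h : ∀ f ξ, V (φ₁.op f ξ) = φ₂.op f (V ξ)) {U : Set X} {ξ : F₁}
    (hξ : ξ ∈ φ₁.sub U) : V ξ ∈ φ₂.sub U := by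
  have h1 : φ₁.sub U ≤ (φ₂.sub U).comap V.toLinearMap := by
    refine Submodule.topologicalClosure_minimal _ (Submodule.span_le.2 ?_)
      ((Submodule.isClosed_topologicalClosure _).preimage V.continuous)
    rintro _ ⟨f, hf, η, rfl⟩
    change V (φ₁.op f η) ∈ φ₂.sub U
    rw [h]
    exact φ₂.op_mem_sub hf _
  exact h1 hξ

namespace InverseSemigroupAction.CovariantRep

variable {S X : Type*} [InverseSemigroup S] [TopologicalSpace X] [T2Space X]
  {A : InverseSemigroupAction S X}

section Intertwiners

variable {D₁ D₂ F₁ F₂ : Type*} [NonUnitalCStarAlgebra D₁] [NonUnitalCStarAlgebra D₂]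
  [NormedAddCommGroup F₁] [NormedSpace ℂ F₁] [CompleteSpace F₁] [HilbertModule D₁ F₁]
  [NormedAddCommGroup F₂] [NormedSpace ℂ F₂] [CompleteSpace F₂] [HilbertModule D₂ F₂]

/-- A continuous linear map intertwines integrated forms if and only if it intertwines the covariant
representations.  The two coefficient algebras may differ, so that the maps `ξ ↦ ξ ⊗ η` are
covered as well as isometries. -/
theorem integrate_intertwines_iff [LocallyCompactSpace X] (V : F₁ →L[ℂ] F₂)
    (c₁ : A.CovariantRep D₁ F₁) (c₂ : A.CovariantRep D₂ F₂) :
    (∀ b ξ, V (c₁.integrate.op b ξ) = c₂.integrate.op b (V ξ)) ↔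
      (∀ f ξ, V (c₁.φ.op f ξ) = c₂.φ.op f (V ξ)) ∧
        ∀ (a : S) (ξ : c₁.φ.sub (A.D (star a * a))), ∃ η : c₂.φ.sub (A.D (star a * a)),
          (η : F₂) = V ξ ∧ (c₂.U a η : F₂) = V (c₁.U a ξ) := by
  constructor
  · intro h
    have hφ : ∀ f ξ, V (c₁.φ.op f ξ) = c₂.φ.op f (V ξ) := by
      intro k ξ
      have h1 : V.comp (c₁.φ.op k) = (c₂.φ.op k).comp V := c₁.integrate.hom_ext_δ fun a f ξ => by
        rw [ContinuousLinearMap.comp_apply, ContinuousLinearMap.comp_apply, h, integrate_δ,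
          integrate_δ, op_genOp, op_genOp, ← integrate_δ, ← integrate_δ, h]
      exact congrArg (fun T => T ξ) h1
    refine ⟨hφ, fun a ξ => ⟨⟨V ξ, HilbertRep.map_mem_sub hφ ξ.2⟩, rfl, ?_⟩⟩
    let j : c₁.φ.sub (A.D (star a * a)) →L[ℂ] c₂.φ.sub (A.D (star a * a)) :=
      (V.comp (Submodule.subtypeL _)).codRestrict _ fun ξ => HilbertRep.map_mem_sub hφ ξ.2
    have h1 : (c₂.UL a).comp j = V.comp (c₁.UL a) :=
      HilbertRep.sub_hom_ext_comp (A := A) c₁.φ fun f ξ => by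
        have h2 := h (A.δ a f) ξ
        rw [integrate_δ, integrate_δ] at h2
        refine Eq.trans ?_ h2.symm
        change c₂.UL a _ = c₂.UL a _
        congr 1
        exact Subtype.ext (hφ _ ξ)
    exact congrArg (fun T => T ξ) h1
  · rintro ⟨hφ, hU⟩ b ξ
    let T₁ : A.CrossedProduct →L[ℂ] F₂ :=
      V.comp ((ContinuousLinearMap.apply ℂ F₁ ξ).comp c₁.integrate.opL)
    let T₂ : A.CrossedProduct →L[ℂ] F₂ :=
      (ContinuousLinearMap.apply ℂ F₂ (V ξ)).comp c₂.integrate.opL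
    have h1 : T₁ = T₂ := ContinuousLinearMap.ext_on
      (Submodule.dense_iff_topologicalClosure_eq_top.2 A.dense_span_δ) (by
        rintro _ ⟨a, f, rfl⟩
        change V (c₁.integrate.op _ ξ) = c₂.integrate.op _ (V ξ)
        rw [integrate_δ, integrate_δ, genOp_apply, genOp_apply, ← hφ]
        obtain ⟨η, hη, hη'⟩ := hU a ⟨_, c₁.φ.op_mem_sub (A.comp a f).2 ξ⟩
        rw [c₁.u_of_mem (c₁.φ.op_mem_sub (A.comp a f).2 ξ), ← hη', ← c₂.u_coe, hη])
    exact congrArg (fun T => T b) h1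

end Intertwiners

variable {D F : Type*} [NonUnitalCStarAlgebra D]
  [NormedAddCommGroup F] [NormedSpace ℂ F] [CompleteSpace F] [HilbertModule D F]

theorem ext_of_op_of_U {c c' : A.CovariantRep D F} (hφ : ∀ f ξ, c.φ.op f ξ = c'.φ.op f ξ)
    (hU : ∀ (a : S) (ξ : c.φ.sub (A.D (star a * a))), ∃ η : c'.φ.sub (A.D (star a * a)),
      (η : F) = ξ ∧ (c'.U a η : F) = c.U a ξ) : c = c' := by
  obtain ⟨φ, U, _, _, _, _, _⟩ := c
  obtain ⟨φ', U', _, _, _, _, _⟩ := c'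
  obtain rfl : φ = φ' := HilbertRep.ext hφ
  obtain rfl : U = U' := by
    funext a
    refine LinearEquiv.ext fun ξ => ?_
    obtain ⟨η, hη, hη'⟩ := hU a ξ
    obtain rfl : η = ξ := Subtype.ext hη
    exact (Subtype.ext hη').symm
  rfl

theorem eq_of_integrate_eq [LocallyCompactSpace X] {c c' : A.CovariantRep D F}
    (h : c.integrate = c'.integrate) : c = c' := by
  have h1 := (integrate_intertwines_iff (ContinuousLinearMap.id ℂ F) c c').1
    (fun b ξ => by rw [h]; rfl)
  exact ext_of_op_of_U h1.1 h1.2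

/-- Covariant representations correspond to representations of the crossed product. -/
def integrateEquiv [LocallyCompactSpace X] :
    A.CovariantRep D F ≃ HilbertRep A.CrossedProduct D F where
  toFun c := c.integrate
  invFun ρ := ρ.disintegrate
  left_inv c := eq_of_integrate_eq c.integrate.integrate_disintegrate
  right_inv ρ := ρ.integrate_disintegrate

theorem integrate_intertwines_isometry_iff [LocallyCompactSpace X] {F₂ : Type*}
    [NormedAddCommGroup F₂] [NormedSpace ℂ F₂] [CompleteSpace F₂] [HilbertModule D F₂]
    (V : F →ₗ[ℂ] F₂) (hV : ∀ ξ η : F, inner D (V ξ) (V η) = inner D ξ η)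
    (c₁ : A.CovariantRep D F) (c₂ : A.CovariantRep D F₂) :
    c₁.integrate.Intertwines V c₂.integrate ↔ c₁.Intertwines V c₂ :=
  integrate_intertwines_iff (V.mkContinuous 1 fun ξ => by
    rw [one_mul]
    exact (HilbertModule.norm_eq_of_inner_eq (D := D) (hV ξ ξ)).le) c₁ c₂

end InverseSemigroupAction.CovariantRep

/-! ### Induction along correspondences -/

section Interior

open TensorProduct

variable {B D D' F E : Type*} [NonUnitalCStarAlgebra B] [NonUnitalCStarAlgebra D]
  [NonUnitalCStarAlgebra D']
  [NormedAddCommGroup F] [NormedSpace ℂ F] [CompleteSpace F] [HilbertModule D F]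
  [NormedAddCommGroup E] [NormedSpace ℂ E] [CompleteSpace E] [HilbertModule D' E]
  (ψ : HilbertRep D D' E)

theorem norm_tmul_le (ξ : F) (η : E) : ‖tmul ψ ξ η‖ ≤ ‖η‖ * ‖ξ‖ := by
  refine le_of_sq_le_sq ?_ (by positivity)
  rw [_root_.tmul, PreHilbertModule.norm_toCompletion, PreHilbertModule.nm_sq]
  change ‖inner D' η (ψ.op (inner D ξ ξ) η)‖ ≤ _
  refine (HilbertModule.norm_inner_le _ _).trans ?_
  have h := ψ.norm_op_apply_le (inner D ξ ξ) η
  rw [HilbertModule.norm_inner_self] at h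
  nlinarith [norm_nonneg η]

/-- The map `ξ ↦ ξ ⊗ η`. -/
def tmulRight (η : E) : F →L[ℂ] InteriorTensor F ψ :=
  ((interiorPre F ψ).toCompletion ∘ₗ (TensorProduct.mk ℂ F E).flip η).mkContinuous ‖η‖ fun ξ =>
    norm_tmul_le ψ ξ η

theorem denseRange_interior : DenseRange (interiorPre F ψ).toCompletion :=
  (interiorPre F ψ).isDenseInducing.dense

/-- `ρ ⊗ 1` is defined on the algebraic tensor product and bounded because `B` is a C*-algebra. -/
theorem HilbertRep.exists_isInduced (ρ : HilbertRep B D F) :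
    ∃ ρ' : HilbertRep B D' (InteriorTensor F ψ), HilbertRep.IsInduced ψ ρ ρ' := by
  let M : B → F ⊗[ℂ] E →ₗ[ℂ] F ⊗[ℂ] E := fun b => (ρ.op b).toLinearMap.rTensor E
  have hM : ∀ b ξ η, M b (ξ ⊗ₜ η) = ρ.op b ξ ⊗ₜ η := fun b ξ η => rfl
  have hinner : ∀ x y, inner D' ((interiorPre F ψ).toCompletion x)
      ((interiorPre F ψ).toCompletion y) = interiorForm F ψ x y := (interiorPre F ψ).innerC_coe
  refine Exists.imp (fun ρ' h b ξ η => ?_)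
    (HilbertRep.exists_of_dense (D := D') _ (denseRange_interior ψ) M ?_ ?_ ?_ ?_ ?_ ?_)
  · exact h b (ξ ⊗ₜ η)
  · intro b c w
    rw [← map_add]
    congr 1
    simp only [M]
    rw [map_add, ← LinearMap.add_apply, ← LinearMap.rTensor_add]
    rfl
  · intro r b w
    rw [← map_smul]
    congr 1
    simp only [M]
    rw [map_smul, ← LinearMap.smul_apply, ← LinearMap.rTensor_smul]
    rfl
  · intro b c w
    congr 1
    simp only [M]
    rw [map_mul, ← LinearMap.comp_apply, ← LinearMap.rTensor_comp]
    rfl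
  · intro b x y
    rw [hinner, hinner]
    induction x using TensorProduct.induction_on with
    | zero => simp
    | add x x' hx hx' => simp only [map_add, LinearMap.add_apply, hx, hx']
    | tmul ξ η =>
      induction y using TensorProduct.induction_on with
      | zero => simp
      | add x x' hx hx' => simp only [map_add, hx, hx']
      | tmul ξ' η' => rw [hM, hM, interiorForm_tmul, interiorForm_tmul, ρ.adjoint]
  · intro w
    induction w using TensorProduct.induction_on with
    | zero => exact ⟨0, fun b => by simp⟩
    | add x x' hx hx' =>
      obtain ⟨C, hC⟩ := hx
      obtain ⟨C', hC'⟩ := hx'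
      refine ⟨C + C', fun b => ?_⟩
      rw [map_add, map_add, add_mul]
      exact norm_add_le_of_le (hC b) (hC' b)
    | tmul ξ η =>
      refine ⟨‖η‖ * ‖ξ‖, fun b => (norm_tmul_le ψ _ η).trans ?_⟩
      calc ‖η‖ * ‖ρ.op b ξ‖ ≤ ‖η‖ * (‖b‖ * ‖ξ‖) :=
            mul_le_mul_of_nonneg_left (ρ.norm_op_apply_le b ξ) (norm_nonneg η)
        _ = ‖η‖ * ‖ξ‖ * ‖b‖ := by ring
  · set t := (Submodule.span ℂ {ζ : InteriorTensor F ψ | ∃ b w,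
      ζ = (interiorPre F ψ).toCompletion (M b w)}).topologicalClosure
    have ht : IsClosed (t : Set (InteriorTensor F ψ)) := Submodule.isClosed_topologicalClosure _
    have h1 : ∀ ξ η, tmul ψ ξ η ∈ t := by
      intro ξ η
      have h2 : (Submodule.span ℂ {ζ : F | ∃ b ξ, ζ = ρ.op b ξ}).topologicalClosure
          ≤ t.comap (tmulRight ψ η).toLinearMap := by
        refine Submodule.topologicalClosure_minimal _ (Submodule.span_le.2 ?_)
          (ht.preimage (tmulRight ψ η).continuous)
        rintro _ ⟨b, ξ, rfl⟩
        exact Submodule.le_topologicalClosure _ (Submodule.subset_span ⟨b, ξ ⊗ₜ η, rfl⟩)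
      rw [ρ.nondegenerate] at h2
      exact h2 (Submodule.mem_top : ξ ∈ _)
    rw [Submodule.eq_top_iff']
    intro ζ
    refine (interiorPre F ψ).induction ζ ht fun x => ?_
    induction x using TensorProduct.induction_on with
    | zero => rw [map_zero]; exact Submodule.zero_mem _
    | add x y hx hy => rw [map_add]; exact Submodule.add_mem _ hx hy
    | tmul ξ η => exact h1 ξ η

theorem HilbertRep.IsInduced.unique {ρ : HilbertRep B D F}
    {ρ₁ ρ₂ : HilbertRep B D' (InteriorTensor F ψ)} (h₁ : HilbertRep.IsInduced ψ ρ ρ₁)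
    (h₂ : HilbertRep.IsInduced ψ ρ ρ₂) : ρ₁ = ρ₂ := by
  refine HilbertRep.ext fun b ζ => ?_
  refine (interiorPre F ψ).induction ζ
    (isClosed_eq (ρ₁.op b).continuous (ρ₂.op b).continuous) fun x => ?_
  induction x using TensorProduct.induction_on with
  | zero => rw [map_zero, map_zero, map_zero]
  | add x y hx hy => rw [map_add, map_add, map_add, hx, hy]
  | tmul ξ η => exact (h₁ b ξ η).trans (h₂ b ξ η).symm

theorem HilbertRep.existsUnique_isInduced (ρ : HilbertRep B D F) :
    ∃! ρ' : HilbertRep B D' (InteriorTensor F ψ), HilbertRep.IsInduced ψ ρ ρ' := by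
  obtain ⟨ρ', h⟩ := HilbertRep.exists_isInduced ψ ρ
  exact ⟨ρ', h, fun _ h' => HilbertRep.IsInduced.unique ψ h' h⟩

namespace InverseSemigroupAction.CovariantRep

variable {S X : Type*} [InverseSemigroup S] [TopologicalSpace X] [T2Space X]
  [LocallyCompactSpace X] {A : InverseSemigroupAction S X}

/-- Induction means that all the maps `ξ ↦ ξ ⊗ η` are intertwiners. -/
theorem isInduced_iff (c : A.CovariantRep D F) (c' : A.CovariantRep D' (InteriorTensor F ψ)) :
    c.IsInduced ψ c' ↔ HilbertRep.IsInduced ψ c.integrate c'.integrate := by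
  have key := fun η : E => integrate_intertwines_iff (tmulRight ψ η) c c'
  constructor
  · rintro ⟨h1, h2⟩ b ξ η
    exact (((key η).2 ⟨fun f ξ => (h1 f ξ η).symm, fun a ξ => h2 a ξ η⟩) b ξ).symm
  · intro h
    have h' := fun η => (key η).1 fun b ξ => (h b ξ η).symm
    exact ⟨fun f ξ η => ((h' η).1 f ξ).symm, fun a ζ η => (h' η).2 a ζ⟩

theorem existsUnique_isInduced (c : A.CovariantRep D F) :
    ∃! c' : A.CovariantRep D' (InteriorTensor F ψ), c.IsInduced ψ c' := by
  obtain ⟨ρ', h, hu⟩ := HilbertRep.existsUnique_isInduced ψ c.integrate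
  refine ⟨ρ'.disintegrate, ?_, fun c' h' => eq_of_integrate_eq ?_⟩
  · exact (isInduced_iff ψ c _).2 (by rwa [ρ'.integrate_disintegrate])
  · rw [ρ'.integrate_disintegrate]
    exact hu _ ((isInduced_iff ψ c c').1 h')

end InverseSemigroupAction.CovariantRep

end Interior

end

theorem mainTheorem7 {S : Type u} {X : Type v} [InverseSemigroup S]
    [TopologicalSpace X] [T2Space X] [LocallyCompactSpace X] (A : InverseSemigroupAction S X) :
    ∃ Φ : ∀ (D : Type w) [NonUnitalCStarAlgebra D] (F : Type z) [NormedAddCommGroup F]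
        [NormedSpace ℂ F] [CompleteSpace F] [HilbertModule D F],
        A.CovariantRep D F ≃ HilbertRep A.CrossedProduct D F,
      -- the integrated form: `f δ_a` acts by `φ(f) U_a`
      (∀ (D : Type w) [NonUnitalCStarAlgebra D] (F : Type z) [NormedAddCommGroup F]
        [NormedSpace ℂ F] [CompleteSpace F] [HilbertModule D F] (c : A.CovariantRep D F)
        (a : S) (f : C0On (A.D (a * star a))) (ξ : c.φ.sub (A.D (star a * a))),
        (Φ D F c).op (A.δ a f) ξ = c.φ.op f (c.U a ξ)) ∧
      -- naturality for isometries
      (∀ (D : Type w) [NonUnitalCStarAlgebra D]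
        (F₁ : Type z) [NormedAddCommGroup F₁] [NormedSpace ℂ F₁] [CompleteSpace F₁]
        [HilbertModule D F₁]
        (F₂ : Type z) [NormedAddCommGroup F₂] [NormedSpace ℂ F₂] [CompleteSpace F₂]
        [HilbertModule D F₂]
        (V : F₁ →ₗ[ℂ] F₂) (_hV : ∀ ξ η : F₁, inner D (V ξ) (V η) = inner D ξ η)
        (c₁ : A.CovariantRep D F₁) (c₂ : A.CovariantRep D F₂),
        (Φ D F₁ c₁).Intertwines V (Φ D F₂ c₂) ↔ c₁.Intertwines V c₂) ∧
      -- compatibility with induction along correspondences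
      (∀ (D : Type w) [NonUnitalCStarAlgebra D] (D' : Type w) [NonUnitalCStarAlgebra D']
        (F : Type z) [NormedAddCommGroup F] [NormedSpace ℂ F] [CompleteSpace F]
        [HilbertModule D F]
        (E : Type z) [NormedAddCommGroup E] [NormedSpace ℂ E] [CompleteSpace E]
        [HilbertModule D' E] (ψ : HilbertRep D D' E),
        (∀ c : A.CovariantRep D F,
          ∃! c' : A.CovariantRep D' (InteriorTensor F ψ), c.IsInduced ψ c') ∧
        (∀ ρ : HilbertRep A.CrossedProduct D F,
          ∃! ρ' : HilbertRep A.CrossedProduct D' (InteriorTensor F ψ), HilbertRep.IsInduced ψ ρ ρ') ∧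
        (∀ (c : A.CovariantRep D F) (c' : A.CovariantRep D' (InteriorTensor F ψ)),
          c.IsInduced ψ c' ↔ HilbertRep.IsInduced ψ (Φ D F c) (Φ D' (InteriorTensor F ψ) c'))) := by
  exact ⟨fun D _ F _ _ _ _ => InverseSemigroupAction.CovariantRep.integrateEquiv,
    fun D _ F _ _ _ _ c a f ξ => (c.integrate_δ a f ξ).trans (c.genOp_apply_of_mem a f ξ),
    fun D _ F₁ _ _ _ _ F₂ _ _ _ _ V hV c₁ c₂ =>
      InverseSemigroupAction.CovariantRep.integrate_intertwines_isometry_iff V hV c₁ c₂,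
    fun D _ D' _ F _ _ _ _ E _ _ _ _ ψ =>
      ⟨fun c => InverseSemigroupAction.CovariantRep.existsUnique_isInduced ψ c,
        fun ρ => HilbertRep.existsUnique_isInduced ψ ρ,
        fun c c' => InverseSemigroupAction.CovariantRep.isInduced_iff ψ c c'⟩⟩
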